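/- Conventions. Let $K$ be a field. The left triangular part $\mathrm{Left}(A)$ of an $n\times n$ matrix $A$ keeps the entries $A_{i,j}$ with $i\le n-j$ and replaces the others by $0$; its (left) quasiseparable order is $s=\max_{1\le k\le n-1}\operatorname{rank}(A_{1..k,1..n-k})$ (and $s=0$ if $n\le 1$). The rank profile matrix $\mathcal R_A$ of an $m\times n$ matrix $A$ is the $0/1$ matrix with $\operatorname{rank}(A)$ ones, on distinct rows and columns, each leading submatrix of which has the same rank as the corresponding leading submatrix of $A$. A PLUQ decomposition $A=P\begin{bmatrix}L\\M\end{bmatrix}\begin{bmatrix}U&V\end{bmatrix}Q$ ($P,Q$ permutation matrices, $L$ an $r\times r$ unit lower triangular matrix, $U$ an $r\times r$ invertible upper triangular matrix) reveals the rank profile matrix if $P\begin{bmatrix}I_r&0\\0&0\end{bmatrix}Q=\mathcal R_A$, $P\begin{bmatrix}L&0\\M&0\end{bmatrix}P^T$ is lower triangular and $Q^T\begin{bmatrix}U&V\\0&0\end{bmatrix}Q$ is upper triangular. A Bruhat generator of a left triangular $n\times n$ matrix $A$ is a triple $$\mathcal L=\mathrm{Left}\Big(P\begin{bmatrix}L&0\\M&0\end{bmatrix}Q\Big),\quad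 \mathcal E=\mathrm{Left}\Big(P\begin{bmatrix}I_r&0\\0&0\end{bmatrix}Q\Big)=\mathrm{Left}(\mathcal R_A),\quad \mathcal U=\mathrm{Left}\Big(P\begin{bmatrix}U&V\\0&0\end{bmatrix}Q\Big)$$ obtained from a PLUQ decomposition of $A$ that reveals its rank profile matrix. Algorithm LT-Bruhat. Input: an $n\times n$ matrix $A$. If $n\le1$, return three zero matrices. Otherwise split $A=\begin{bmatrix}A_1&A_2\\A_3&*\end{bmatrix}$ with $A_2$ of order $\lceil n/2\rceil$ and $A_3$ of order $\lfloor n/2\rfloor$; compute a PLUQ decomposition $A_1=P_1\begin{bmatrix}L_1\\M_1\end{bmatrix}\begin{bmatrix}U_1&V_1\end{bmatrix}Q_1$ revealing the rank profile matrix $R_1$ of $A_1$; put $\begin{bmatrix}B_1\\B_2\end{bmatrix}=P_1^TA_2$, $\begin{bmatrix}C_1&C_2\end{bmatrix}=A_3Q_1^T$, $D=L_1^{-1}B_1$, $E=C_1U_1^{-1}$, $F=B_2-M_1D$, $G=C_2-EV_1$, $H=P_1\begin{bmatrix}0\\F\end{bmatrix}$, $I=\begin{bmatrix}0&G\end{bmatrix}Q_1$;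 let $(\mathcal L_2,\mathcal E_2,\mathcal U_2)$ and $(\mathcal L_3,\mathcal E_3,\mathcal U_3)$ be the results of the recursive calls on $H$ and $I$; return $$\mathcal L=\mathrm{Left}\begin{bmatrix}P_1\begin{bmatrix}L_1&0\\M_1&0\end{bmatrix}Q_1&0\\\begin{bmatrix}E&0\end{bmatrix}Q_1&0\end{bmatrix}+\begin{bmatrix}0&\mathcal L_2\\\mathcal L_3&0\end{bmatrix},\quad \mathcal E=\begin{bmatrix}R_1&\mathcal E_2\\\mathcal E_3&0\end{bmatrix},$$ $$\mathcal U=\begin{bmatrix}P_1\begin{bmatrix}U_1&V_1\\0&0\end{bmatrix}Q_1&\mathrm{Left}\Big(P_1\begin{bmatrix}D\\0\end{bmatrix}\Big)\\0&0\end{bmatrix}+\begin{bmatrix}0&\mathcal U_2\\\mathcal U_3&0\end{bmatrix}.$$ The PLUQ decomposition, the triangular solves $L^{-1}B$, $CU^{-1}$ and the products $B-MD$ are delegated to subroutines. Algorithms are algebraic computation trees over $K$ (constants of $K$ are free); every arithmetic operation and every zero test counts as one field operation. Theorem. Let $\omega>2$ be a real number. 1. For every field $K$ and every choice of correct subroutines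 (the PLUQ subroutine returning a decomposition that reveals the rank profile matrix), and for every $n\times n$ matrix $A$ over $K$, Algorithm LT-Bruhat computes a Bruhat generator $(\mathcal L,\mathcal E,\mathcal U)$ of $\mathrm{Left}(A)$. 2. For every $c$ there is a constant $C$, depending only on $\omega$ and $c$, such that for every field $K$ and all correct subroutines with costs at most $c\,mn\max(r,1)^{\omega-2}$ (PLUQ of an $m\times n$ matrix of rank $r$), $c\,r^{\omega-1}(r+n)$ (triangular solve of order $r$ with $n$ right-hand sides, on either side) and $c\,(m+k)(n+k)\max(k,1)^{\omega-2}$ ($B-MD$ with $M$ of size $m\times k$ and $D$ of size $k\times n$), Algorithm LT-Bruhat uses at most $C\max(s,1)^{\omega-2}n^2$ field operations on every $n\times n$ matrix $A$ over $K$, where $s$ is the quasiseparable order of $\mathrm{Left}(A)$. 3. For every $c$ there is a constant $C$, depending only on $\omega$ and $c$, such that over every field $K$ over which, for all $n$, $n\times n$ matrices can be multiplied in at most $c\,n^\omega$ field operations, there are correct subroutines with costs at most those listed in 2 with $C$ in place of $c$, for which Algorithm LT-Bruhat uses at most $C\max(s,1)^{\omega-2}n^2$ field operations on every $n\times n$ matrix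 over $K$ with left triangular part of quasiseparable order $s$. -/

import Mathlib

open Matrix

universe u

namespace QuasiSep

section Matrices

variable {X : Type*} {K : Type*} [Field K] {m n : ℕ}

/-- The left triangular part of a matrix: with 1-based indices, the entries with `i ≤ n - j` are
kept and all the others are replaced by `z` (the zero of the entry type). -/
def leftPart (z : X) (A : Matrix (Fin m) (Fin n) X) : Matrix (Fin m) (Fin n) X :=
  Matrix.of fun i j => if (i : ℕ) + 1 + ((j : ℕ) + 1) ≤ n then A i j else z

/-- The leading submatrix of `A` made of its first `k` rows and first `l` columns. -/
def leading (A : Matrix (Fin m) (Fin n) K) (k l : ℕ) :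
    Matrix {i : Fin m // (i : ℕ) < k} {j : Fin n // (j : ℕ) < l} K :=
  A.submatrix Subtype.val Subtype.val

/-- The left quasiseparable order: the largest rank of a leading `k × (n - k)` submatrix,
`1 ≤ k ≤ n - 1`. -/
noncomputable def quasiOrder (A : Matrix (Fin n) (Fin n) K) : ℕ :=
  (Finset.Icc 1 (n - 1)).sup fun k => (leading A k (n - k)).rank

/-- `R` is the rank profile matrix of `A`: it has exactly `rank A` non-zero entries, all equal to
one and on distinct rows and columns, and each of its leading submatrices has the rank of the
corresponding leading submatrix of `A`. -/
def IsRankProfileMatrix (A R : Matrix (Fin m) (Fin n) K) : Prop :=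
  (∀ i j, R i j = 0 ∨ R i j = 1) ∧
  (∀ i j j', R i j ≠ 0 → R i j' ≠ 0 → j = j') ∧
  (∀ i i' j, R i j ≠ 0 → R i' j ≠ 0 → i = i') ∧
  {x : Fin m × Fin n | R x.1 x.2 ≠ 0}.ncard = A.rank ∧
  ∀ k l, (leading R k l).rank = (leading A k l).rank

/-- The data of a decomposition `P [L; M] [U V] Q` of an `m × n` matrix, `L` and `U` being
`r × r`. The permutation matrices `P` and `Q` are stored as bijections: `P i k = 1` iff `p i = k`
and `Q k j = 1` iff `q j = k`. Hence `P X Q` is `X.submatrix p q`, and `Pᵀ Y` is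
`Y.submatrix p.symm id`, and `Y Qᵀ` is `Y.submatrix id q.symm`. -/
structure PLUQ (m n : ℕ) (X : Type*) where
  r : ℕ
  p : Fin m ≃ Fin r ⊕ Fin (m - r)
  q : Fin n ≃ Fin r ⊕ Fin (n - r)
  L : Matrix (Fin r) (Fin r) X
  M : Matrix (Fin (m - r)) (Fin r) X
  U : Matrix (Fin r) (Fin r) X
  V : Matrix (Fin r) (Fin (n - r)) X

/-- The matrix with constant entry `z`. -/
def constMatrix {ι κ : Type*} (z : X) : Matrix ι κ X := Matrix.of fun _ _ => z

/-- `P [I_r 0; 0 0] Q`, where `z` and `o` are the zero and the one of the entry type. -/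
def PLUQ.pivots {Y : Type*} (d : PLUQ m n Y) (z o : X) : Matrix (Fin m) (Fin n) X :=
  (fromBlocks (Matrix.of fun i j => if i = j then o else z)
    (constMatrix z) (constMatrix z) (constMatrix z)).submatrix d.p d.q

/-- Unit lower triangular matrices. -/
def UnitLower {r : ℕ} (L : Matrix (Fin r) (Fin r) K) : Prop :=
  (∀ i, L i i = 1) ∧ ∀ i j, i < j → L i j = 0

/-- Invertible upper triangular matrices. -/
def InvUpper {r : ℕ} (U : Matrix (Fin r) (Fin r) K) : Prop :=
  (∀ i, U i i ≠ 0) ∧ ∀ i j, j < i → U i j = 0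

/-- `d` is a PLUQ decomposition of `A` revealing the rank profile matrix: `A = P [L; M] [U V] Q`,
the matrix `P [I_r 0; 0 0] Q` is the rank profile matrix of `A`, and `P [L 0; M 0] Pᵀ` is lower
triangular and `Qᵀ [U V; 0 0] Q` is upper triangular. -/
structure PLUQ.Reveals (d : PLUQ m n K) (A : Matrix (Fin m) (Fin n) K) : Prop where
  unitLower : UnitLower d.L
  invUpper : InvUpper d.U
  eq : A = (fromRows d.L d.M * fromCols d.U d.V).submatrix d.p d.q
  rankProfile : IsRankProfileMatrix A (d.pivots 0 1)
  lower : ∀ i j, i < j → (fromBlocks d.L 0 d.M (0 : Matrix _ (Fin (m - d.r)) K)) (d.p i) (d.p j) = 0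
  upper : ∀ i j, j < i → (fromBlocks d.U d.V 0 (0 : Matrix (Fin (n - d.r)) _ K)) (d.q i) (d.q j) = 0

/-- Three `n × n` matrices, the shape of a Bruhat generator. -/
structure Triple (n : ℕ) (X : Type*) where
  L : Matrix (Fin n) (Fin n) X
  E : Matrix (Fin n) (Fin n) X
  U : Matrix (Fin n) (Fin n) X

/-- `T` is a Bruhat generator of the (left triangular) matrix `A`: for some PLUQ decomposition
of `A` revealing its rank profile matrix, `T` consists of the left triangular parts of
`P [L 0; M 0] Q`, of the rank profile matrix `P [I_r 0; 0 0] Q` and of `P [U V; 0 0] Q`. -/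
def IsBruhatGenerator (A : Matrix (Fin n) (Fin n) K) (T : Triple n K) : Prop :=
  ∃ d : PLUQ n n K, d.Reveals A ∧
    T.L = leftPart 0 ((fromBlocks d.L 0 d.M 0).submatrix d.p d.q) ∧
    T.E = leftPart 0 (d.pivots 0 1) ∧
    T.U = leftPart 0 ((fromBlocks d.U d.V 0 0).submatrix d.p d.q)

end Matrices

section Model

/-- The four operations of a field. -/
inductive ArithOp
  | add | sub | mul | div

/-- The value of an operation (with the convention `x / 0 = 0`). -/
def ArithOp.eval {K : Type u} [Field K] : ArithOp → K → K → K
  | .add, x, y => x + y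
  | .sub, x, y => x - y
  | .mul, x, y => x * y
  | .div, x, y => x / y

/-- Programs over a field `K` (algebraic computation trees). A program never sees a field element:
it only handles addresses in a memory, to which constants and results of operations are appended.
The continuation receives the address of the new element, or the answer of a zero test. -/
inductive Prog (K : Type u) (α : Type) : Type u
  | ret (a : α) : Prog K α
  | const (c : K) (k : ℕ → Prog K α) : Prog K α
  | arith (o : ArithOp) (i j : ℕ) (k : ℕ → Prog K α) : Prog K α
  | isZero (i : ℕ) (k : Bool → Prog K α) : Prog K α

variable {K : Type u} {α β : Type}

def Prog.bind : Prog K α → (α → Prog K β) → Prog K β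
  | .ret a, f => f a
  | .const c k, f => .const c fun a => (k a).bind f
  | .arith o i j k, f => .arith o i j fun a => (k a).bind f
  | .isZero i k, f => .isZero i fun b => (k b).bind f

instance : Monad (Prog K) where
  pure := Prog.ret
  bind := Prog.bind

/-- The outcome of an execution: result, final memory, and number of field operations
(arithmetic operations and zero tests). -/
structure Outcome (K : Type u) (α : Type) where
  val : α
  mem : List K
  cost : ℕ

open Classical in
/-- Execution of a program on an initial memory. -/
noncomputable def Prog.run [Field K] : Prog K α → List K → Outcome K α
  | .ret a, σ => ⟨a, σ, 0⟩
  | .const c k, σ => (k σ.length).run (σ ++ [c])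
  | .arith o i j k, σ =>
      let R := (k σ.length).run (σ ++ [o.eval (σ.getD i 0) (σ.getD j 0)])
      ⟨R.val, R.mem, R.cost + 1⟩
  | .isZero i k, σ =>
      let R := (k (decide (σ.getD i 0 = 0))).run σ
      ⟨R.val, R.mem, R.cost + 1⟩

/-- In the memory `σ`, the cells whose addresses are the entries of `A` exist and hold the entries
of the matrix `V`. -/
def Rep {ι κ : Type*} (σ : List K) (A : Matrix ι κ ℕ) (V : Matrix ι κ K) : Prop :=
  ∀ i j, σ[A i j]? = some (V i j)

/-- Run the programs `f 0, …, f (n - 1)` in this order and collect the results. -/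
def Prog.forFin : (n : ℕ) → (Fin n → Prog K α) → Prog K (Fin n → α)
  | 0, _ => pure Fin.elim0
  | n + 1, f => do
      let a ← f 0
      let g ← Prog.forFin n fun i => f i.succ
      return Fin.cons a g

/-- Entrywise addition of two matrices. -/
def addMatrix {m n : ℕ} (A B : Matrix (Fin m) (Fin n) ℕ) :
    Prog K (Matrix (Fin m) (Fin n) ℕ) := do
  let C ← Prog.forFin m fun i => Prog.forFin n fun j => Prog.arith .add (A i j) (B i j) Prog.ret
  return Matrix.of C

/-- Two `n × n` matrices over `K` can be multiplied in at most `c * n ^ ω` field operations. -/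
def MatMulIn (K : Type u) [Field K] (ω c : ℝ) : Prop :=
  ∀ n : ℕ, ∃ mul : Matrix (Fin n) (Fin n) ℕ → Matrix (Fin n) (Fin n) ℕ →
      Prog K (Matrix (Fin n) (Fin n) ℕ),
    ∀ (σ : List K) (A B : Matrix (Fin n) (Fin n) ℕ) (VA VB : Matrix (Fin n) (Fin n) K),
      Rep σ A VA → Rep σ B VB →
        Rep ((mul A B).run σ).mem ((mul A B).run σ).val (VA * VB) ∧
        (((mul A B).run σ).cost : ℝ) ≤ c * (n : ℝ) ^ ω

end Model

section Algorithm

/-- Programs for the four tasks that the algorithm delegates: PLUQ decomposition, `L⁻¹ B`,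
`C U⁻¹` and `B - M D`. -/
structure Subroutines (K : Type u) where
  pluq : (m n : ℕ) → Matrix (Fin m) (Fin n) ℕ → Prog K (PLUQ m n ℕ)
  trsmLower : (r n : ℕ) → Matrix (Fin r) (Fin r) ℕ → Matrix (Fin r) (Fin n) ℕ →
    Prog K (Matrix (Fin r) (Fin n) ℕ)
  trsmUpper : (m r : ℕ) → Matrix (Fin m) (Fin r) ℕ → Matrix (Fin r) (Fin r) ℕ →
    Prog K (Matrix (Fin m) (Fin r) ℕ)
  mm : (m k n : ℕ) → Matrix (Fin m) (Fin n) ℕ → Matrix (Fin m) (Fin k) ℕ →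
    Matrix (Fin k) (Fin n) ℕ → Prog K (Matrix (Fin m) (Fin n) ℕ)

variable {K : Type u}

/-- The subroutines compute what they are meant to compute. -/
structure Subroutines.Correct [Field K] (S : Subroutines K) : Prop where
  pluq : ∀ (m n : ℕ) (σ : List K) (A : Matrix (Fin m) (Fin n) ℕ) (W : Matrix (Fin m) (Fin n) K),
    Rep σ A W →
      let R := (S.pluq m n A).run σ
      ∃ L M U V, Rep R.mem R.val.L L ∧ Rep R.mem R.val.M M ∧
        Rep R.mem R.val.U U ∧ Rep R.mem R.val.V V ∧
        (⟨R.val.r, R.val.p, R.val.q, L, M, U, V⟩ : PLUQ m n K).Reveals W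
  trsmLower : ∀ (r n : ℕ) (σ : List K) (L : Matrix (Fin r) (Fin r) ℕ)
    (B : Matrix (Fin r) (Fin n) ℕ) (VL : Matrix (Fin r) (Fin r) K) (VB : Matrix (Fin r) (Fin n) K),
    UnitLower VL → Rep σ L VL → Rep σ B VB →
      let R := (S.trsmLower r n L B).run σ
      Rep R.mem R.val (VL⁻¹ * VB)
  trsmUpper : ∀ (m r : ℕ) (σ : List K) (C : Matrix (Fin m) (Fin r) ℕ)
    (U : Matrix (Fin r) (Fin r) ℕ) (VC : Matrix (Fin m) (Fin r) K) (VU : Matrix (Fin r) (Fin r) K),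
    InvUpper VU → Rep σ C VC → Rep σ U VU →
      let R := (S.trsmUpper m r C U).run σ
      Rep R.mem R.val (VC * VU⁻¹)
  mm : ∀ (m k n : ℕ) (σ : List K) (B : Matrix (Fin m) (Fin n) ℕ) (M : Matrix (Fin m) (Fin k) ℕ)
    (D : Matrix (Fin k) (Fin n) ℕ) (VB : Matrix (Fin m) (Fin n) K) (VM : Matrix (Fin m) (Fin k) K)
    (VD : Matrix (Fin k) (Fin n) K),
    Rep σ B VB → Rep σ M VM → Rep σ D VD →
      let R := (S.mm m k n B M D).run σ
      Rep R.mem R.val (VB - VM * VD)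

/-- The subroutines run within the usual costs, relative to an exponent `ω` and a constant `c`:
a PLUQ decomposition of an `m × n` matrix of rank `r` in `O(m n r ^ (ω - 2))`, a triangular solve of
order `r` with `n` right-hand sides in `O(r ^ (ω - 1) (r + n))`, and `B - M D` with inner dimension
`k` in `O((m + k) (n + k) k ^ (ω - 2))`. Inspecting an `m × n` matrix is allowed even if it turns
out to be zero, hence the maxima. -/
structure Subroutines.CostIn [Field K] (S : Subroutines K) (ω c : ℝ) : Prop where
  pluq : ∀ (m n : ℕ) (σ : List K) (A : Matrix (Fin m) (Fin n) ℕ) (W : Matrix (Fin m) (Fin n) K),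
    Rep σ A W →
      (((S.pluq m n A).run σ).cost : ℝ) ≤ c * m * n * ((max W.rank 1 : ℕ) : ℝ) ^ (ω - 2)
  trsmLower : ∀ (r n : ℕ) (σ : List K) (L : Matrix (Fin r) (Fin r) ℕ)
    (B : Matrix (Fin r) (Fin n) ℕ) (VL : Matrix (Fin r) (Fin r) K) (VB : Matrix (Fin r) (Fin n) K),
    UnitLower VL → Rep σ L VL → Rep σ B VB →
      (((S.trsmLower r n L B).run σ).cost : ℝ) ≤ c * (r : ℝ) ^ (ω - 1) * (r + n)
  trsmUpper : ∀ (m r : ℕ) (σ : List K) (C : Matrix (Fin m) (Fin r) ℕ)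
    (U : Matrix (Fin r) (Fin r) ℕ) (VC : Matrix (Fin m) (Fin r) K) (VU : Matrix (Fin r) (Fin r) K),
    InvUpper VU → Rep σ C VC → Rep σ U VU →
      (((S.trsmUpper m r C U).run σ).cost : ℝ) ≤ c * (r : ℝ) ^ (ω - 1) * (m + r)
  mm : ∀ (m k n : ℕ) (σ : List K) (B : Matrix (Fin m) (Fin n) ℕ) (M : Matrix (Fin m) (Fin k) ℕ)
    (D : Matrix (Fin k) (Fin n) ℕ) (VB : Matrix (Fin m) (Fin n) K) (VM : Matrix (Fin m) (Fin k) K)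
    (VD : Matrix (Fin k) (Fin n) K),
    Rep σ B VB → Rep σ M VM → Rep σ D VD →
      (((S.mm m k n B M D).run σ).cost : ℝ) ≤
        c * (m + k) * (n + k) * ((max k 1 : ℕ) : ℝ) ^ (ω - 2)

/-- Rows of an `n × n` matrix: the first `⌈n/2⌉`, then the last `⌊n/2⌋`. -/
def rowSplit (n : ℕ) : Fin n ≃ Fin (n - n / 2) ⊕ Fin (n / 2) :=
  (finCongr (by omega)).trans finSumFinEquiv.symm

/-- Columns of an `n × n` matrix: the first `⌊n/2⌋`, then the last `⌈n/2⌉`. -/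
def colSplit (n : ℕ) : Fin n ≃ Fin (n / 2) ⊕ Fin (n - n / 2) :=
  (finCongr (by omega)).trans finSumFinEquiv.symm

/-- The `n × n` matrix `[A₁ A₂; A₃ A₄]` with `A₂` of order `⌈n/2⌉` and `A₃` of order `⌊n/2⌋`. -/
def assemble {X : Type*} (n : ℕ)
    (A₁ : Matrix (Fin (n - n / 2)) (Fin (n / 2)) X)
    (A₂ : Matrix (Fin (n - n / 2)) (Fin (n - n / 2)) X)
    (A₃ : Matrix (Fin (n / 2)) (Fin (n / 2)) X)
    (A₄ : Matrix (Fin (n / 2)) (Fin (n - n / 2)) X) : Matrix (Fin n) (Fin n) X :=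
  (fromBlocks A₁ A₂ A₃ A₄).submatrix (rowSplit n) (colSplit n)

/-- Algorithm LT-Bruhat. -/
def ltBruhat [Field K] (S : Subroutines K) (n : ℕ) (A : Matrix (Fin n) (Fin n) ℕ) :
    Prog K (Triple n ℕ) :=
  if _hn : n ≤ 1 then do
    let z ← Prog.const 0 Prog.ret
    return ⟨constMatrix z, constMatrix z, constMatrix z⟩
  else do
    let z ← Prog.const 0 Prog.ret
    let o ← Prog.const 1 Prog.ret
    let A' := A.submatrix (rowSplit n).symm (colSplit n).symm
    let A₁ := A'.toBlocks₁₁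
    let A₂ := A'.toBlocks₁₂
    let A₃ := A'.toBlocks₂₁
    let d ← S.pluq _ _ A₁
    let R₁ := d.pivots z o
    -- `[B₁; B₂] = P₁ᵀ A₂` and `[C₁ C₂] = A₃ Q₁ᵀ`
    let B := A₂.submatrix d.p.symm id
    let C := A₃.submatrix id d.q.symm
    let D ← S.trsmLower _ _ d.L B.toRows₁
    let E ← S.trsmUpper _ _ C.toCols₁ d.U
    let F ← S.mm _ _ _ B.toRows₂ d.M D
    let G ← S.mm _ _ _ C.toCols₂ E d.V
    -- `H = P₁ [0; F]` and `I = [0 G] Q₁`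
    let H := (fromRows (constMatrix z) F).submatrix d.p id
    let I := (fromCols (constMatrix z) G).submatrix id d.q
    let T₂ ← ltBruhat S (n - n / 2) H
    let T₃ ← ltBruhat S (n / 2) I
    let calL ← addMatrix
      (leftPart z (assemble n
        ((fromBlocks d.L (constMatrix z) d.M (constMatrix z)).submatrix d.p d.q) (constMatrix z)
        ((fromCols E (constMatrix z)).submatrix id d.q) (constMatrix z)))
      (assemble n (constMatrix z) T₂.L T₃.L (constMatrix z))
    let calU ← addMatrix
      (assemble n
        ((fromBlocks d.U d.V (constMatrix z) (constMatrix z)).submatrix d.p d.q)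
        (leftPart z ((fromRows D (constMatrix z)).submatrix d.p id))
        (constMatrix z) (constMatrix z))
      (assemble n (constMatrix z) T₂.U T₃.U (constMatrix z))
    let calE := assemble n R₁ T₂.E T₃.E (constMatrix z)
    return ⟨calL, calE, calU⟩
termination_by n

end Algorithm

end QuasiSep

set_option linter.unusedSectionVars false

/-! The proof rests on one notion, `IsElimination`: Gaussian elimination carried out only on a
down-closed region of cells. Pivots are ordered; each column vector starts at its pivot row, each
row vector at its pivot column, and both vanish at the earlier pivots. On the full region this
amounts to a PLUQ decomposition revealing the rank profile matrix: only the pivots lying in a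
leading block contribute to it, so its rank is the number of those pivots (`restrict`, `rank_eq`,
`isRankProfileMatrix`).

Correctness. At one level of the recursion the vectors that eliminate `A₁` are prolonged by `E` and
`D`. What remains of the matrix vanishes on the pivot rows and columns already used, so eliminations
of the two residuals `H` and `I`, which occupy disjoint rows and columns, can simply be appended;
the bottom right block lies outside the left triangle (`isElimination_step`). The algorithm
therefore produces an elimination on the left triangle only, while a Bruhat generator asks for a
decomposition of the whole matrix. `exists_extension` bridges the gap: missing cells are added one
at a time, and nothing recorded inside the region changes.

Cost. The rank of `A₁` is at most `s`, so one level costs `O(s ^ (ω - 2) n ^ 2)`. The residuals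
again have quasiseparable order at most `s`, because elimination only adds to columns (or rows)
combinations of columns (or rows) of the same leading block (`quasiOrder_top_right_le`,
`quasiOrder_bot_left_le`). Two calls of half the size make the total a geometric sum
(`recurrence_le`).

Subroutines. Products are computed by square tiles, triangular solves by halving, PLUQ by halving
the columns. In the last case the rank may split unevenly between the two halves, and concavity of a
power function still yields a gain by a fixed factor (`halving_mul_rpow`). -/

namespace QuasiSep

/-! ### Gaussian elimination on a down-closed region, and its extension to all cells. -/

section Elimination

variable {K : Type*} [Field K] {ρ κ : Type*} [LinearOrder ρ] [LinearOrder κ]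

/-- A Gaussian elimination of the matrix `A` on the region `S`: a sequence of pivots
`(row k, col k)` in `S`, with column vectors `l · k` and row vectors `u k ·`, such that `A`
is the sum of the products `l · k * u k ·` on `S`. -/
structure IsElimination (S : ρ → κ → Prop) (A : Matrix ρ κ K) {r : ℕ} (row : Fin r → ρ)
    (col : Fin r → κ) (l : Matrix ρ (Fin r) K) (u : Matrix (Fin r) κ K) : Prop where
  l_lower : ∀ i k, i < row k → l i k = 0
  l_diag : ∀ k, l (row k) k = 1
  l_tri : ∀ t k, t < k → l (row t) k = 0
  l_supp : ∀ i k, ¬ S i (col k) → l i k = 0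
  u_upper : ∀ k j, j < col k → u k j = 0
  u_diag : ∀ k, u k (col k) ≠ 0
  u_tri : ∀ t k, t < k → u k (col t) = 0
  u_supp : ∀ k j, ¬ S (row k) j → u k j = 0
  eq : ∀ i j, S i j → A i j = ∑ k, l i k * u k j

/-- The region contains with each cell all the cells above it and to the left of it. -/
def DownClosed (S : ρ → κ → Prop) : Prop :=
  ∀ i i' j j', i' ≤ i → j' ≤ j → S i j → S i' j'

/-- The vectors `l · k`, placed in the pivot columns. -/
def pivotL {r : ℕ} (col : Fin r → κ) (l : Matrix ρ (Fin r) K) : Matrix ρ κ K :=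
  Matrix.of fun i j => ∑ k, if col k = j then l i k else 0

/-- The pivots. -/
def pivotE (K : Type*) [Field K] {r : ℕ} (row : Fin r → ρ) (col : Fin r → κ) : Matrix ρ κ K :=
  Matrix.of fun i j => ∑ k, if row k = i ∧ col k = j then 1 else 0

/-- The vectors `u k ·`, placed in the pivot rows. -/
def pivotU {r : ℕ} (row : Fin r → ρ) (u : Matrix (Fin r) κ K) : Matrix ρ κ K :=
  Matrix.of fun i j => ∑ k, if row k = i then u k j else 0

namespace IsElimination

variable {S : ρ → κ → Prop} {A : Matrix ρ κ K} {r : ℕ} {row : Fin r → ρ} {col : Fin r → κ}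
  {l : Matrix ρ (Fin r) K} {u : Matrix (Fin r) κ K}

theorem row_injective (h : IsElimination S A row col l u) : Function.Injective row := by
  intro a b hab
  rcases lt_trichotomy a b with hl | hl | hl
  · have := h.l_tri a b hl
    rw [hab, h.l_diag] at this
    exact absurd this one_ne_zero
  · exact hl
  · have := h.l_tri b a hl
    rw [← hab, h.l_diag] at this
    exact absurd this one_ne_zero

theorem col_injective (h : IsElimination S A row col l u) : Function.Injective col := by
  intro a b hab
  rcases lt_trichotomy a b with hl | hl | hl
  · have := h.u_tri a b hl
    rw [hab] at this
    exact absurd this (h.u_diag b)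
  · exact hl
  · have := h.u_tri b a hl
    rw [← hab] at this
    exact absurd this (h.u_diag a)

theorem mem (h : IsElimination S A row col l u) (k : Fin r) : S (row k) (col k) := by
  by_contra hc
  exact h.u_diag k (h.u_supp k _ hc)

/-- The column vectors vanish on the zero rows. -/
theorem l_eq_zero (h : IsElimination S A row col l u) {i : ρ} (hi : ∀ j, S i j → A i j = 0)
    (k : Fin r) : l i k = 0 := by
  -- Forward substitution: in column `col k` the later terms vanish by `u_tri` and the earlier ones
  -- by induction, leaving `l i k * u k (col k) = 0`.
  induction k using WellFoundedLT.induction with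
  | ind k ih =>
    by_cases hS : S i (col k)
    · have h0 := h.eq i (col k) hS
      rw [hi _ hS, Finset.sum_eq_single k] at h0
      · exact (mul_eq_zero.1 h0.symm).resolve_right (h.u_diag k)
      · intro t _ htk
        rcases lt_or_gt_of_ne htk with hlt | hlt
        · rw [ih t hlt, zero_mul]
        · rw [h.u_tri k t hlt, mul_zero]
      · simp
    · exact h.l_supp _ _ hS

/-- The row vectors vanish on the zero columns. -/
theorem u_eq_zero (h : IsElimination S A row col l u) {j : κ} (hj : ∀ i, S i j → A i j = 0)
    (k : Fin r) : u k j = 0 := by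
  induction k using WellFoundedLT.induction with
  | ind k ih =>
    by_cases hS : S (row k) j
    · have h0 := h.eq (row k) j hS
      rw [hj _ hS, Finset.sum_eq_single k] at h0
      · simpa [h.l_diag k] using h0.symm
      · intro t _ htk
        rcases lt_or_gt_of_ne htk with hlt | hlt
        · rw [ih t hlt, mul_zero]
        · rw [h.l_tri k t hlt, zero_mul]
      · simp
    · exact h.u_supp _ _ hS

/-- An elimination followed by an elimination of the residual. -/
theorem append {A₁ A₂ : Matrix ρ κ K} {r₁ r₂ : ℕ} {row₁ : Fin r₁ → ρ} {col₁ : Fin r₁ → κ}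
    {l₁ : Matrix ρ (Fin r₁) K} {u₁ : Matrix (Fin r₁) κ K} {row₂ : Fin r₂ → ρ} {col₂ : Fin r₂ → κ}
    {l₂ : Matrix ρ (Fin r₂) K} {u₂ : Matrix (Fin r₂) κ K}
    (h₁ : IsElimination S A₁ row₁ col₁ l₁ u₁) (h₂ : IsElimination S A₂ row₂ col₂ l₂ u₂)
    (hrow : ∀ t j, S (row₁ t) j → A₂ (row₁ t) j = 0)
    (hcol : ∀ t i, S i (col₁ t) → A₂ i (col₁ t) = 0)
    (hA : ∀ i j, S i j → A i j = A₁ i j + A₂ i j) :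
    IsElimination S A (Fin.append row₁ row₂) (Fin.append col₁ col₂)
      (Matrix.of fun i => Fin.append (l₁ i) (l₂ i)) (Matrix.of fun k j => Fin.append (fun t => u₁ t j) (fun t => u₂ t j) k) where
  l_lower i k := by
    induction k using Fin.addCases with
    | left k => simpa using h₁.l_lower i k
    | right k => simpa using h₂.l_lower i k
  l_diag k := by
    induction k using Fin.addCases with
    | left k => simpa using h₁.l_diag k
    | right k => simpa using h₂.l_diag k
  l_tri t k := by
    induction k using Fin.addCases with
    | left k =>
      induction t using Fin.addCases with
      | left t => exact fun ht => by simpa using h₁.l_tri t k (Fin.lt_def.2 (Fin.lt_def.1 ht))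
      | right t =>
        intro hlt
        simp only [Fin.lt_def, Fin.val_natAdd, Fin.val_castAdd] at hlt
        omega
    | right k =>
      induction t using Fin.addCases with
      -- The only condition mixing the two families: the residual is zero on the old pivot rows,
      -- hence so are the new column vectors.
      | left t => simpa using fun _ => h₂.l_eq_zero (hrow t) k
      | right t => simpa using h₂.l_tri t k
  l_supp i k := by
    induction k using Fin.addCases with
    | left k => simpa using h₁.l_supp i k
    | right k => simpa using h₂.l_supp i k
  u_upper k j := by
    induction k using Fin.addCases with
    | left k => simpa using h₁.u_upper k j
    | right k => simpa using h₂.u_upper k j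
  u_diag k := by
    induction k using Fin.addCases with
    | left k => simpa using h₁.u_diag k
    | right k => simpa using h₂.u_diag k
  u_tri t k := by
    induction k using Fin.addCases with
    | left k =>
      induction t using Fin.addCases with
      | left t => exact fun ht => by simpa using h₁.u_tri t k (Fin.lt_def.2 (Fin.lt_def.1 ht))
      | right t =>
        intro hlt
        simp only [Fin.lt_def, Fin.val_natAdd, Fin.val_castAdd] at hlt
        omega
    | right k =>
      induction t using Fin.addCases with
      | left t => simpa using fun _ => h₂.u_eq_zero (hcol t) k
      | right t => simpa using h₂.u_tri t k
  u_supp k j := by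
    induction k using Fin.addCases with
    | left k => simpa using h₁.u_supp k j
    | right k => simpa using h₂.u_supp k j
  eq i j hS := by
    rw [hA i j hS, h₁.eq i j hS, h₂.eq i j hS, Fin.sum_univ_add]
    simp

/-- Cutting the vectors off outside of the region. -/
theorem truncate [DecidableRel S] (hS : DownClosed S)
    (h : IsElimination (fun _ _ => True) A row col l u) (hm : ∀ k, S (row k) (col k)) :
    IsElimination S A row col (Matrix.of fun i k => if S i (col k) then l i k else 0)
      (Matrix.of fun k j => if S (row k) j then u k j else 0) where
  l_lower i k hi := by simp [h.l_lower i k hi]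
  l_diag k := by simp [h.l_diag k, hm]
  l_tri t k ht := by simp [h.l_tri t k ht]
  l_supp i k hi := by simp [hi]
  u_upper k j hj := by simp [h.u_upper k j hj]
  u_diag k := by simp [h.u_diag k, hm]
  u_tri t k ht := by simp [h.u_tri t k ht]
  u_supp k j hj := by simp [hj]
  eq i j hij := by
    rw [h.eq i j trivial]
    refine Finset.sum_congr rfl fun k _ => ?_
    by_cases hi : i < row k
    · simp [h.l_lower i k hi]
    by_cases hj : j < col k
    · simp [h.u_upper k j hj]
    -- A term that may be nonzero at a cell of the region has its pivot weakly above and to the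
    -- left, so by down-closedness neither factor is cut.
    simp [hS i i j (col k) le_rfl (not_lt.1 hj) hij, hS i (row k) j j (not_lt.1 hi) le_rfl hij]

/-- An elimination of a block is an elimination of the matrix with this block and zeros elsewhere. -/
theorem embed {ρ' κ' : Type*} [LinearOrder ρ'] [LinearOrder κ'] {S' : ρ' → κ' → Prop}
    {A' : Matrix ρ' κ' K} {l' : Matrix ρ' (Fin r) K} {u' : Matrix (Fin r) κ' K}
    (h : IsElimination S A row col l u) (f : ρ ↪o ρ') (g : κ ↪o κ')
    (hS : ∀ i j, S' (f i) (g j) ↔ S i j)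
    (hl : ∀ i k, l' (f i) k = l i k) (hl0 : ∀ i k, i ∉ Set.range f → l' i k = 0)
    (hu : ∀ k j, u' k (g j) = u k j) (hu0 : ∀ k j, j ∉ Set.range g → u' k j = 0)
    (hA : ∀ i j, A' (f i) (g j) = A i j)
    (hA0 : ∀ i j, S' i j → (i ∉ Set.range f ∨ j ∉ Set.range g) → A' i j = 0) :
    IsElimination S' A' (f ∘ row) (g ∘ col) l' u' where
  l_lower i k hi := by
    by_cases hr : i ∈ Set.range f
    · obtain ⟨i, rfl⟩ := hr
      rw [hl]
      exact h.l_lower i k (f.lt_iff_lt.1 hi)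
    · exact hl0 i k hr
  l_diag k := by simp [hl, h.l_diag]
  l_tri t k ht := by simp [hl, h.l_tri t k ht]
  l_supp i k hi := by
    by_cases hr : i ∈ Set.range f
    · obtain ⟨i, rfl⟩ := hr
      rw [hl]
      exact h.l_supp i k (fun hc => hi ((hS _ _).2 hc))
    · exact hl0 i k hr
  u_upper k j hj := by
    by_cases hr : j ∈ Set.range g
    · obtain ⟨j, rfl⟩ := hr
      rw [hu]
      exact h.u_upper k j (g.lt_iff_lt.1 hj)
    · exact hu0 k j hr
  u_diag k := by simp [hu, h.u_diag]
  u_tri t k ht := by simp [hu, h.u_tri t k ht]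
  u_supp k j hj := by
    by_cases hr : j ∈ Set.range g
    · obtain ⟨j, rfl⟩ := hr
      rw [hu]
      exact h.u_supp k j (fun hc => hj ((hS _ _).2 hc))
    · exact hu0 k j hr
  eq i j hij := by
    by_cases hr : i ∈ Set.range f
    · by_cases hc : j ∈ Set.range g
      · obtain ⟨i, rfl⟩ := hr
        obtain ⟨j, rfl⟩ := hc
        simp only [hA, hl, hu]
        exact h.eq i j ((hS _ _).1 hij)
      · simp [hA0 i j hij (Or.inr hc), hu0 _ j hc]
    · simp [hA0 i j hij (Or.inl hr), hl0 i _ hr]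

/-- An elimination on a region extends to any region with one more cell. -/
theorem exists_extension_cell (hS : DownClosed S) (h : IsElimination S A row col l u)
    (i₀ : ρ) (j₀ : κ) (h0 : ¬ S i₀ j₀) (hr : ∀ i, i < i₀ → S i j₀) (hc : ∀ j, j < j₀ → S i₀ j) :
    ∃ (r' : ℕ) (row' : Fin r' → ρ) (col' : Fin r' → κ) (l' : Matrix ρ (Fin r') K)
      (u' : Matrix (Fin r') κ K),
      IsElimination (fun i j => S i j ∨ (i = i₀ ∧ j = j₀)) A row' col' l' u' ∧
      ∀ i j, S i j → pivotL col' l' i j = pivotL col l i j ∧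
        pivotE K row' col' i j = pivotE K row col i j ∧
        pivotU row' u' i j = pivotU row u i j := by
  classical
  set S' : ρ → κ → Prop := fun i j => S i j ∨ (i = i₀ ∧ j = j₀) with hS'
  -- The defect at the new cell. It is absorbed into a row vector or a column vector when a pivot
  -- permits it, and otherwise becomes a new pivot if nonzero.
  set x : K := A i₀ j₀ - ∑ k, l i₀ k * u k j₀ with hx
  have hnS : ∀ i j, ¬ S' i j → ¬ S i j := fun i j hn hs => hn (Or.inl hs)
  -- A pivot in row `i₀` can take `x` as its entry in column `j₀`, unless an earlier pivot of that
  -- column forces a zero there by `u_tri`.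
  by_cases hU : ∃ k, row k = i₀ ∧ ∀ t, t < k → col t ≠ j₀
  · obtain ⟨k, hk, hkt⟩ := hU
    have hlt : col k < j₀ := by
      by_contra hge
      exact h0 (hS (row k) _ (col k) _ hk.ge (not_lt.1 hge) (h.mem k))
    have huk : u k j₀ = 0 := h.u_supp _ _ (hk ▸ h0)
    refine ⟨r, row, col, l, Matrix.of fun k' j => if k' = k ∧ j = j₀ then x else u k' j,
      ⟨h.l_lower, h.l_diag, h.l_tri, fun i k hn => h.l_supp i k (hnS _ _ hn), ?_, ?_, ?_, ?_, ?_⟩,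
      fun i j hij => ⟨rfl, rfl, ?_⟩⟩
    · intro k' j hj
      rw [of_apply, if_neg, h.u_upper k' j hj]
      rintro ⟨rfl, rfl⟩
      exact lt_asymm hj hlt
    · intro k'
      rw [of_apply, if_neg]
      · exact h.u_diag k'
      · rintro ⟨rfl, hc⟩
        exact hlt.ne hc
    · intro t k' ht
      rw [of_apply, if_neg, h.u_tri t k' ht]
      rintro ⟨rfl, hc⟩
      exact hkt t ht hc
    · intro k' j hn
      rw [of_apply, if_neg, h.u_supp k' j (hnS _ _ hn)]
      rintro ⟨rfl, rfl⟩
      exact hn (Or.inr ⟨hk, rfl⟩)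
    · intro i j hij
      by_cases hj : j = j₀
      · subst hj
        have hsum : ∑ k', l i k' * (Matrix.of fun k' j' => if k' = k ∧ j' = j then x else u k' j')
            k' j = l i k * x + ∑ k', l i k' * u k' j := by
          rw [← Finset.add_sum_erase _ _ (Finset.mem_univ k),
            ← Finset.add_sum_erase _ (fun k' => l i k' * u k' j) (Finset.mem_univ k), huk]
          simp only [of_apply, and_self, if_true, mul_zero, zero_add]
          congr 1
          refine Finset.sum_congr rfl fun k' hk' => ?_
          rw [if_neg (fun hh => (Finset.ne_of_mem_erase hk') hh.1)]
        rw [hsum]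
        by_cases hi : i = i₀
        · subst hi
          have : l i k = 1 := hk ▸ h.l_diag k
          rw [this, hx]
          ring
        · have hSij : S i j := hij.resolve_right (fun hh => hi hh.1)
          -- The changed entry does not disturb the cells of the region in column `j₀`: they lie
          -- above row `i₀`, where the column vector of `k` has not started.
          have : l i k = 0 := by
            apply h.l_lower
            by_contra hge
            exact h0 (hS i _ j _ (hk ▸ not_lt.1 hge) le_rfl hSij)
          rw [this, zero_mul, zero_add]
          exact h.eq i j hSij
      · simp only [of_apply, hj, and_false, if_false]
        exact h.eq i j (hij.resolve_right (fun hh => hj hh.2))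
    · simp only [pivotU, of_apply]
      refine Finset.sum_congr rfl fun k' _ => ?_
      by_cases hi : row k' = i
      · rw [if_pos hi, if_pos hi, if_neg]
        rintro ⟨rfl, rfl⟩
        exact h0 (hk ▸ hi ▸ hij)
      · rw [if_neg hi, if_neg hi]
  -- The symmetric case, with a pivot in column `j₀`. The defect is divided by the pivot value
  -- because column vectors are the normalized ones.
  by_cases hL : ∃ k, col k = j₀ ∧ ∀ t, t < k → row t ≠ i₀
  · obtain ⟨k, hk, hkt⟩ := hL
    have hlt : row k < i₀ := by
      by_contra hge
      exact h0 (hS (row k) _ (col k) _ (not_lt.1 hge) hk.ge (h.mem k))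
    have hlk : l i₀ k = 0 := h.l_supp _ _ (hk ▸ h0)
    refine ⟨r, row, col, Matrix.of fun i k' => if k' = k ∧ i = i₀ then x / u k j₀ else l i k', u,
      ⟨?_, ?_, ?_, ?_, h.u_upper, h.u_diag, h.u_tri, fun k j hn => h.u_supp k j (hnS _ _ hn), ?_⟩,
      fun i j hij => ⟨?_, rfl, rfl⟩⟩
    · intro i k' hi
      rw [of_apply, if_neg, h.l_lower i k' hi]
      rintro ⟨rfl, rfl⟩
      exact lt_asymm hi hlt
    · intro k'
      rw [of_apply, if_neg]
      · exact h.l_diag k'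
      · rintro ⟨rfl, hc⟩
        exact hlt.ne hc
    · intro t k' ht
      rw [of_apply, if_neg, h.l_tri t k' ht]
      rintro ⟨rfl, hc⟩
      exact hkt t ht hc
    · intro i k' hn
      rw [of_apply, if_neg, h.l_supp i k' (hnS _ _ hn)]
      rintro ⟨rfl, rfl⟩
      exact hn (Or.inr ⟨rfl, hk⟩)
    · intro i j hij
      by_cases hi : i = i₀
      · subst hi
        have hsum : ∑ k', (Matrix.of fun i' k' => if k' = k ∧ i' = i then x / u k j₀ else l i' k')
            i k' * u k' j = x / u k j₀ * u k j + ∑ k', l i k' * u k' j := by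
          rw [← Finset.add_sum_erase _ _ (Finset.mem_univ k),
            ← Finset.add_sum_erase _ (fun k' => l i k' * u k' j) (Finset.mem_univ k), hlk]
          simp only [of_apply, and_self, if_true, zero_mul, zero_add]
          congr 1
          refine Finset.sum_congr rfl fun k' hk' => ?_
          rw [if_neg (fun hh => (Finset.ne_of_mem_erase hk') hh.1)]
        rw [hsum]
        by_cases hj : j = j₀
        · subst hj
          have : u k j ≠ 0 := hk ▸ h.u_diag k
          rw [div_mul_cancel₀ _ this, hx]
          ring
        · have hSij : S i j := hij.resolve_right (fun hh => hj hh.2)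
          have : u k j = 0 := by
            apply h.u_upper
            by_contra hge
            exact h0 (hS i _ j _ le_rfl (hk ▸ not_lt.1 hge) hSij)
          rw [this, mul_zero, zero_add]
          exact h.eq i j hSij
      · simp only [of_apply, hi, and_false, if_false]
        exact h.eq i j (hij.resolve_right (fun hh => hi hh.1))
    · simp only [pivotL, of_apply]
      refine Finset.sum_congr rfl fun k' _ => ?_
      by_cases hj : col k' = j
      · rw [if_pos hj, if_pos hj, if_neg]
        rintro ⟨rfl, rfl⟩
        exact h0 (hk ▸ hj ▸ hij)
      · rw [if_neg hj, if_neg hj]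
  push Not at hU hL
  -- A pivot of row `i₀` would be preceded by one of column `j₀`, itself preceded by one of row
  -- `i₀`; injectivity of `row` closes the cycle.
  have hrow : ∀ k, row k ≠ i₀ := by
    intro k hk
    obtain ⟨t, ht, htj⟩ := hU k hk
    obtain ⟨s, hs, hsi⟩ := hL t htj
    have := h.row_injective (hsi.trans hk.symm)
    subst this
    exact lt_asymm ht hs
  have hcol : ∀ k, col k ≠ j₀ := by
    intro k hk
    obtain ⟨t, ht, htj⟩ := hL k hk
    exact hrow t htj
  have hold : IsElimination S' (l * u) row col l u :=
    ⟨h.l_lower, h.l_diag, h.l_tri, fun i k hn => h.l_supp i k (hnS _ _ hn), h.u_upper, h.u_diag,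
      h.u_tri, fun k j hn => h.u_supp k j (hnS _ _ hn), fun i j _ => Matrix.mul_apply⟩
  by_cases hx0 : x = 0
  · refine ⟨r, row, col, l, u, { hold with eq := ?_ }, fun i j _ => ⟨rfl, rfl, rfl⟩⟩
    rintro i j (hij | ⟨rfl, rfl⟩)
    · exact h.eq i j hij
    · exact sub_eq_zero.1 hx0
  -- With neither row nor column in use, the defect is eliminated by itself as a single pivot and
  -- appended.
  · have hnew : IsElimination S' (Matrix.of fun i j => if i = i₀ ∧ j = j₀ then x else 0)
        (fun _ : Fin 1 => i₀) (fun _ => j₀) (Matrix.of fun i _ => if i = i₀ then 1 else 0)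
        (Matrix.of fun _ j => if j = j₀ then x else 0) := by
      refine ⟨?_, ?_, ?_, ?_, ?_, ?_, ?_, ?_, ?_⟩
      · intro i k hi
        simp [hi.ne]
      · simp
      · intro t k ht
        exact absurd ht (by omega)
      · intro i k hn
        rw [of_apply, if_neg]
        rintro rfl
        exact hn (Or.inr ⟨rfl, rfl⟩)
      · intro k j hj
        simp [hj.ne]
      · simpa using hx0
      · intro t k ht
        exact absurd ht (by omega)
      · intro k j hn
        rw [of_apply, if_neg]
        rintro rfl
        exact hn (Or.inr ⟨rfl, rfl⟩)
      · intro i j _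
        by_cases hi : i = i₀ <;> by_cases hj : j = j₀ <;> simp [hi, hj]
    refine ⟨r + 1, _, _, _, _, hold.append hnew ?_ ?_ ?_, fun i j hij => ⟨?_, ?_, ?_⟩⟩
    · intro t j _
      simp [hrow t]
    · intro t i _
      simp [hcol t]
    · rintro i j (hij | ⟨rfl, rfl⟩)
      · rw [of_apply, if_neg, add_zero, Matrix.mul_apply]
        · exact h.eq i j hij
        · rintro ⟨rfl, rfl⟩
          exact h0 hij
      · simp [hx, Matrix.mul_apply]
    · simp only [pivotL, of_apply, Fin.sum_univ_add, Fin.append_left, Fin.append_right]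
      rw [add_eq_left]
      refine Finset.sum_eq_zero fun k _ => ?_
      rw [ite_eq_right_iff, ite_eq_right_iff]
      rintro rfl rfl
      exact absurd hij h0
    · simp only [pivotE, of_apply, Fin.sum_univ_add, Fin.append_left, Fin.append_right]
      rw [add_eq_left]
      refine Finset.sum_eq_zero fun k _ => ?_
      rw [ite_eq_right_iff]
      rintro ⟨rfl, rfl⟩
      exact absurd hij h0
    · simp only [pivotU, of_apply, Fin.sum_univ_add, Fin.append_left, Fin.append_right]
      rw [add_eq_left]
      refine Finset.sum_eq_zero fun k _ => ?_
      rw [ite_eq_right_iff, ite_eq_right_iff]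
      rintro rfl rfl
      exact absurd hij h0

/-- An elimination on a region extends to the whole matrix. -/
theorem exists_extension [Finite ρ] [Finite κ] (hS : DownClosed S)
    (h : IsElimination S A row col l u) :
    ∃ (r' : ℕ) (row' : Fin r' → ρ) (col' : Fin r' → κ) (l' : Matrix ρ (Fin r') K)
      (u' : Matrix (Fin r') κ K),
      IsElimination (fun _ _ => True) A row' col' l' u' ∧
      ∀ i j, S i j → pivotL col' l' i j = pivotL col l i j ∧
        pivotE K row' col' i j = pivotE K row col i j ∧
        pivotU row' u' i j = pivotU row u i j := by
  classical
  generalize hN : Set.ncard {x : ρ × κ | ¬ S x.1 x.2} = N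
  induction N using Nat.strong_induction_on generalizing S r with
  | _ N ih =>
    by_cases hne : {x : ρ × κ | ¬ S x.1 x.2}.Nonempty
    -- By minimality in the product order, all cells above and to the left are already present, so
    -- adding this one keeps the region down-closed.
    · obtain ⟨⟨i₀, j₀⟩, h0, hmin⟩ := (Set.toFinite _).exists_minimal hne
      have h0' : ¬ S i₀ j₀ := h0
      have hr : ∀ i, i < i₀ → S i j₀ := by
        intro i hi
        by_contra hn
        exact hi.not_ge (hmin (show (i, j₀) ∈ _ from hn) ⟨hi.le, le_rfl⟩).1
      have hc : ∀ j, j < j₀ → S i₀ j := by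
        intro j hj
        by_contra hn
        exact hj.not_ge (hmin (show (i₀, j) ∈ _ from hn) ⟨le_rfl, hj.le⟩).2
      obtain ⟨r₁, row₁, col₁, l₁, u₁, h₁, hag⟩ := h.exists_extension_cell hS i₀ j₀ h0' hr hc
      have hD : DownClosed (fun i j => S i j ∨ (i = i₀ ∧ j = j₀)) := by
        rintro i i' j j' hi hj (hs | ⟨rfl, rfl⟩)
        · exact Or.inl (hS i i' j j' hi hj hs)
        · rcases hi.lt_or_eq with hi | rfl
          · exact Or.inl (hS i' i' j j' le_rfl hj (hr _ hi))
          · rcases hj.lt_or_eq with hj | rfl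
            · exact Or.inl (hc _ hj)
            · exact Or.inr ⟨rfl, rfl⟩
      have hcard : Set.ncard {x : ρ × κ | ¬ (S x.1 x.2 ∨ (x.1 = i₀ ∧ x.2 = j₀))} < N := by
        rw [← hN]
        refine Set.ncard_lt_ncard ⟨fun x hx hs => hx (Or.inl hs), fun hsub => ?_⟩ (Set.toFinite _)
        exact hsub h0 (Or.inr ⟨rfl, rfl⟩)
      obtain ⟨r₂, row₂, col₂, l₂, u₂, h₂, hag₂⟩ := ih _ hcard hD h₁ rfl
      refine ⟨r₂, row₂, col₂, l₂, u₂, h₂, fun i j hij => ?_⟩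
      obtain ⟨a, b, c⟩ := hag i j hij
      obtain ⟨a', b', c'⟩ := hag₂ i j (Or.inl hij)
      exact ⟨a'.trans a, b'.trans b, c'.trans c⟩
    · have hall : S = fun _ _ => True := by
        ext i j
        simp only [iff_true]
        by_contra hn
        exact hne ⟨(i, j), hn⟩
      subst hall
      exact ⟨r, row, col, l, u, h, fun _ _ _ => ⟨rfl, rfl, rfl⟩⟩

end IsElimination
end Elimination
end QuasiSep

namespace QuasiSep

/-! ### From pivot lists to permutations. -/

section Completion

variable {m n r : ℕ} {X : Type*}

theorem le_of_fin_injective {f : Fin r → Fin m} (hf : Function.Injective f) : r ≤ m := by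
  simpa using Fintype.card_le_of_injective f hf

theorem card_compl_range {f : Fin r → Fin m} (hf : Function.Injective f) :
    Nat.card ↥(Set.range f)ᶜ = m - r := by
  rw [Nat.card_coe_set_eq, Set.ncard_compl, Nat.card_eq_fintype_card, Fintype.card_fin,
    ← Set.image_univ, Set.ncard_image_of_injective _ hf, Set.ncard_univ, Nat.card_eq_fintype_card,
    Fintype.card_fin]

/-- A bijection `Fin m ≃ Fin r ⊕ Fin (m - r)` whose inverse is `f` on the first summand. -/
noncomputable def completion (f : Fin r → Fin m) (hf : Function.Injective f) :
    Fin m ≃ Fin r ⊕ Fin (m - r) :=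
  (((Equiv.ofInjective f hf).sumCongr (Finite.equivFinOfCardEq (card_compl_range hf)).symm).trans
    (Equiv.Set.sumCompl (Set.range f))).symm

theorem completion_symm_inl (f : Fin r → Fin m) (hf : Function.Injective f) (k : Fin r) :
    (completion f hf).symm (Sum.inl k) = f k := by
  simp [completion]

/-- The decomposition with given pivots and given vectors. -/
noncomputable def PLUQ.ofPivots (row : Fin r → Fin m) (col : Fin r → Fin n)
    (hrow : Function.Injective row) (hcol : Function.Injective col)
    (l : Matrix (Fin m) (Fin r) X) (u : Matrix (Fin r) (Fin n) X) : PLUQ m n X where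
  r := r
  p := completion row hrow
  q := completion col hcol
  L := l.submatrix row id
  M := l.submatrix (fun a => (completion row hrow).symm (Sum.inr a)) id
  U := u.submatrix id col
  V := u.submatrix id (fun b => (completion col hcol).symm (Sum.inr b))

theorem fromRows_completion (row : Fin r → Fin m) (hrow : Function.Injective row)
    (l : Matrix (Fin m) (Fin r) X) (i : Fin m) (k : Fin r) :
    fromRows (l.submatrix row id)
      (l.submatrix (fun a => (completion row hrow).symm (Sum.inr a)) id)
      (completion row hrow i) k = l i k := by
  obtain ⟨x, rfl⟩ := (completion row hrow).symm.surjective i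
  rw [Equiv.apply_symm_apply]
  cases x <;> simp [completion_symm_inl]

theorem fromCols_completion (col : Fin r → Fin n) (hcol : Function.Injective col)
    (u : Matrix (Fin r) (Fin n) X) (k : Fin r) (j : Fin n) :
    fromCols (u.submatrix id col)
      (u.submatrix id (fun a => (completion col hcol).symm (Sum.inr a))) k
      (completion col hcol j) = u k j := by
  obtain ⟨x, rfl⟩ := (completion col hcol).symm.surjective j
  rw [Equiv.apply_symm_apply]
  cases x <;> simp [completion_symm_inl]

end Completion

/-! ### Ranks of leading blocks as pivot counts. -/

section Rank

variable {K : Type*} [Field K] {ρ κ : Type*} [LinearOrder ρ] [LinearOrder κ]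

theorem pivotE_apply {r : ℕ} (row : Fin r → ρ) (col : Fin r → κ) (i : ρ) (j : κ) :
    pivotE K row col i j = ∑ k, (if row k = i then 1 else 0) * (if col k = j then 1 else 0) := by
  rw [pivotE, of_apply]
  refine Finset.sum_congr rfl fun k _ => ?_
  by_cases h1 : row k = i <;> by_cases h2 : col k = j <;> simp [h1, h2]

theorem pivotE_eq_zero_or_exists {r : ℕ} {row : Fin r → ρ} (col : Fin r → κ)
    (hrow : Function.Injective row) (i : ρ) (j : κ) :
    pivotE K row col i j = 0 ∨ (pivotE K row col i j = 1 ∧ ∃ k, row k = i ∧ col k = j) := by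
  by_cases h : ∃ k, row k = i ∧ col k = j
  · refine Or.inr ⟨?_, h⟩
    obtain ⟨k, rfl, rfl⟩ := h
    rw [pivotE, of_apply, Finset.sum_eq_single k]
    · simp
    · intro t _ ht
      rw [if_neg fun hh => ht (hrow hh.1)]
    · simp
  · left
    push Not at h
    rw [pivotE, of_apply]
    exact Finset.sum_eq_zero fun k _ => if_neg fun hh => h k hh.1 hh.2

theorem pivotE_ne_zero_iff {r : ℕ} {row : Fin r → ρ} (col : Fin r → κ)
    (hrow : Function.Injective row) (i : ρ) (j : κ) :
    pivotE K row col i j ≠ 0 ↔ ∃ k, row k = i ∧ col k = j := by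
  constructor
  · intro h
    exact ((pivotE_eq_zero_or_exists col hrow i j).resolve_left h).2
  · rintro ⟨k, rfl, rfl⟩ h
    rw [pivotE, of_apply, Finset.sum_eq_single k] at h
    · simp at h
    · intro t _ ht
      rw [if_neg fun hh => ht (hrow hh.1)]
    · simp

namespace IsElimination

variable {S : ρ → κ → Prop} {A : Matrix ρ κ K} {r : ℕ} {row : Fin r → ρ} {col : Fin r → κ}
  {l : Matrix ρ (Fin r) K} {u : Matrix (Fin r) κ K}

theorem eq_mul (h : IsElimination (fun _ _ => True) A row col l u) : A = l * u := by
  ext i j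
  rw [Matrix.mul_apply, h.eq i j trivial]

theorem unitLower (h : IsElimination S A row col l u) : UnitLower (l.submatrix row id) :=
  ⟨h.l_diag, fun i j hij => h.l_tri i j hij⟩

theorem invUpper (h : IsElimination S A row col l u) : InvUpper (u.submatrix id col) :=
  ⟨h.u_diag, fun i j hij => h.u_tri j i hij⟩

end IsElimination

theorem UnitLower.isUnit_det {r : ℕ} {L : Matrix (Fin r) (Fin r) K} (h : UnitLower L) :
    IsUnit L.det := by
  rw [Matrix.det_of_isLowerTriangular L (fun i j hij => h.2 i j hij)]
  simp [h.1]

theorem InvUpper.isUnit_det {r : ℕ} {U : Matrix (Fin r) (Fin r) K} (h : InvUpper U) :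
    IsUnit U.det := by
  rw [Matrix.det_of_isUpperTriangular (fun i j hij => h.2 i j hij), isUnit_iff_ne_zero]
  exact Finset.prod_ne_zero_iff.2 fun i _ => h.1 i

namespace IsElimination

variable {S : ρ → κ → Prop} {A : Matrix ρ κ K} {r : ℕ} {row : Fin r → ρ} {col : Fin r → κ}
  {l : Matrix ρ (Fin r) K} {u : Matrix (Fin r) κ K}

/-- The factorization through `r` dimensions bounds the rank above; the submatrix on pivot rows and
columns, a unit lower times an invertible upper triangular matrix, bounds it below. -/
theorem rank_eq [Fintype κ] (h : IsElimination (fun _ _ => True) A row col l u) : A.rank = r := by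
  apply le_antisymm
  · rw [h.eq_mul]
    refine (Matrix.rank_mul_le_left _ _).trans ?_
    simpa using Matrix.rank_le_card_width l
  · have hs : A.submatrix row col = l.submatrix row id * u.submatrix id col := by
      rw [h.eq_mul]
      rfl
    have hu : IsUnit (A.submatrix row col) := by
      rw [Matrix.isUnit_iff_isUnit_det, hs, Matrix.det_mul]
      exact h.unitLower.isUnit_det.mul h.invUpper.isUnit_det
    have := Matrix.rank_of_isUnit _ hu
    rw [Fintype.card_fin] at this
    exact this.symm.le.trans (Matrix.rank_submatrix_le _ _ _)

/-- The rank profile matrix is eliminated with the same pivots. -/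
theorem pivotE (h : IsElimination (fun _ _ => True) A row col l u) :
    IsElimination (fun _ _ => True) (pivotE K row col) row col
      (Matrix.of fun i k => if row k = i then 1 else 0)
      (Matrix.of fun k j => if col k = j then 1 else 0) where
  l_lower i k hi := by simp [hi.ne']
  l_diag k := by simp
  l_tri t k ht := by simp [h.row_injective.eq_iff, ht.ne']
  l_supp i k hi := absurd trivial hi
  u_upper k j hj := by simp [hj.ne']
  u_diag k := by simp
  u_tri t k ht := by simp [h.col_injective.eq_iff, ht.ne']
  u_supp i k hi := absurd trivial hi
  eq i j _ := pivotE_apply row col i j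

/-- Restriction of an elimination to leading rows and columns. -/
theorem restrict (h : IsElimination (fun _ _ => True) A row col l u) (p : ρ → Prop) (q : κ → Prop)
    [DecidablePred p] [DecidablePred q]
    (hp : ∀ i i', i' ≤ i → p i → p i') (hq : ∀ j j', j' ≤ j → q j → q j') :
    ∃ row' col' l' u', IsElimination (fun _ _ => True)
      (A.submatrix (Subtype.val : Subtype p → ρ) (Subtype.val : Subtype q → κ))
      (r := (Finset.univ.filter fun k => p (row k) ∧ q (col k)).card) row' col' l' u' := by
  -- Exactly the pivots inside the block are kept, in their order. Any other pivot has its row or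
  -- its column beyond the block, so one of its two vectors is zero there.
  set T := Finset.univ.filter fun k => p (row k) ∧ q (col k) with hT
  let e := T.orderEmbOfFin rfl
  have he : ∀ t, p (row (e t)) ∧ q (col (e t)) := fun t =>
    (Finset.mem_filter.1 (T.orderEmbOfFin_mem rfl t)).2
  refine ⟨fun t => ⟨row (e t), (he t).1⟩, fun t => ⟨col (e t), (he t).2⟩,
    l.submatrix Subtype.val e, u.submatrix e Subtype.val, ?_, ?_, ?_, ?_, ?_, ?_, ?_, ?_, ?_⟩
  · exact fun i k hi => h.l_lower _ _ hi
  · exact fun k => h.l_diag _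
  · exact fun t k ht => h.l_tri _ _ (e.lt_iff_lt.2 ht)
  · exact fun i k hi => absurd trivial hi
  · exact fun i k hi => h.u_upper _ _ hi
  · exact fun k => h.u_diag _
  · exact fun t k ht => h.u_tri _ _ (e.lt_iff_lt.2 ht)
  · exact fun i k hi => absurd trivial hi
  · intro i j _
    rw [submatrix_apply, h.eq _ _ trivial]
    have h1 : ∑ k, l i.1 k * u k j.1 = ∑ k ∈ T, l i.1 k * u k j.1 := by
      symm
      refine Finset.sum_subset (Finset.subset_univ _) fun k _ hk => ?_
      rw [hT, Finset.mem_filter, not_and_or, not_and_or] at hk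
      rcases hk with hk | hk | hk
      · exact absurd (Finset.mem_univ _) hk
      · rw [h.l_lower, zero_mul]
        by_contra hge
        exact hk (hp _ _ (not_lt.1 hge) i.2)
      · rw [h.u_upper, mul_zero]
        by_contra hge
        exact hk (hq _ _ (not_lt.1 hge) j.2)
    rw [h1]
    have h2 : Finset.univ.map e.toEmbedding = T := by
      rw [Finset.map_eq_image]
      exact Finset.image_orderEmbOfFin_univ T rfl
    refine (Finset.sum_congr h2.symm fun _ _ => rfl).trans ?_
    rw [Finset.sum_map]
    rfl

end IsElimination

/-! ### Eliminations on the full region versus PLUQ decompositions revealing the rank profile. -/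

section Fin

variable {m n r : ℕ} {A : Matrix (Fin m) (Fin n) K} {row : Fin r → Fin m} {col : Fin r → Fin n}
  {l : Matrix (Fin m) (Fin r) K} {u : Matrix (Fin r) (Fin n) K}

/-- The pivot matrix has an elimination with the same pivots, and the rank of a leading block
depends only on which pivots fall in it. -/
theorem IsElimination.isRankProfileMatrix
    (h : IsElimination (fun _ _ => True) A row col l u) :
    IsRankProfileMatrix A (QuasiSep.pivotE K row col) := by
  refine ⟨fun i j => ?_, fun i j j' => ?_, fun i i' j => ?_, ?_, fun k k' => ?_⟩
  · rcases pivotE_eq_zero_or_exists (K := K) col h.row_injective i j with h0 | h0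
    · exact Or.inl h0
    · exact Or.inr h0.1
  · rw [pivotE_ne_zero_iff _ h.row_injective, pivotE_ne_zero_iff _ h.row_injective]
    rintro ⟨a, rfl, rfl⟩ ⟨b, hb, rfl⟩
    rw [h.row_injective hb]
  · rw [pivotE_ne_zero_iff _ h.row_injective, pivotE_ne_zero_iff _ h.row_injective]
    rintro ⟨a, rfl, rfl⟩ ⟨b, rfl, hb⟩
    rw [h.col_injective hb]
  · rw [h.rank_eq]
    have : {x : Fin m × Fin n | QuasiSep.pivotE K row col x.1 x.2 ≠ 0} =
        (fun k => (row k, col k)) '' Set.univ := by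
      ext ⟨i, j⟩
      simp [pivotE_ne_zero_iff _ h.row_injective]
    rw [this, Set.ncard_image_of_injective, Set.ncard_univ, Nat.card_eq_fintype_card,
      Fintype.card_fin]
    exact fun a b hab => h.row_injective (Prod.ext_iff.1 hab).1
  · have hp : ∀ i i' : Fin m, i' ≤ i → (i : ℕ) < k → (i' : ℕ) < k := fun i i' hi hk =>
      (Fin.le_def.1 hi).trans_lt hk
    have hq : ∀ i i' : Fin n, i' ≤ i → (i : ℕ) < k' → (i' : ℕ) < k' := fun i i' hi hk =>
      (Fin.le_def.1 hi).trans_lt hk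
    obtain ⟨_, _, _, _, h1⟩ := h.restrict _ _ hp hq
    obtain ⟨_, _, _, _, h2⟩ := h.pivotE.restrict _ _ hp hq
    exact h2.rank_eq.trans h1.rank_eq.symm

/-- A decomposition that reveals the rank profile matrix is an elimination. -/
theorem PLUQ.Reveals.isElimination {d : PLUQ m n K} (h : d.Reveals A) :
    IsElimination (fun _ _ => True) A (fun k => d.p.symm (Sum.inl k))
      (fun k => d.q.symm (Sum.inl k)) ((fromRows d.L d.M).submatrix d.p id)
      ((fromCols d.U d.V).submatrix id d.q) where
  l_lower i k hi := by
    have := h.lower _ _ hi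
    rw [Equiv.apply_symm_apply] at this
    rw [submatrix_apply]
    revert this
    cases d.p i <;> exact id
  l_diag k := by simpa using h.unitLower.1 k
  l_tri t k ht := by simpa using h.unitLower.2 t k ht
  l_supp i k hi := absurd trivial hi
  u_upper k j hj := by
    have := h.upper _ _ hj
    rw [Equiv.apply_symm_apply] at this
    rw [submatrix_apply]
    revert this
    cases d.q j <;> exact id
  u_diag k := by simpa using h.invUpper.1 k
  u_tri t k ht := by simpa using h.invUpper.2 k t ht
  u_supp i k hi := absurd trivial hi
  eq i j _ := by
    conv_lhs => rw [h.eq]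
    rfl

/-- With the next two lemmas, this passes between the permuted block matrices of a generator and
sums indexed by pivots, which no longer mention the non-pivot part of the permutations. -/
theorem pivots_eq_pivotE (d : PLUQ m n K) : d.pivots (0 : K) 1 =
    QuasiSep.pivotE K (fun k => d.p.symm (Sum.inl k)) (fun k => d.q.symm (Sum.inl k)) := by
  ext i j
  obtain ⟨x, rfl⟩ := d.p.symm.surjective i
  obtain ⟨y, rfl⟩ := d.q.symm.surjective j
  rw [pivotE_apply]
  rcases x with a | a <;> rcases y with b | b <;> simp [PLUQ.pivots, constMatrix, eq_comm]

theorem fromBlocks_L_eq_pivotL (d : PLUQ m n K) :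
    (fromBlocks d.L 0 d.M 0).submatrix d.p d.q =
      pivotL (fun k => d.q.symm (Sum.inl k)) ((fromRows d.L d.M).submatrix d.p id) := by
  ext i j
  obtain ⟨y, rfl⟩ := d.q.symm.surjective j
  simp only [pivotL, of_apply, submatrix_apply]
  rcases y with b | b <;> cases d.p i <;> simp

theorem fromBlocks_U_eq_pivotU (d : PLUQ m n K) :
    (fromBlocks d.U d.V 0 0).submatrix d.p d.q =
      pivotU (fun k => d.p.symm (Sum.inl k)) ((fromCols d.U d.V).submatrix id d.q) := by
  ext i j
  obtain ⟨y, rfl⟩ := d.p.symm.surjective i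
  simp only [pivotU, of_apply, submatrix_apply]
  rcases y with b | b <;> cases d.q j <;> simp

/-- Conversely, an elimination is a decomposition that reveals the rank profile matrix. -/
theorem PLUQ.reveals_of_isElimination {d : PLUQ m n K}
    (h : IsElimination (fun _ _ => True) A (fun k => d.p.symm (Sum.inl k))
      (fun k => d.q.symm (Sum.inl k)) ((fromRows d.L d.M).submatrix d.p id)
      ((fromCols d.U d.V).submatrix id d.q)) : d.Reveals A where
  unitLower := by
    convert h.unitLower using 1
    ext i j
    simp
  invUpper := by
    convert h.invUpper using 1
    ext i j
    simp
  eq := h.eq_mul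
  rankProfile := by
    rw [pivots_eq_pivotE]
    exact h.isRankProfileMatrix
  lower i j hij := by
    obtain ⟨y, rfl⟩ := d.p.symm.surjective j
    rw [Equiv.apply_symm_apply]
    rcases y with b | b
    · have := h.l_lower i b hij
      rw [submatrix_apply] at this
      revert this
      cases d.p i <;> exact id
    · cases d.p i <;> rfl
  upper i j hij := by
    obtain ⟨y, rfl⟩ := d.q.symm.surjective i
    rw [Equiv.apply_symm_apply]
    rcases y with b | b
    · have := h.u_upper b j hij
      rw [submatrix_apply] at this
      revert this
      cases d.q j <;> exact id
    · cases d.q j <;> rfl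

theorem ofPivots_row (hrow : Function.Injective row) (hcol : Function.Injective col) {X : Type*}
    (l : Matrix (Fin m) (Fin r) X) (u : Matrix (Fin r) (Fin n) X) :
    (fun k => (PLUQ.ofPivots row col hrow hcol l u).p.symm (Sum.inl k)) = row :=
  funext (completion_symm_inl row hrow)

theorem ofPivots_col (hrow : Function.Injective row) (hcol : Function.Injective col) {X : Type*}
    (l : Matrix (Fin m) (Fin r) X) (u : Matrix (Fin r) (Fin n) X) :
    (fun k => (PLUQ.ofPivots row col hrow hcol l u).q.symm (Sum.inl k)) = col :=
  funext (completion_symm_inl col hcol)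

theorem ofPivots_fromRows (hrow : Function.Injective row) (hcol : Function.Injective col)
    {X : Type*} (l : Matrix (Fin m) (Fin r) X) (u : Matrix (Fin r) (Fin n) X) :
    (fromRows (PLUQ.ofPivots row col hrow hcol l u).L
      (PLUQ.ofPivots row col hrow hcol l u).M).submatrix
      (PLUQ.ofPivots row col hrow hcol l u).p id = l := by
  ext i k
  exact fromRows_completion row hrow l i k

theorem ofPivots_fromCols (hrow : Function.Injective row) (hcol : Function.Injective col)
    {X : Type*} (l : Matrix (Fin m) (Fin r) X) (u : Matrix (Fin r) (Fin n) X) :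
    (fromCols (PLUQ.ofPivots row col hrow hcol l u).U
      (PLUQ.ofPivots row col hrow hcol l u).V).submatrix id
      (PLUQ.ofPivots row col hrow hcol l u).q = u := by
  ext k j
  exact fromCols_completion col hcol u k j

theorem IsElimination.reveals (h : IsElimination (fun _ _ => True) A row col l u) :
    (PLUQ.ofPivots row col h.row_injective h.col_injective l u).Reveals A := by
  apply PLUQ.reveals_of_isElimination
  rw [ofPivots_fromRows, ofPivots_fromCols, ofPivots_row, ofPivots_col]
  exact h

theorem ofPivots_pivots (hrow : Function.Injective row) (hcol : Function.Injective col)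
    (l : Matrix (Fin m) (Fin r) K) (u : Matrix (Fin r) (Fin n) K) :
    (PLUQ.ofPivots row col hrow hcol l u).pivots (0 : K) 1 = QuasiSep.pivotE K row col := by
  rw [pivots_eq_pivotE, ofPivots_row, ofPivots_col]
  rfl

theorem ofPivots_L (hrow : Function.Injective row) (hcol : Function.Injective col)
    (l : Matrix (Fin m) (Fin r) K) (u : Matrix (Fin r) (Fin n) K) :
    let d := PLUQ.ofPivots row col hrow hcol l u
    (fromBlocks d.L 0 d.M 0).submatrix d.p d.q = pivotL col l := by
  intro d
  rw [fromBlocks_L_eq_pivotL, ofPivots_fromRows, ofPivots_col]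
  rfl

theorem ofPivots_U (hrow : Function.Injective row) (hcol : Function.Injective col)
    (l : Matrix (Fin m) (Fin r) K) (u : Matrix (Fin r) (Fin n) K) :
    let d := PLUQ.ofPivots row col hrow hcol l u
    (fromBlocks d.U d.V 0 0).submatrix d.p d.q = pivotU row u := by
  intro d
  rw [fromBlocks_U_eq_pivotU, ofPivots_fromCols, ofPivots_row]
  rfl

end Fin

/-! ### Bruhat generators from eliminations of the left triangle. -/

section Bruhat

variable {n : ℕ}

/-- The cells above the main antidiagonal. -/
def LeftRegion (n : ℕ) (i j : Fin n) : Prop := (i : ℕ) + 1 + ((j : ℕ) + 1) ≤ n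

instance : DecidableRel (LeftRegion n) := fun _ _ => Nat.decLe _ _

theorem downClosed_leftRegion : DownClosed (LeftRegion n) := by
  intro i i' j j' hi hj h
  simp only [LeftRegion, Fin.le_def] at *
  omega

theorem leftPart_apply {X : Type*} (z : X) (A : Matrix (Fin n) (Fin n) X) (i j : Fin n) :
    leftPart z A i j = if LeftRegion n i j then A i j else z := rfl

theorem leftPart_eq_of {X : Type*} {z : X} {A B : Matrix (Fin n) (Fin n) X}
    (h : ∀ i j, LeftRegion n i j → A i j = B i j) (hB : ∀ i j, ¬ LeftRegion n i j → B i j = z) :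
    leftPart z A = B := by
  ext i j
  by_cases hij : LeftRegion n i j
  · rw [leftPart_apply, if_pos hij, h i j hij]
  · rw [leftPart_apply, if_neg hij, hB i j hij]

variable {r : ℕ} {A : Matrix (Fin n) (Fin n) K} {row : Fin r → Fin n} {col : Fin r → Fin n}
  {l : Matrix (Fin n) (Fin r) K} {u : Matrix (Fin r) (Fin n) K}

/-- Extending to all cells gives the required decomposition of the left triangular matrix. The three
matrices agree on the left triangle with those of the extension, and vanish off it by the support
conditions, so they are its left parts. -/
theorem IsElimination.isBruhatGenerator (h : IsElimination (LeftRegion n) A row col l u) :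
    IsBruhatGenerator (leftPart 0 A) ⟨pivotL col l, QuasiSep.pivotE K row col, pivotU row u⟩ := by
  have h' : IsElimination (LeftRegion n) (leftPart 0 A) row col l u := by
    refine { h with eq := fun i j hij => ?_ }
    rw [← h.eq i j hij, leftPart_apply, if_pos hij]
  obtain ⟨r', row', col', l', u', hfull, hag⟩ := h'.exists_extension downClosed_leftRegion
  refine ⟨_, hfull.reveals, ?_, ?_, ?_⟩
  · rw [ofPivots_L]
    refine (leftPart_eq_of (fun i j hij => (hag i j hij).1) fun i j hij => ?_).symm
    rw [pivotL, of_apply]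
    refine Finset.sum_eq_zero fun k _ => ?_
    rw [ite_eq_right_iff]
    rintro rfl
    exact h.l_supp _ _ hij
  · rw [ofPivots_pivots]
    refine (leftPart_eq_of (fun i j hij => (hag i j hij).2.1) fun i j hij => ?_).symm
    rw [QuasiSep.pivotE, of_apply]
    refine Finset.sum_eq_zero fun k _ => if_neg ?_
    rintro ⟨rfl, rfl⟩
    exact hij (h.mem k)
  · rw [ofPivots_U]
    refine (leftPart_eq_of (fun i j hij => (hag i j hij).2.2) fun i j hij => ?_).symm
    rw [pivotU, of_apply]
    refine Finset.sum_eq_zero fun k _ => ?_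
    rw [ite_eq_right_iff]
    rintro rfl
    exact h.u_supp _ _ hij

end Bruhat

end Rank

end QuasiSep

namespace QuasiSep

/-! ### Program logic: results, memory and cost of an execution. -/

section Semantics

variable {K : Type u} [Field K] {α β : Type}

theorem Prog.run_pure (a : α) (σ : List K) : (pure a : Prog K α).run σ = ⟨a, σ, 0⟩ := rfl

theorem Prog.run_bind (p : Prog K α) (f : α → Prog K β) (σ : List K) :
    (p >>= f).run σ = ⟨((f (p.run σ).val).run (p.run σ).mem).val,
      ((f (p.run σ).val).run (p.run σ).mem).mem,
      (p.run σ).cost + ((f (p.run σ).val).run (p.run σ).mem).cost⟩ := by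
  change (p.bind f).run σ = _
  induction p generalizing σ with
  | ret a => simp [Prog.bind, Prog.run]
  | const c k ih => simp only [Prog.bind, Prog.run, ih]
  | arith o i j k ih =>
    simp only [Prog.bind, Prog.run, ih]
    congr 1
    omega
  | isZero i k ih =>
    simp only [Prog.bind, Prog.run, ih]
    congr 1
    omega

/-- Memory is append-only. Every statement about stored values therefore survives later computation,
which is what `Holds.mono` and `Rep.mono` exploit. -/
theorem Prog.prefix_run (p : Prog K α) (σ : List K) : σ <+: (p.run σ).mem := by
  induction p generalizing σ with
  | ret a => exact List.prefix_rfl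
  | const c k ih => exact (List.prefix_append σ [c]).trans (ih _ _)
  | arith o i j k ih => exact (List.prefix_append σ _).trans (ih _ _)
  | isZero i k ih => exact ih _ _

/-- The execution of `p` from the memory `σ` has a result, a final memory and a cost as described
by `Q`. -/
def Prog.Spec (p : Prog K α) (σ : List K) (Q : α → List K → ℕ → Prop) : Prop :=
  Q (p.run σ).val (p.run σ).mem (p.run σ).cost

theorem Prog.Spec.mono {p : Prog K α} {σ : List K} {Q Q' : α → List K → ℕ → Prop}
    (h : p.Spec σ Q) (hQ : ∀ a τ c, σ <+: τ → Q a τ c → Q' a τ c) : p.Spec σ Q' :=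
  hQ _ _ _ (p.prefix_run σ) h

theorem Prog.Spec.pure {a : α} {σ : List K} {Q : α → List K → ℕ → Prop} (h : Q a σ 0) :
    (Pure.pure a : Prog K α).Spec σ Q := h

/-- The rule for sequencing: the cost `c` already spent is added inside the postcondition left to
prove, so costs accumulate along the program. -/
theorem Prog.Spec.bind {p : Prog K α} {f : α → Prog K β} {σ : List K}
    {Q₁ : α → List K → ℕ → Prop} {Q : β → List K → ℕ → Prop} (hp : p.Spec σ Q₁)
    (hf : ∀ a τ c, σ <+: τ → Q₁ a τ c → (f a).Spec τ fun b μ c' => Q b μ (c + c')) :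
    (p >>= f).Spec σ Q := by
  rw [Prog.Spec, Prog.run_bind]
  exact hf _ _ _ (p.prefix_run σ) hp

/-- The cell of address `a` holds the value `x`. -/
def Holds (σ : List K) (a : ℕ) (x : K) : Prop := σ[a]? = some x

theorem Holds.mono {σ τ : List K} {a : ℕ} {x : K} (h : Holds σ a x) (hτ : σ <+: τ) :
    Holds τ a x := by
  obtain ⟨t, rfl⟩ := hτ
  have hlt : a < σ.length := by
    by_contra hge
    rw [Holds, List.getElem?_eq_none (not_lt.1 hge)] at h
    exact absurd h (by simp)
  rw [Holds, List.getElem?_append_left hlt]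
  exact h

theorem Holds.getD {σ : List K} {a : ℕ} {x : K} (h : Holds σ a x) : σ.getD a 0 = x := by
  rw [List.getD_eq_getElem?_getD, show σ[a]? = some x from h, Option.getD_some]

theorem holds_length (σ : List K) (x : K) : Holds (σ ++ [x]) σ.length x := by
  simp [Holds]

theorem Rep.mono {ι κ : Type*} {σ τ : List K} {A : Matrix ι κ ℕ} {V : Matrix ι κ K}
    (h : Rep σ A V) (hτ : σ <+: τ) : Rep τ A V :=
  fun i j => Holds.mono (h i j) hτ

theorem Rep.submatrix {ι κ ι' κ' : Type*} {σ : List K} {A : Matrix ι κ ℕ} {V : Matrix ι κ K}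
    (h : Rep σ A V) (f : ι' → ι) (g : κ' → κ) : Rep σ (A.submatrix f g) (V.submatrix f g) :=
  fun i j => h (f i) (g j)

theorem Rep.transpose {ι κ : Type*} {σ : List K} {A : Matrix ι κ ℕ} {V : Matrix ι κ K}
    (h : Rep σ A V) : Rep σ Aᵀ Vᵀ :=
  fun i j => h j i

theorem rep_constMatrix {ι κ : Type*} {σ : List K} {z : ℕ} {x : K} (h : Holds σ z x) :
    Rep σ (constMatrix z : Matrix ι κ ℕ) (constMatrix x) :=
  fun _ _ => h

theorem rep_zero {ι κ : Type*} {σ : List K} {z : ℕ} (h : Holds σ z (0 : K)) :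
    Rep σ (constMatrix z : Matrix ι κ ℕ) 0 :=
  fun _ _ => h

theorem Rep.fromRows {ι₁ ι₂ κ : Type*} {σ : List K} {A : Matrix ι₁ κ ℕ} {B : Matrix ι₂ κ ℕ}
    {V : Matrix ι₁ κ K} {W : Matrix ι₂ κ K} (hA : Rep σ A V) (hB : Rep σ B W) :
    Rep σ (fromRows A B) (fromRows V W) := by
  rintro (i | i) j
  · exact hA i j
  · exact hB i j

theorem Rep.fromCols {ι κ₁ κ₂ : Type*} {σ : List K} {A : Matrix ι κ₁ ℕ} {B : Matrix ι κ₂ ℕ}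
    {V : Matrix ι κ₁ K} {W : Matrix ι κ₂ K} (hA : Rep σ A V) (hB : Rep σ B W) :
    Rep σ (fromCols A B) (fromCols V W) := by
  rintro i (j | j)
  · exact hA i j
  · exact hB i j

theorem Rep.fromBlocks {ι₁ ι₂ κ₁ κ₂ : Type*} {σ : List K} {A : Matrix ι₁ κ₁ ℕ}
    {B : Matrix ι₁ κ₂ ℕ} {C : Matrix ι₂ κ₁ ℕ} {D : Matrix ι₂ κ₂ ℕ} {A' : Matrix ι₁ κ₁ K}
    {B' : Matrix ι₁ κ₂ K} {C' : Matrix ι₂ κ₁ K} {D' : Matrix ι₂ κ₂ K} (hA : Rep σ A A')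
    (hB : Rep σ B B') (hC : Rep σ C C') (hD : Rep σ D D') :
    Rep σ (fromBlocks A B C D) (fromBlocks A' B' C' D') := by
  rintro (i | i) (j | j)
  · exact hA i j
  · exact hB i j
  · exact hC i j
  · exact hD i j

theorem Rep.assemble {n : ℕ} {σ : List K} {A₁ A₂ A₃ A₄} {V₁ V₂ V₃ V₄} (h₁ : Rep σ A₁ V₁)
    (h₂ : Rep σ A₂ V₂) (h₃ : Rep σ A₃ V₃) (h₄ : Rep σ A₄ V₄) :
    Rep σ (assemble n A₁ A₂ A₃ A₄) (assemble n V₁ V₂ V₃ V₄) :=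
  (h₁.fromBlocks h₂ h₃ h₄).submatrix _ _

theorem Rep.leftPart {m n : ℕ} {σ : List K} {A : Matrix (Fin m) (Fin n) ℕ}
    {V : Matrix (Fin m) (Fin n) K} {z : ℕ} {x : K} (h : Rep σ A V) (hz : Holds σ z x) :
    Rep σ (leftPart z A) (leftPart x V) := by
  intro i j
  simp only [QuasiSep.leftPart, of_apply]
  split_ifs
  · exact h i j
  · exact hz

theorem rep_pivots {m n : ℕ} {σ : List K} {z o : ℕ} {x y : K} (hz : Holds σ z x)
    (ho : Holds σ o y) {X : Type*} (d : PLUQ m n X) : Rep σ (d.pivots z o) (d.pivots x y) := by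
  refine Rep.submatrix (Rep.fromBlocks ?_ (rep_constMatrix hz) (rep_constMatrix hz)
    (rep_constMatrix hz)) _ _
  intro i j
  simp only [of_apply]
  split_ifs
  · exact ho
  · exact hz

theorem Prog.spec_const (c : K) (σ : List K) :
    (Prog.const c Prog.ret).Spec σ fun a τ cost => Holds τ a c ∧ cost = 0 :=
  ⟨holds_length σ c, rfl⟩

theorem Prog.spec_arith (o : ArithOp) {i j : ℕ} {σ : List K} {x y : K} (hi : Holds σ i x)
    (hj : Holds σ j y) :
    (Prog.arith o i j Prog.ret).Spec σ fun a τ cost => Holds τ a (o.eval x y) ∧ cost = 1 := by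
  refine ⟨?_, rfl⟩
  rw [← hi.getD, ← hj.getD]
  exact holds_length σ _

/-- Stability of `Q` under growth of the memory carries the result of each iteration through the
later ones. -/
theorem Prog.spec_forFin {n : ℕ} {f : Fin n → Prog K α} {σ : List K} {Q : Fin n → α → List K → Prop}
    {b : ℝ} (hmono : ∀ i a τ τ', Q i a τ → τ <+: τ' → Q i a τ')
    (h : ∀ i τ, σ <+: τ → (f i).Spec τ fun a μ cost => Q i a μ ∧ (cost : ℝ) ≤ b) :
    (Prog.forFin n f).Spec σ fun g τ cost => (∀ i, Q i (g i) τ) ∧ (cost : ℝ) ≤ n * b := by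
  induction n generalizing σ with
  | zero => exact Prog.Spec.pure ⟨fun i => i.elim0, by simp⟩
  | succ n ih =>
    rw [Prog.forFin]
    refine Prog.Spec.bind (h 0 σ List.prefix_rfl) fun a τ c hτ ha => ?_
    refine Prog.Spec.bind (ih (Q := fun i => Q i.succ) (fun i => hmono _)
      fun i μ hμ => h i.succ μ (hτ.trans hμ)) fun g μ c' hμ hg => ?_
    refine Prog.Spec.pure ⟨fun i => ?_, ?_⟩
    · induction i using Fin.cases with
      | zero => exact hmono _ _ _ _ ha.1 hμ
      | succ i => exact hg.1 i
    · have h1 := ha.2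
      have h2 := hg.2
      push_cast
      linarith

/-- Run one arithmetic operation for each entry of a matrix. -/
theorem Prog.spec_forFin_arith {m n : ℕ} (o : ArithOp) {A B : Matrix (Fin m) (Fin n) ℕ}
    {σ : List K} {V W : Matrix (Fin m) (Fin n) K} (hA : Rep σ A V) (hB : Rep σ B W) :
    (Prog.forFin m fun i => Prog.forFin n fun j => Prog.arith o (A i j) (B i j) Prog.ret).Spec σ
      fun C τ cost => Rep τ (Matrix.of C) (Matrix.of fun i j => o.eval (V i j) (W i j)) ∧
        (cost : ℝ) ≤ m * n := by
  refine (Prog.spec_forFin (b := n)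
    (Q := fun i C τ => ∀ j, Holds τ (C j) (o.eval (V i j) (W i j))) ?_ ?_).mono ?_
  · exact fun i C τ τ' hC hτ j => (hC j).mono hτ
  · intro i τ hτ
    refine (Prog.spec_forFin (b := 1)
      (Q := fun j a τ => Holds τ a (o.eval (V i j) (W i j))) ?_ ?_).mono ?_
    · exact fun j a τ τ' ha hτ => ha.mono hτ
    · intro j μ hμ
      refine (Prog.spec_arith o ((hA.mono (hτ.trans hμ)) i j) ((hB.mono (hτ.trans hμ)) i j)).mono ?_
      rintro a ν c _ ⟨ha, rfl⟩
      exact ⟨ha, by simp⟩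
    · rintro C μ c _ ⟨hC, hc⟩
      exact ⟨hC, by simpa using hc⟩
  · rintro C μ c _ ⟨hC, hc⟩
    exact ⟨fun i j => hC i j, hc⟩

theorem spec_addMatrix {m n : ℕ} {A B : Matrix (Fin m) (Fin n) ℕ} {σ : List K}
    {V W : Matrix (Fin m) (Fin n) K} (hA : Rep σ A V) (hB : Rep σ B W) :
    (addMatrix A B).Spec σ fun C τ cost => Rep τ C (V + W) ∧ (cost : ℝ) ≤ m * n := by
  refine Prog.Spec.bind (Prog.spec_forFin_arith .add hA hB) ?_
  rintro C τ c _ ⟨hC, hc⟩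
  exact Prog.Spec.pure ⟨hC, by simpa using hc⟩

end Semantics

end QuasiSep

namespace QuasiSep

/-! ### The splitting of indices into two halves. -/

section Split

variable {n : ℕ} {X : Type*}

/-- The first `⌈n/2⌉` rows. -/
def rowTop (n : ℕ) : Fin (n - n / 2) ↪o Fin n :=
  OrderEmbedding.ofStrictMono (fun i => (rowSplit n).symm (Sum.inl i)) fun a b h => by
    simpa only [rowSplit, Equiv.symm_trans_apply, Equiv.symm_symm, finSumFinEquiv_apply_left,
      finSumFinEquiv_apply_right, finCongr_symm, finCongr_apply, Fin.lt_def, Fin.val_cast,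
      Fin.val_castAdd, Fin.val_natAdd, add_lt_add_iff_left] using h

/-- The last `⌊n/2⌋` rows. -/
def rowBot (n : ℕ) : Fin (n / 2) ↪o Fin n :=
  OrderEmbedding.ofStrictMono (fun i => (rowSplit n).symm (Sum.inr i)) fun a b h => by
    simpa only [rowSplit, Equiv.symm_trans_apply, Equiv.symm_symm, finSumFinEquiv_apply_left,
      finSumFinEquiv_apply_right, finCongr_symm, finCongr_apply, Fin.lt_def, Fin.val_cast,
      Fin.val_castAdd, Fin.val_natAdd, add_lt_add_iff_left] using h

/-- The first `⌊n/2⌋` columns. -/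
def colLeft (n : ℕ) : Fin (n / 2) ↪o Fin n :=
  OrderEmbedding.ofStrictMono (fun i => (colSplit n).symm (Sum.inl i)) fun a b h => by
    simpa only [colSplit, Equiv.symm_trans_apply, Equiv.symm_symm, finSumFinEquiv_apply_left,
      finSumFinEquiv_apply_right, finCongr_symm, finCongr_apply, Fin.lt_def, Fin.val_cast,
      Fin.val_castAdd, Fin.val_natAdd, add_lt_add_iff_left] using h

/-- The last `⌈n/2⌉` columns. -/
def colRight (n : ℕ) : Fin (n - n / 2) ↪o Fin n :=
  OrderEmbedding.ofStrictMono (fun i => (colSplit n).symm (Sum.inr i)) fun a b h => by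
    simpa only [colSplit, Equiv.symm_trans_apply, Equiv.symm_symm, finSumFinEquiv_apply_left,
      finSumFinEquiv_apply_right, finCongr_symm, finCongr_apply, Fin.lt_def, Fin.val_cast,
      Fin.val_castAdd, Fin.val_natAdd, add_lt_add_iff_left] using h

@[simp] theorem rowSplit_rowTop (i : Fin (n - n / 2)) : rowSplit n (rowTop n i) = Sum.inl i :=
  (rowSplit n).apply_symm_apply _

@[simp] theorem rowSplit_rowBot (i : Fin (n / 2)) : rowSplit n (rowBot n i) = Sum.inr i :=
  (rowSplit n).apply_symm_apply _

@[simp] theorem colSplit_colLeft (i : Fin (n / 2)) : colSplit n (colLeft n i) = Sum.inl i :=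
  (colSplit n).apply_symm_apply _

@[simp] theorem colSplit_colRight (i : Fin (n - n / 2)) : colSplit n (colRight n i) = Sum.inr i :=
  (colSplit n).apply_symm_apply _

@[simp] theorem val_rowTop (i : Fin (n - n / 2)) : (rowTop n i : ℕ) = i := by
  simp [rowTop, rowSplit]

@[simp] theorem val_rowBot (i : Fin (n / 2)) : (rowBot n i : ℕ) = n - n / 2 + i := by
  simp [rowBot, rowSplit]

@[simp] theorem val_colLeft (i : Fin (n / 2)) : (colLeft n i : ℕ) = i := by
  simp [colLeft, colSplit]

@[simp] theorem val_colRight (i : Fin (n - n / 2)) : (colRight n i : ℕ) = n / 2 + i := by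
  simp [colRight, colSplit]

theorem row_cases {P : Fin n → Prop} (h₁ : ∀ i, P (rowTop n i)) (h₂ : ∀ i, P (rowBot n i))
    (i : Fin n) : P i := by
  obtain ⟨x, rfl⟩ := (rowSplit n).symm.surjective i
  rcases x with x | x
  · exact h₁ x
  · exact h₂ x

theorem col_cases {P : Fin n → Prop} (h₁ : ∀ i, P (colLeft n i)) (h₂ : ∀ i, P (colRight n i))
    (i : Fin n) : P i := by
  obtain ⟨x, rfl⟩ := (colSplit n).symm.surjective i
  rcases x with x | x
  · exact h₁ x
  · exact h₂ x

theorem rowTop_ne_rowBot (i : Fin (n - n / 2)) (j : Fin (n / 2)) : rowTop n i ≠ rowBot n j := by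
  intro h
  have := congrArg Fin.val h
  simp only [val_rowTop, val_rowBot] at this
  omega

theorem colLeft_ne_colRight (i : Fin (n / 2)) (j : Fin (n - n / 2)) :
    colLeft n i ≠ colRight n j := by
  intro h
  have := congrArg Fin.val h
  simp only [val_colLeft, val_colRight] at this
  omega

variable (A₁ : Matrix (Fin (n - n / 2)) (Fin (n / 2)) X)
  (A₂ : Matrix (Fin (n - n / 2)) (Fin (n - n / 2)) X)
  (A₃ : Matrix (Fin (n / 2)) (Fin (n / 2)) X) (A₄ : Matrix (Fin (n / 2)) (Fin (n - n / 2)) X)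

@[simp] theorem assemble_top_left (i j) :
    assemble n A₁ A₂ A₃ A₄ (rowTop n i) (colLeft n j) = A₁ i j := by simp [assemble]

@[simp] theorem assemble_top_right (i j) :
    assemble n A₁ A₂ A₃ A₄ (rowTop n i) (colRight n j) = A₂ i j := by simp [assemble]

@[simp] theorem assemble_bot_left (i j) :
    assemble n A₁ A₂ A₃ A₄ (rowBot n i) (colLeft n j) = A₃ i j := by simp [assemble]

@[simp] theorem assemble_bot_right (i j) :
    assemble n A₁ A₂ A₃ A₄ (rowBot n i) (colRight n j) = A₄ i j := by simp [assemble]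

-- The split is chosen for these four facts: since `⌈n/2⌉ + ⌊n/2⌋ = n`, the top left block is wholly
-- in the left triangle, the bottom right one wholly outside, and the other two meet it in their own
-- left triangles.
@[simp] theorem leftRegion_top_left (i j) :
    LeftRegion n (rowTop n i) (colLeft n j) := by
  simp only [LeftRegion, val_rowTop, val_colLeft]
  omega

@[simp] theorem leftRegion_top_right (i j) :
    LeftRegion n (rowTop n i) (colRight n j) ↔ LeftRegion (n - n / 2) i j := by
  simp only [LeftRegion, val_rowTop, val_colRight]
  omega

@[simp] theorem leftRegion_bot_left (i j) :
    LeftRegion n (rowBot n i) (colLeft n j) ↔ LeftRegion (n / 2) i j := by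
  simp only [LeftRegion, val_rowBot, val_colLeft]
  omega

@[simp] theorem not_leftRegion_bot_right (i j) :
    ¬ LeftRegion n (rowBot n i) (colRight n j) := by
  simp only [LeftRegion, val_rowBot, val_colRight]
  omega

end Split

/-! ### Prolonging eliminations, and the pivot matrices of combined eliminations. -/

section Widen

variable {K : Type*} [Field K] {ρ κ ρ' κ' : Type*} [LinearOrder ρ] [LinearOrder κ]
  [LinearOrder ρ'] [LinearOrder κ'] {r : ℕ}

/-- An elimination of a leading block, with the vectors continued arbitrarily. -/
theorem IsElimination.widen {A : Matrix ρ κ K} {row : Fin r → ρ} {col : Fin r → κ}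
    {l : Matrix ρ (Fin r) K} {u : Matrix (Fin r) κ K}
    (h : IsElimination (fun _ _ => True) A row col l u) (f : ρ ↪o ρ') (g : κ ↪o κ')
    (hf : ∀ i a, i ∉ Set.range f → f a < i) (hg : ∀ j a, j ∉ Set.range g → g a < j)
    {l' : Matrix ρ' (Fin r) K} {u' : Matrix (Fin r) κ' K}
    (hl : ∀ i k, l' (f i) k = l i k) (hu : ∀ k j, u' k (g j) = u k j) :
    IsElimination (fun _ _ => True) (l' * u') (f ∘ row) (g ∘ col) l' u' where
  l_lower i k hi := by
    by_cases hr : i ∈ Set.range f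
    · obtain ⟨i, rfl⟩ := hr
      rw [hl]
      exact h.l_lower i k (f.lt_iff_lt.1 hi)
    · exact absurd hi (lt_asymm (hf i _ hr))
  l_diag k := by simp [hl, h.l_diag]
  l_tri t k ht := by simp [hl, h.l_tri t k ht]
  l_supp i k hi := absurd trivial hi
  u_upper k j hj := by
    by_cases hr : j ∈ Set.range g
    · obtain ⟨j, rfl⟩ := hr
      rw [hu]
      exact h.u_upper k j (g.lt_iff_lt.1 hj)
    · exact absurd hj (lt_asymm (hg j _ hr))
  u_diag k := by simp [hu, h.u_diag]
  u_tri t k ht := by simp [hu, h.u_tri t k ht]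
  u_supp k j hj := absurd trivial hj
  eq i j _ := Matrix.mul_apply

theorem pivotL_append {r₁ r₂ : ℕ} (col₁ : Fin r₁ → κ) (col₂ : Fin r₂ → κ)
    (l₁ : Matrix ρ (Fin r₁) K) (l₂ : Matrix ρ (Fin r₂) K) :
    pivotL (Fin.append col₁ col₂) (Matrix.of fun i => Fin.append (l₁ i) (l₂ i)) =
      pivotL col₁ l₁ + pivotL col₂ l₂ := by
  ext i j
  simp [pivotL, Fin.sum_univ_add]

theorem pivotE_append {r₁ r₂ : ℕ} (row₁ : Fin r₁ → ρ) (row₂ : Fin r₂ → ρ) (col₁ : Fin r₁ → κ)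
    (col₂ : Fin r₂ → κ) :
    pivotE K (Fin.append row₁ row₂) (Fin.append col₁ col₂) =
      pivotE K row₁ col₁ + pivotE K row₂ col₂ := by
  ext i j
  simp only [pivotE, of_apply, Fin.sum_univ_add, Fin.append_left, Fin.append_right,
    Matrix.add_apply]

theorem pivotU_append {r₁ r₂ : ℕ} (row₁ : Fin r₁ → ρ) (row₂ : Fin r₂ → ρ)
    (u₁ : Matrix (Fin r₁) κ K) (u₂ : Matrix (Fin r₂) κ K) :
    pivotU (Fin.append row₁ row₂)
      (Matrix.of fun k j => Fin.append (fun t => u₁ t j) (fun t => u₂ t j) k) =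
      pivotU row₁ u₁ + pivotU row₂ u₂ := by
  ext i j
  simp [pivotU, Fin.sum_univ_add]

/-- The entry `l i k` is stored at the cell `(i, col k)`, the very cell whose membership decides
whether it is cut. -/
theorem pivotL_truncate {n : ℕ} (col : Fin r → Fin n) (l : Matrix (Fin n) (Fin r) K) :
    pivotL col (Matrix.of fun i k => if LeftRegion n i (col k) then l i k else 0) =
      leftPart 0 (pivotL col l) := by
  ext i j
  rw [leftPart_apply, pivotL, pivotL, of_apply, of_apply]
  split_ifs with h
  · refine Finset.sum_congr rfl fun k _ => ?_
    split_ifs with hk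
    · rw [of_apply, if_pos (hk ▸ h)]
    · rfl
  · refine Finset.sum_eq_zero fun k _ => ?_
    split_ifs with hk
    · rw [of_apply, if_neg (hk ▸ h)]
    · rfl

theorem pivotU_truncate {n : ℕ} (row : Fin r → Fin n) (u : Matrix (Fin r) (Fin n) K) :
    pivotU row (Matrix.of fun k j => if LeftRegion n (row k) j then u k j else 0) =
      leftPart 0 (pivotU row u) := by
  ext i j
  rw [leftPart_apply, pivotU, pivotU, of_apply, of_apply]
  split_ifs with h
  · refine Finset.sum_congr rfl fun k _ => ?_
    split_ifs with hk
    · rw [of_apply, if_pos (hk ▸ h)]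
    · rfl
  · refine Finset.sum_eq_zero fun k _ => ?_
    split_ifs with hk
    · rw [of_apply, if_neg (hk ▸ h)]
    · rfl

end Widen

/-! ### One level of the recursion. -/

section Step

variable {K : Type*} [Field K] {n r : ℕ}

theorem pivotL_colLeft (col : Fin r → Fin (n / 2)) (l : Matrix (Fin (n - n / 2)) (Fin r) K)
    (l' : Matrix (Fin (n / 2)) (Fin r) K) :
    pivotL (colLeft n ∘ col) ((fromRows l l').submatrix (rowSplit n) id) =
      assemble n (pivotL col l) 0 (pivotL col l') 0 := by
  ext i j
  induction i using row_cases with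
  | h₁ i => induction j using col_cases with
    | h₁ j => simp [pivotL]
    | h₂ j => simp [pivotL, colLeft_ne_colRight]
  | h₂ i => induction j using col_cases with
    | h₁ j => simp [pivotL]
    | h₂ j => simp [pivotL, colLeft_ne_colRight]

theorem pivotL_colRight (col : Fin r → Fin (n - n / 2)) (l : Matrix (Fin (n - n / 2)) (Fin r) K)
    (l' : Matrix (Fin (n / 2)) (Fin r) K) :
    pivotL (colRight n ∘ col) ((fromRows l l').submatrix (rowSplit n) id) =
      assemble n 0 (pivotL col l) 0 (pivotL col l') := by
  ext i j
  induction i using row_cases with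
  | h₁ i => induction j using col_cases with
    | h₁ j => simp [pivotL, (colLeft_ne_colRight _ _).symm]
    | h₂ j => simp [pivotL]
  | h₂ i => induction j using col_cases with
    | h₁ j => simp [pivotL, (colLeft_ne_colRight _ _).symm]
    | h₂ j => simp [pivotL]

theorem pivotU_rowTop (row : Fin r → Fin (n - n / 2)) (u : Matrix (Fin r) (Fin (n / 2)) K)
    (u' : Matrix (Fin r) (Fin (n - n / 2)) K) :
    pivotU (rowTop n ∘ row) ((fromCols u u').submatrix id (colSplit n)) =
      assemble n (pivotU row u) (pivotU row u') 0 0 := by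
  ext i j
  induction i using row_cases with
  | h₁ i => induction j using col_cases with
    | h₁ j => simp [pivotU]
    | h₂ j => simp [pivotU]
  | h₂ i => induction j using col_cases with
    | h₁ j => simp [pivotU, rowTop_ne_rowBot]
    | h₂ j => simp [pivotU, rowTop_ne_rowBot]

theorem pivotU_rowBot (row : Fin r → Fin (n / 2)) (u : Matrix (Fin r) (Fin (n / 2)) K)
    (u' : Matrix (Fin r) (Fin (n - n / 2)) K) :
    pivotU (rowBot n ∘ row) ((fromCols u u').submatrix id (colSplit n)) =
      assemble n 0 0 (pivotU row u) (pivotU row u') := by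
  ext i j
  induction i using row_cases with
  | h₁ i => induction j using col_cases with
    | h₁ j => simp [pivotU, (rowTop_ne_rowBot _ _).symm]
    | h₂ j => simp [pivotU, (rowTop_ne_rowBot _ _).symm]
  | h₂ i => induction j using col_cases with
    | h₁ j => simp [pivotU]
    | h₂ j => simp [pivotU]

theorem pivotE_top_left (row : Fin r → Fin (n - n / 2)) (col : Fin r → Fin (n / 2)) :
    pivotE K (rowTop n ∘ row) (colLeft n ∘ col) = assemble n (pivotE K row col) 0 0 0 := by
  ext i j
  induction i using row_cases with
  | h₁ i => induction j using col_cases with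
    | h₁ j => simp [pivotE]
    | h₂ j => simp [pivotE, colLeft_ne_colRight]
  | h₂ i => induction j using col_cases with
    | h₁ j => simp [pivotE, rowTop_ne_rowBot]
    | h₂ j => simp [pivotE, rowTop_ne_rowBot]

theorem pivotE_top_right (row : Fin r → Fin (n - n / 2)) (col : Fin r → Fin (n - n / 2)) :
    pivotE K (rowTop n ∘ row) (colRight n ∘ col) = assemble n 0 (pivotE K row col) 0 0 := by
  ext i j
  induction i using row_cases with
  | h₁ i => induction j using col_cases with
    | h₁ j => simp [pivotE, (colLeft_ne_colRight _ _).symm]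
    | h₂ j => simp [pivotE]
  | h₂ i => induction j using col_cases with
    | h₁ j => simp [pivotE, rowTop_ne_rowBot]
    | h₂ j => simp [pivotE, rowTop_ne_rowBot]

theorem pivotE_bot_left (row : Fin r → Fin (n / 2)) (col : Fin r → Fin (n / 2)) :
    pivotE K (rowBot n ∘ row) (colLeft n ∘ col) = assemble n 0 0 (pivotE K row col) 0 := by
  ext i j
  induction i using row_cases with
  | h₁ i => induction j using col_cases with
    | h₁ j => simp [pivotE, (rowTop_ne_rowBot _ _).symm]
    | h₂ j => simp [pivotE, (rowTop_ne_rowBot _ _).symm]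
  | h₂ i => induction j using col_cases with
    | h₁ j => simp [pivotE]
    | h₂ j => simp [pivotE, colLeft_ne_colRight]

/-- One level of the recursion, in terms of eliminations: `A₁ = l u` is eliminated, and
`A₂ - l D` and `A₃ - E u` are eliminated on their left triangular parts. -/
theorem isElimination_step {A₁ : Matrix (Fin (n - n / 2)) (Fin (n / 2)) K} {A₂ A₃ A₄}
    {row : Fin r → Fin (n - n / 2)} {col : Fin r → Fin (n / 2)}
    {l : Matrix (Fin (n - n / 2)) (Fin r) K} {u : Matrix (Fin r) (Fin (n / 2)) K}
    (h₁ : IsElimination (fun _ _ => True) A₁ row col l u)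
    {D : Matrix (Fin r) (Fin (n - n / 2)) K} {E : Matrix (Fin (n / 2)) (Fin r) K}
    (hD : ∀ t j, (A₂ - l * D) (row t) j = 0) (hE : ∀ t i, (A₃ - E * u) i (col t) = 0)
    {r₂ : ℕ} {row₂ : Fin r₂ → Fin (n - n / 2)} {col₂ : Fin r₂ → Fin (n - n / 2)}
    {l₂ : Matrix (Fin (n - n / 2)) (Fin r₂) K} {u₂ : Matrix (Fin r₂) (Fin (n - n / 2)) K}
    (h₂ : IsElimination (LeftRegion (n - n / 2)) (A₂ - l * D) row₂ col₂ l₂ u₂)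
    {r₃ : ℕ} {row₃ : Fin r₃ → Fin (n / 2)} {col₃ : Fin r₃ → Fin (n / 2)}
    {l₃ : Matrix (Fin (n / 2)) (Fin r₃) K} {u₃ : Matrix (Fin r₃) (Fin (n / 2)) K}
    (h₃ : IsElimination (LeftRegion (n / 2)) (A₃ - E * u) row₃ col₃ l₃ u₃) :
    ∃ (r' : ℕ) (row' : Fin r' → Fin n) (col' : Fin r' → Fin n) (l' : Matrix (Fin n) (Fin r') K)
      (u' : Matrix (Fin r') (Fin n) K),
      IsElimination (LeftRegion n) (assemble n A₁ A₂ A₃ A₄) row' col' l' u' ∧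
      pivotL col' l' = leftPart 0 (assemble n (pivotL col l) 0 (pivotL col E) 0) +
        assemble n 0 (pivotL col₂ l₂) (pivotL col₃ l₃) 0 ∧
      pivotE K row' col' =
        assemble n (pivotE K row col) (pivotE K row₂ col₂) (pivotE K row₃ col₃) 0 ∧
      pivotU row' u' = assemble n (pivotU row u) (leftPart 0 (pivotU row D)) 0 0 +
        assemble n 0 (pivotU row₂ u₂) (pivotU row₃ u₃) 0 := by
  -- The vectors of `A₁`, prolonged by `E` below and `D` to the right, are cut to the left triangle;
  -- this is the source of the `Left` in the formulas for the output.
  have e₁ := (h₁.widen (rowTop n) (colLeft n)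
    (fun i a hi => by
      induction i using row_cases with
      | h₁ i => exact absurd ⟨i, rfl⟩ hi
      | h₂ i =>
        rw [Fin.lt_def, val_rowTop, val_rowBot]
        omega)
    (fun j a hj => by
      induction j using col_cases with
      | h₁ j => exact absurd ⟨j, rfl⟩ hj
      | h₂ j =>
        rw [Fin.lt_def, val_colLeft, val_colRight]
        omega)
    (l' := (fromRows l E).submatrix (rowSplit n) id)
    (u' := (fromCols u D).submatrix id (colSplit n))
    (fun i k => by simp) (fun k j => by simp)).truncate downClosed_leftRegion
    (fun k => leftRegion_top_left _ _)
  have e₂ : IsElimination (LeftRegion n) (assemble n 0 (A₂ - l * D) 0 0) (rowTop n ∘ row₂)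
      (colRight n ∘ col₂)
      ((fromRows l₂ (0 : Matrix (Fin (n / 2)) _ K)).submatrix (rowSplit n) id)
      ((fromCols (0 : Matrix _ (Fin (n / 2)) K) u₂).submatrix id (colSplit n)) := by
    refine h₂.embed (rowTop n) (colRight n) (fun i j => leftRegion_top_right i j) ?_ ?_ ?_ ?_ ?_ ?_
    · simp
    · intro i k hi
      induction i using row_cases with
      | h₁ i => exact absurd ⟨i, rfl⟩ hi
      | h₂ i => simp
    · simp
    · intro k j hj
      induction j using col_cases with
      | h₁ j => simp
      | h₂ j => exact absurd ⟨j, rfl⟩ hj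
    · simp
    · intro i j _ hij
      induction i using row_cases with
      | h₁ i =>
        induction j using col_cases with
        | h₁ j => simp
        | h₂ j => simp at hij
      | h₂ i => induction j using col_cases <;> simp
  have e₃ : IsElimination (LeftRegion n) (assemble n 0 0 (A₃ - E * u) 0) (rowBot n ∘ row₃)
      (colLeft n ∘ col₃)
      ((fromRows (0 : Matrix (Fin (n - n / 2)) _ K) l₃).submatrix (rowSplit n) id)
      ((fromCols u₃ (0 : Matrix _ (Fin (n - n / 2)) K)).submatrix id (colSplit n)) := by
    refine h₃.embed (rowBot n) (colLeft n) (fun i j => leftRegion_bot_left i j) ?_ ?_ ?_ ?_ ?_ ?_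
    · simp
    · intro i k hi
      induction i using row_cases with
      | h₁ i => simp
      | h₂ i => exact absurd ⟨i, rfl⟩ hi
    · simp
    · intro k j hj
      induction j using col_cases with
      | h₁ j => exact absurd ⟨j, rfl⟩ hj
      | h₂ j => simp
    · simp
    · intro i j _ hij
      induction i using row_cases with
      | h₁ i => induction j using col_cases <;> simp
      | h₂ i =>
        induction j using col_cases with
        | h₁ j => simp at hij
        | h₂ j => simp
  -- The two residuals share no row and no column, so each vanishes on the pivot rows and columns of
  -- the other.
  have e₂₃ := e₂.append e₃ (A := assemble n 0 (A₂ - l * D) (A₃ - E * u) 0)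
    (fun t j _ => by induction j using col_cases <;> simp)
    (fun t i _ => by induction i using row_cases <;> simp)
    (fun i j _ => by
      induction i using row_cases <;> induction j using col_cases <;> simp)
  have e := e₁.append e₂₃ (A := assemble n A₁ A₂ A₃ A₄)
    (fun t j _ => by
      induction j using col_cases with
      | h₁ j => simp
      | h₂ j => simpa using hD t j)
    (fun t i _ => by
      induction i using row_cases with
      | h₁ i => simp
      | h₂ i => simpa using hE t i)
    (fun i j hij => by
      induction i using row_cases with
      | h₁ i =>
        induction j using col_cases with
        | h₁ j => simp [h₁.eq_mul, Matrix.mul_apply]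
        | h₂ j => simp [Matrix.mul_apply]
      | h₂ i =>
        induction j using col_cases with
        | h₁ j => simp [Matrix.mul_apply]
        | h₂ j => exact absurd hij (not_leftRegion_bot_right _ _))
  refine ⟨_, _, _, _, _, e, ?_, ?_, ?_⟩
  · rw [pivotL_append, pivotL_append, pivotL_truncate, pivotL_colLeft, pivotL_colRight,
      pivotL_colLeft]
    congr 1
    ext i j
    induction i using row_cases <;> induction j using col_cases <;> simp [pivotL]
  · rw [pivotE_append, pivotE_append, pivotE_top_left, pivotE_top_right, pivotE_bot_left]
    ext i j
    induction i using row_cases <;> induction j using col_cases <;> simp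
  · rw [pivotU_append, pivotU_append, pivotU_truncate, pivotU_rowTop, pivotU_rowTop,
      pivotU_rowBot]
    ext i j
    induction i using row_cases <;> induction j using col_cases <;>
      simp [leftPart_apply, pivotU]

end Step

end QuasiSep

namespace QuasiSep

/-! ### The quasiseparable order does not grow in the recursion. -/

section QuasiOrder

variable {K : Type*} [Field K] {n r : ℕ}

theorem rank_le_of_col_mem_span {ι κ κ' : Type*} [Finite ι] [Fintype κ] [Fintype κ']
    {A : Matrix ι κ K} {B : Matrix ι κ' K}
    (h : ∀ j, B.col j ∈ Submodule.span K (Set.range A.col)) : B.rank ≤ A.rank := by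
  rw [Matrix.rank_eq_finrank_span_cols, Matrix.rank_eq_finrank_span_cols]
  refine Submodule.finrank_mono (Submodule.span_le.2 ?_)
  rintro _ ⟨j, rfl⟩
  exact h j

theorem rank_leading_le_quasiOrder (W : Matrix (Fin n) (Fin n) K) {k : ℕ} (hk : 1 ≤ k)
    (hk' : k ≤ n - 1) : (leading W k (n - k)).rank ≤ quasiOrder W :=
  Finset.le_sup (f := fun k => (leading W k (n - k)).rank) (Finset.mem_Icc.2 ⟨hk, hk'⟩)

/-- The leading `k × (n - k)` blocks lie inside the left triangle. -/
theorem quasiOrder_leftPart (W : Matrix (Fin n) (Fin n) K) :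
    quasiOrder (leftPart 0 W) = quasiOrder W := by
  refine Finset.sup_congr rfl fun k hk => ?_
  congr 1
  ext ⟨i, hi⟩ ⟨j, hj⟩
  simp only [leading, submatrix_apply, leftPart, of_apply]
  rw [if_pos]
  omega

variable (W : Matrix (Fin n) (Fin n) K)

theorem rank_top_left_le_quasiOrder (hn : 2 ≤ n) :
    (W.submatrix (rowTop n) (colLeft n)).rank ≤ quasiOrder W := by
  refine le_trans ?_ (rank_leading_le_quasiOrder W (k := n - n / 2) (by omega) (by omega))
  exact Matrix.rank_submatrix_le (leading W (n - n / 2) (n - (n - n / 2)))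
    (fun i => ⟨rowTop n i, by simp⟩)
    (fun j => ⟨colLeft n j, by rw [val_colLeft]; have := j.2; omega⟩)

/-- The columns of `l` are combinations of the pivot columns of the top left block. Hence the first
`k` rows of the residual have columns in the span of the columns of the leading `k × (n - k)` block
of `W`: the `n / 2` left columns and the leading columns of the right block together do not exceed
its width. This holds for any `D`. -/
theorem quasiOrder_top_right_le {row : Fin r → Fin (n - n / 2)} {col : Fin r → Fin (n / 2)}
    {l : Matrix (Fin (n - n / 2)) (Fin r) K} {u : Matrix (Fin r) (Fin (n / 2)) K}
    (h : IsElimination (fun _ _ => True) (W.submatrix (rowTop n) (colLeft n)) row col l u)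
    (D : Matrix (Fin r) (Fin (n - n / 2)) K) :
    quasiOrder (W.submatrix (rowTop n) (colRight n) - l * D) ≤ quasiOrder W := by
  refine Finset.sup_le fun k hk => ?_
  rw [Finset.mem_Icc] at hk
  refine le_trans ?_ (rank_leading_le_quasiOrder W (k := k) (by omega) (by omega))
  have hl : l = (W.submatrix (rowTop n) (colLeft n)).submatrix id col *
      (u.submatrix id col)⁻¹ := by
    rw [show (W.submatrix (rowTop n) (colLeft n)).submatrix id col = l * u.submatrix id col by
      rw [h.eq_mul]; rfl, Matrix.mul_assoc, Matrix.mul_nonsing_inv _ h.invUpper.isUnit_det,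
      Matrix.mul_one]
  set Z := (u.submatrix id col)⁻¹ * D with hZ
  have hlD : l * D = (W.submatrix (rowTop n) (colLeft n)).submatrix id col * Z := by
    rw [hZ, ← Matrix.mul_assoc, ← hl]
  let f : {i : Fin (n - n / 2) // (i : ℕ) < k} → {i : Fin n // (i : ℕ) < k} :=
    fun i => ⟨rowTop n i.1, by simpa using i.2⟩
  refine le_trans (rank_le_of_col_mem_span fun j => ?_)
    (Matrix.rank_submatrix_le (leading W k (n - k)) f id)
  have hcol : (leading (W.submatrix (rowTop n) (colRight n) - l * D) k (n - n / 2 - k)).col j =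
      ((leading W k (n - k)).submatrix f id).col
        ⟨colRight n j.1, by rw [val_colRight]; have := j.2; omega⟩ -
      ∑ t, Z t j.1 • ((leading W k (n - k)).submatrix f id).col
        ⟨colLeft n (col t), by rw [val_colLeft]; have := (col t).2; omega⟩ := by
    ext i
    simp only [hlD, leading, Matrix.col_apply, submatrix_apply, Matrix.sub_apply, Pi.sub_apply,
      Matrix.mul_apply, Finset.sum_apply, Pi.smul_apply, smul_eq_mul, id]
    congr 1
    exact Finset.sum_congr rfl fun t _ => mul_comm _ _
  rw [hcol]
  refine Submodule.sub_mem _ (Submodule.subset_span ⟨_, rfl⟩) (Submodule.sum_mem _ fun t _ => ?_)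
  exact Submodule.smul_mem _ _ (Submodule.subset_span ⟨_, rfl⟩)

/-- The same argument on rows: those of `u` are combinations of the pivot rows. The leading block of
`W` now has `n - n / 2 + k` rows, to include the whole top half, and its width is exactly that of
the block of the residual. -/
theorem quasiOrder_bot_left_le {row : Fin r → Fin (n - n / 2)} {col : Fin r → Fin (n / 2)}
    {l : Matrix (Fin (n - n / 2)) (Fin r) K} {u : Matrix (Fin r) (Fin (n / 2)) K}
    (h : IsElimination (fun _ _ => True) (W.submatrix (rowTop n) (colLeft n)) row col l u)
    (E : Matrix (Fin (n / 2)) (Fin r) K) :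
    quasiOrder (W.submatrix (rowBot n) (colLeft n) - E * u) ≤ quasiOrder W := by
  refine Finset.sup_le fun k hk => ?_
  rw [Finset.mem_Icc] at hk
  refine le_trans ?_ (rank_leading_le_quasiOrder W (k := n - n / 2 + k) (by omega) (by omega))
  have hu : u = (l.submatrix row id)⁻¹ *
      (W.submatrix (rowTop n) (colLeft n)).submatrix row id := by
    rw [show (W.submatrix (rowTop n) (colLeft n)).submatrix row id = l.submatrix row id * u by
      rw [h.eq_mul]; rfl, ← Matrix.mul_assoc, Matrix.nonsing_inv_mul _ h.unitLower.isUnit_det,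
      Matrix.one_mul]
  set Z := E * (l.submatrix row id)⁻¹ with hZ
  have hEu : E * u = Z * (W.submatrix (rowTop n) (colLeft n)).submatrix row id := by
    rw [hZ, Matrix.mul_assoc, ← hu]
  let f : {i : Fin (n / 2) // (i : ℕ) < n / 2 - k} → {i : Fin n // (i : ℕ) < n - (n - n / 2 + k)} :=
    fun i => ⟨colLeft n i.1, by rw [val_colLeft]; have := i.2; omega⟩
  refine le_trans ?_ (Matrix.rank_submatrix_le (leading W (n - n / 2 + k) (n - (n - n / 2 + k)))
    id f)
  rw [← Matrix.rank_transpose, ← Matrix.rank_transpose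
    ((leading W (n - n / 2 + k) (n - (n - n / 2 + k))).submatrix id f)]
  refine rank_le_of_col_mem_span fun j => ?_
  have hcol : (leading (W.submatrix (rowBot n) (colLeft n) - E * u) k (n / 2 - k))ᵀ.col j =
      ((leading W (n - n / 2 + k) (n - (n - n / 2 + k))).submatrix id f)ᵀ.col
        ⟨rowBot n j.1, by rw [val_rowBot]; have := j.2; omega⟩ -
      ∑ t, Z j.1 t • ((leading W (n - n / 2 + k) (n - (n - n / 2 + k))).submatrix id f)ᵀ.col
        ⟨rowTop n (row t), by rw [val_rowTop]; have := (row t).2; omega⟩ := by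
    ext i
    simp only [hEu, leading, Matrix.col_apply, transpose_apply, submatrix_apply, Matrix.sub_apply,
      Pi.sub_apply, Matrix.mul_apply, Finset.sum_apply, Pi.smul_apply, smul_eq_mul, id]
    rfl
  rw [hcol]
  refine Submodule.sub_mem _ (Submodule.subset_span ⟨_, rfl⟩) (Submodule.sum_mem _ fun t _ => ?_)
  exact Submodule.smul_mem _ _ (Submodule.subset_span ⟨_, rfl⟩)

end QuasiOrder

/-! ### The cost recurrence of the algorithm. -/

section CostBounds

variable {K : Type u} [Field K] {S : Subroutines K} {ω c : ℝ}

theorem Subroutines.CostIn.mono {c' : ℝ} (h : S.CostIn ω c) (hc : c ≤ c') : S.CostIn ω c' where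
  pluq m n σ A W hA := (h.pluq m n σ A W hA).trans (by gcongr)
  trsmLower r n σ L B VL VB h₁ h₂ h₃ := (h.trsmLower r n σ L B VL VB h₁ h₂ h₃).trans (by gcongr)
  trsmUpper m r σ C U VC VU h₁ h₂ h₃ := (h.trsmUpper m r σ C U VC VU h₁ h₂ h₃).trans (by gcongr)
  mm m k n σ B M D VB VM VD h₁ h₂ h₃ := (h.mm m k n σ B M D VB VM VD h₁ h₂ h₃).trans (by gcongr)

theorem natCast_rpow_sub_one {r : ℕ} (hω : 2 < ω) :
    (r : ℝ) ^ (ω - 1) = r * (r : ℝ) ^ (ω - 2) := by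
  rw [show ω - 1 = ω - 2 + 1 by ring, Real.rpow_add_one' (Nat.cast_nonneg r) (by linarith),
    mul_comm]

/-- The cost of one level of the recursion. -/
theorem level_cost_le (hω : 2 < ω) (hc : 0 ≤ c) {n r s : ℕ} (h₁ : r ≤ n - n / 2) (h₂ : r ≤ n / 2)
    (hs : max r 1 ≤ s) {c₁ c₂ c₃ c₄ c₅ c₆ c₇ : ℝ}
    (hc₁ : c₁ ≤ c * (n - n / 2 : ℕ) * (n / 2 : ℕ) * ((max r 1 : ℕ) : ℝ) ^ (ω - 2))
    (hc₂ : c₂ ≤ c * (r : ℝ) ^ (ω - 1) * (r + (n - n / 2 : ℕ)))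
    (hc₃ : c₃ ≤ c * (r : ℝ) ^ (ω - 1) * ((n / 2 : ℕ) + r))
    (hc₄ : c₄ ≤ c * ((n - n / 2 - r : ℕ) + r) * ((n - n / 2 : ℕ) + r) *
      ((max r 1 : ℕ) : ℝ) ^ (ω - 2))
    (hc₅ : c₅ ≤ c * ((n / 2 : ℕ) + r) * ((n / 2 - r : ℕ) + r) * ((max r 1 : ℕ) : ℝ) ^ (ω - 2))
    (hc₆ : c₆ ≤ (n : ℝ) * n) (hc₇ : c₇ ≤ (n : ℝ) * n) :
    c₁ + c₂ + c₃ + c₄ + c₅ + c₆ + c₇ ≤ (5 * c + 2) * (s : ℝ) ^ (ω - 2) * (n : ℝ) ^ 2 := by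
  have hsum : ((n - n / 2 : ℕ) : ℝ) + (n / 2 : ℕ) = n := by
    rw [← Nat.cast_add]
    congr 1
    omega
  have ha : ((n - n / 2 - r : ℕ) : ℝ) + r = (n - n / 2 : ℕ) := by
    rw [← Nat.cast_add]
    congr 1
    omega
  have hb : ((n / 2 - r : ℕ) : ℝ) + r = (n / 2 : ℕ) := by
    rw [← Nat.cast_add]
    congr 1
    omega
  rw [ha] at hc₄
  rw [hb] at hc₅
  have hr1 : (r : ℝ) ≤ (n - n / 2 : ℕ) := by exact_mod_cast h₁
  have hr2 : (r : ℝ) ≤ (n / 2 : ℕ) := by exact_mod_cast h₂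
  generalize ((n - n / 2 : ℕ) : ℝ) = a at *
  generalize ((n / 2 : ℕ) : ℝ) = b at *
  have hr0 : (0 : ℝ) ≤ r := Nat.cast_nonneg r
  rw [natCast_rpow_sub_one hω] at hc₂ hc₃
  have hα : 0 ≤ ω - 2 := by linarith
  have hx : ((max r 1 : ℕ) : ℝ) ^ (ω - 2) ≤ (s : ℝ) ^ (ω - 2) :=
    Real.rpow_le_rpow (Nat.cast_nonneg _) (by exact_mod_cast hs) hα
  have hy : (r : ℝ) ^ (ω - 2) ≤ (s : ℝ) ^ (ω - 2) :=
    Real.rpow_le_rpow (Nat.cast_nonneg _) (by exact_mod_cast (le_max_left r 1).trans hs) hα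
  have hz : 1 ≤ (s : ℝ) ^ (ω - 2) :=
    Real.one_le_rpow (by exact_mod_cast (le_max_right r 1).trans hs) hα
  have hy0 : 0 ≤ (r : ℝ) ^ (ω - 2) := Real.rpow_nonneg hr0 _
  have hx0 : 0 ≤ ((max r 1 : ℕ) : ℝ) ^ (ω - 2) := Real.rpow_nonneg (Nat.cast_nonneg _) _
  generalize ((max r 1 : ℕ) : ℝ) ^ (ω - 2) = x at *
  generalize (r : ℝ) ^ (ω - 2) = y at *
  generalize (s : ℝ) ^ (ω - 2) = z at *
  have hb0 : 0 ≤ b := hr0.trans hr2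
  have ha0 : 0 ≤ a := hr0.trans hr1
  have hn0 : (0 : ℝ) ≤ n := Nat.cast_nonneg n
  have han : a ≤ n := by linarith
  have hbn : b ≤ n := by linarith
  -- Each of the five subroutine calls has the shape `c * p * q * w` with both sizes at most `n`;
  -- the two additions supply the `2` in `5 * c + 2`.
  have key : ∀ p q w : ℝ, 0 ≤ p → p ≤ n → 0 ≤ q → q ≤ n → 0 ≤ w → w ≤ z →
      c * p * q * w ≤ c * n * n * z := by
    intro p q w hp hpn hq hqn hw hwz
    gcongr
  have k₁ := key a b x ha0 han hb0 hbn hx0 hx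
  have k₂ := key r (r + a) y hr0 (by linarith) (by linarith) (by linarith) hy0 hy
  have k₃ := key r (b + r) y hr0 (by linarith) (by linarith) (by linarith) hy0 hy
  have k₄ := key a (a + r) x ha0 han (by linarith) (by linarith) hx0 hx
  have k₅ := key (b + r) b x (by linarith) (by linarith) hb0 hbn hx0 hx
  have k₆ : (n : ℝ) * n ≤ z * (n * n) := le_mul_of_one_le_left (by positivity) hz
  nlinarith

/-- Solution of the cost recurrence. -/
theorem recurrence_le {d : ℝ} (hd : 0 ≤ d) {n : ℕ} (hn : 2 ≤ n) :
    d * (n : ℝ) ^ 2 + (8 / 3 * d * ((n - n / 2 : ℕ) : ℝ) ^ 2 + 8 / 3 * d * ((n / 2 : ℕ) : ℝ) ^ 2) ≤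
      8 / 3 * d * (n : ℝ) ^ 2 := by
  -- The halves weigh at most `5/8` of the whole, and `8/3` solves `1 + 5/8 * x = x`.
  have h : 8 * ((n - n / 2) ^ 2 + (n / 2) ^ 2) ≤ 5 * n ^ 2 := by
    rcases Nat.even_or_odd' n with ⟨k, rfl | rfl⟩
    · rw [show 2 * k - 2 * k / 2 = k by omega, show 2 * k / 2 = k by omega]
      nlinarith
    · rw [show 2 * k + 1 - (2 * k + 1) / 2 = k + 1 by omega, show (2 * k + 1) / 2 = k by omega]
      have : 1 ≤ k := by omega
      nlinarith
  have h' : 8 * (((n - n / 2 : ℕ) : ℝ) ^ 2 + ((n / 2 : ℕ) : ℝ) ^ 2) ≤ 5 * (n : ℝ) ^ 2 := by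
    exact_mod_cast h
  nlinarith [mul_le_mul_of_nonneg_left h' hd]

end CostBounds

end QuasiSep

namespace QuasiSep

/-! ### The algorithm: correctness and cost in one induction. -/

section Correctness

variable {K : Type u} [Field K]

theorem assemble_submatrix {n : ℕ} (W : Matrix (Fin n) (Fin n) K) :
    assemble n (W.submatrix (rowTop n) (colLeft n)) (W.submatrix (rowTop n) (colRight n))
      (W.submatrix (rowBot n) (colLeft n)) (W.submatrix (rowBot n) (colRight n)) = W := by
  ext i j
  induction i using row_cases <;> induction j using col_cases <;> simp

theorem pivotL_fromCols {m n : ℕ} {ι : Type*} [LinearOrder ι] (d : PLUQ m n K)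
    (E : Matrix ι (Fin d.r) K) :
    (fromCols E (0 : Matrix ι (Fin (n - d.r)) K)).submatrix id d.q =
      pivotL (fun k => d.q.symm (Sum.inl k)) E := by
  ext i j
  obtain ⟨y, rfl⟩ := d.q.symm.surjective j
  rcases y with b | b <;> simp [pivotL]

theorem pivotU_fromRows {m n : ℕ} {κ : Type*} [LinearOrder κ] (d : PLUQ m n K)
    (D : Matrix (Fin d.r) κ K) :
    (fromRows D (0 : Matrix (Fin (m - d.r)) κ K)).submatrix d.p id =
      pivotU (fun k => d.p.symm (Sum.inl k)) D := by
  ext i j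
  obtain ⟨y, rfl⟩ := d.p.symm.surjective i
  rcases y with b | b <;> simp [pivotU]

/-- `P [0; F]` is the residual `A₂ - P [L; M] D`. -/
theorem fromRows_residual {m n k : ℕ} (d : PLUQ m n K) (A₂ : Matrix (Fin m) (Fin k) K)
    (hL : UnitLower d.L) :
    (fromRows (0 : Matrix (Fin d.r) (Fin k) K)
      ((A₂.submatrix d.p.symm id).toRows₂ -
        d.M * (d.L⁻¹ * (A₂.submatrix d.p.symm id).toRows₁))).submatrix d.p id =
      A₂ - (fromRows d.L d.M).submatrix d.p id * (d.L⁻¹ * (A₂.submatrix d.p.symm id).toRows₁) := by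
  set D := d.L⁻¹ * (A₂.submatrix d.p.symm id).toRows₁ with hD
  have hLD : d.L * D = (A₂.submatrix d.p.symm id).toRows₁ := by
    rw [hD, ← Matrix.mul_assoc, Matrix.mul_nonsing_inv _ hL.isUnit_det, Matrix.one_mul]
  ext i j
  obtain ⟨x, rfl⟩ := d.p.symm.surjective i
  rcases x with a | a
  · have := congrFun (congrFun hLD a) j
    simp only [Matrix.mul_apply, toRows₁_apply, submatrix_apply, id] at this
    simp [Matrix.mul_apply, this]
  · simp [Matrix.mul_apply]

/-- `[0 G] Q` is the residual `A₃ - E [U V] Q`. -/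
theorem fromCols_residual {m n k : ℕ} (d : PLUQ m n K) (A₃ : Matrix (Fin k) (Fin n) K)
    (hU : InvUpper d.U) :
    (fromCols (0 : Matrix (Fin k) (Fin d.r) K)
      ((A₃.submatrix id d.q.symm).toCols₂ -
        ((A₃.submatrix id d.q.symm).toCols₁ * d.U⁻¹) * d.V)).submatrix id d.q =
      A₃ - ((A₃.submatrix id d.q.symm).toCols₁ * d.U⁻¹) *
        (fromCols d.U d.V).submatrix id d.q := by
  set E := (A₃.submatrix id d.q.symm).toCols₁ * d.U⁻¹ with hE
  have hEU : E * d.U = (A₃.submatrix id d.q.symm).toCols₁ := by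
    rw [hE, Matrix.mul_assoc, Matrix.nonsing_inv_mul _ hU.isUnit_det, Matrix.mul_one]
  ext i j
  obtain ⟨x, rfl⟩ := d.q.symm.surjective j
  rcases x with a | a
  · have := congrFun (congrFun hEU i) a
    simp only [Matrix.mul_apply, toCols₁_apply, submatrix_apply, id] at this
    simp [Matrix.mul_apply, this]
  · simp [Matrix.mul_apply]

/-- The algorithm computes an elimination of the left triangular part, within the stated cost. -/
theorem spec_ltBruhat {S : Subroutines K} (hS : S.Correct) {ω : ℝ} (hω : 2 < ω) (n : ℕ)
    (σ : List K) (A : Matrix (Fin n) (Fin n) ℕ) (W : Matrix (Fin n) (Fin n) K) (hA : Rep σ A W) :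
    (ltBruhat S n A).Spec σ fun T τ cost =>
      (∃ (r : ℕ) (row : Fin r → Fin n) (col : Fin r → Fin n) (l : Matrix (Fin n) (Fin r) K)
        (u : Matrix (Fin r) (Fin n) K), IsElimination (LeftRegion n) W row col l u ∧
        Rep τ T.L (pivotL col l) ∧ Rep τ T.E (pivotE K row col) ∧ Rep τ T.U (pivotU row u)) ∧
      ∀ c : ℝ, 0 ≤ c → S.CostIn ω c → ∀ s : ℕ, max (quasiOrder W) 1 ≤ s →
        (cost : ℝ) ≤ 8 / 3 * ((5 * c + 2) * (s : ℝ) ^ (ω - 2)) * (n : ℝ) ^ 2 := by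
  induction n using Nat.strong_induction_on generalizing σ with
  | _ n ih =>
  rw [ltBruhat]
  split_ifs with hn
  · refine (Prog.spec_const 0 σ).bind ?_
    rintro z τ cost _ ⟨hz, rfl⟩
    -- For `n ≤ 1` the left triangle has no cell, so the empty elimination matches the zero output
    -- whatever `W` is.
    have hreg : ∀ i j, ¬ LeftRegion n i j := fun i j h => by
      unfold LeftRegion at h
      omega
    refine Prog.Spec.pure ⟨⟨0, Fin.elim0, Fin.elim0, 0, 0,
      ⟨fun _ k => k.elim0, fun k => k.elim0, fun k => k.elim0, fun _ k => k.elim0,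
        fun k => k.elim0, fun k => k.elim0, fun k => k.elim0, fun k => k.elim0,
        fun i j h => absurd h (hreg i j)⟩, ?_, ?_, ?_⟩, fun c hc _ s _ => ?_⟩
    · exact fun i j => by rw [show pivotL _ _ i j = (0 : K) by simp [pivotL]]; exact hz
    · exact fun i j => by rw [show pivotE _ _ _ i j = (0 : K) by simp [pivotE]]; exact hz
    · exact fun i j => by rw [show pivotU _ _ i j = (0 : K) by simp [pivotU]]; exact hz
    · simp only [add_zero, Nat.cast_zero]
      positivity
  have hn2 : 2 ≤ n := by omega
  refine (Prog.spec_const 0 σ).bind ?_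
  rintro z σ₁ _ h₁ ⟨hz, rfl⟩
  refine (Prog.spec_const 1 σ₁).bind ?_
  rintro o σ₂ _ h₂ ⟨ho, rfl⟩
  replace hz := hz.mono h₂
  replace hA := hA.mono (h₁.trans h₂)
  have hA' := hA.submatrix (rowSplit n).symm (colSplit n).symm
  dsimp only
  generalize A.submatrix (rowSplit n).symm (colSplit n).symm = A' at hA' ⊢
  have hA₁ : Rep σ₂ A'.toBlocks₁₁ (W.submatrix (rowTop n) (colLeft n)) := fun i j => hA' _ _
  have hA₂ : Rep σ₂ A'.toBlocks₁₂ (W.submatrix (rowTop n) (colRight n)) := fun i j => hA' _ _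
  have hA₃ : Rep σ₂ A'.toBlocks₂₁ (W.submatrix (rowBot n) (colLeft n)) := fun i j => hA' _ _
  generalize A'.toBlocks₁₁ = A₁ at hA₁ ⊢
  generalize A'.toBlocks₁₂ = A₂ at hA₂ ⊢
  generalize A'.toBlocks₂₁ = A₃ at hA₃ ⊢
  set W₁ := W.submatrix (rowTop n) (colLeft n) with hW₁
  set W₂ := W.submatrix (rowTop n) (colRight n) with hW₂
  set W₃ := W.submatrix (rowBot n) (colLeft n) with hW₃
  have sp : (S.pluq _ _ A₁).Spec σ₂ fun d τ cost =>
      (∃ L M U V, Rep τ d.L L ∧ Rep τ d.M M ∧ Rep τ d.U U ∧ Rep τ d.V V ∧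
        (⟨d.r, d.p, d.q, L, M, U, V⟩ : PLUQ _ _ K).Reveals W₁) ∧
      ∀ c, S.CostIn ω c → (cost : ℝ) ≤ c * (n - n / 2 : ℕ) * (n / 2 : ℕ) *
        ((max W₁.rank 1 : ℕ) : ℝ) ^ (ω - 2) :=
    ⟨hS.pluq _ _ σ₂ A₁ W₁ hA₁, fun c hc => hc.pluq _ _ σ₂ A₁ W₁ hA₁⟩
  refine sp.bind ?_
  rintro d σ₃ c₁ h₃ ⟨⟨L, M, U, V, hL, hM, hU, hV, hd⟩, hc₁⟩
  have el := hd.isElimination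
  set dv : PLUQ _ _ K := ⟨d.r, d.p, d.q, L, M, U, V⟩ with hdv
  have hrank : W₁.rank = d.r := el.rank_eq
  have hB := (hA₂.mono h₃).submatrix d.p.symm id
  have hC := (hA₃.mono h₃).submatrix id d.q.symm
  generalize A₂.submatrix d.p.symm id = B at hB ⊢
  generalize A₃.submatrix id d.q.symm = C at hC ⊢
  have hB₁ : Rep σ₃ B.toRows₁ (W₂.submatrix d.p.symm id).toRows₁ := fun i j => hB _ _
  have hB₂ : Rep σ₃ B.toRows₂ (W₂.submatrix d.p.symm id).toRows₂ := fun i j => hB _ _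
  have hC₁ : Rep σ₃ C.toCols₁ (W₃.submatrix id d.q.symm).toCols₁ := fun i j => hC _ _
  have hC₂ : Rep σ₃ C.toCols₂ (W₃.submatrix id d.q.symm).toCols₂ := fun i j => hC _ _
  have sD : (S.trsmLower _ _ d.L B.toRows₁).Spec σ₃ fun D τ cost =>
      Rep τ D (L⁻¹ * (W₂.submatrix d.p.symm id).toRows₁) ∧
      ∀ c, S.CostIn ω c → (cost : ℝ) ≤ c * (d.r : ℝ) ^ (ω - 1) * (d.r + (n - n / 2 : ℕ)) :=
    ⟨hS.trsmLower _ _ σ₃ _ _ _ _ hd.unitLower hL hB₁,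
      fun c hc => hc.trsmLower _ _ σ₃ _ _ _ _ hd.unitLower hL hB₁⟩
  refine sD.bind ?_
  rintro D σ₄ c₂ h₄ ⟨hD, hc₂⟩
  have sE : (S.trsmUpper _ _ C.toCols₁ d.U).Spec σ₄ fun E τ cost =>
      Rep τ E ((W₃.submatrix id d.q.symm).toCols₁ * U⁻¹) ∧
      ∀ c, S.CostIn ω c → (cost : ℝ) ≤ c * (d.r : ℝ) ^ (ω - 1) * ((n / 2 : ℕ) + d.r) :=
    ⟨hS.trsmUpper _ _ σ₄ _ _ _ _ hd.invUpper (hC₁.mono h₄) (hU.mono h₄),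
      fun c hc => hc.trsmUpper _ _ σ₄ _ _ _ _ hd.invUpper (hC₁.mono h₄) (hU.mono h₄)⟩
  refine sE.bind ?_
  rintro E σ₅ c₃ h₅ ⟨hE, hc₃⟩
  set Dv := L⁻¹ * (W₂.submatrix d.p.symm id).toRows₁ with hDv
  set Ev := (W₃.submatrix id d.q.symm).toCols₁ * U⁻¹ with hEv
  have h35 := h₄.trans h₅
  have sF : (S.mm _ _ _ B.toRows₂ d.M D).Spec σ₅ fun F τ cost =>
      Rep τ F ((W₂.submatrix d.p.symm id).toRows₂ - M * Dv) ∧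
      ∀ c, S.CostIn ω c → (cost : ℝ) ≤ c * ((n - n / 2 - d.r : ℕ) + d.r) *
        ((n - n / 2 : ℕ) + d.r) * ((max d.r 1 : ℕ) : ℝ) ^ (ω - 2) :=
    ⟨hS.mm _ _ _ σ₅ _ _ _ _ _ _ (hB₂.mono h35) (hM.mono h35) (hD.mono h₅),
      fun c hc => hc.mm _ _ _ σ₅ _ _ _ _ _ _ (hB₂.mono h35) (hM.mono h35) (hD.mono h₅)⟩
  refine sF.bind ?_
  rintro F σ₆ c₄ h₆ ⟨hF, hc₄⟩
  have h36 := h35.trans h₆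
  have sG : (S.mm _ _ _ C.toCols₂ E d.V).Spec σ₆ fun G τ cost =>
      Rep τ G ((W₃.submatrix id d.q.symm).toCols₂ - Ev * V) ∧
      ∀ c, S.CostIn ω c → (cost : ℝ) ≤ c * ((n / 2 : ℕ) + d.r) *
        ((n / 2 - d.r : ℕ) + d.r) * ((max d.r 1 : ℕ) : ℝ) ^ (ω - 2) :=
    ⟨hS.mm _ _ _ σ₆ _ _ _ _ _ _ (hC₂.mono h36) (hE.mono h₆) (hV.mono h36),
      fun c hc => hc.mm _ _ _ σ₆ _ _ _ _ _ _ (hC₂.mono h36) (hE.mono h₆) (hV.mono h36)⟩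
  refine sG.bind ?_
  rintro G σ₇ c₅ h₇ ⟨hG, hc₅⟩
  have h37 := h36.trans h₇
  have hz₇ : Holds σ₇ z 0 := hz.mono (h₃.trans h37)
  have ho₇ : Holds σ₇ o 1 := ho.mono (h₃.trans h37)
  have hH : Rep σ₇ ((fromRows (constMatrix z) F).submatrix d.p id)
      (W₂ - (fromRows L M).submatrix d.p id * Dv) := by
    rw [← fromRows_residual dv W₂ hd.unitLower]
    exact ((rep_zero hz₇).fromRows (hF.mono h₇)).submatrix _ _
  have hI : Rep σ₇ ((fromCols (constMatrix z) G).submatrix id d.q)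
      (W₃ - Ev * (fromCols U V).submatrix id d.q) := by
    rw [← fromCols_residual dv W₃ hd.invUpper]
    exact ((rep_zero hz₇).fromCols hG).submatrix _ _
  refine (ih (n - n / 2) (by omega) σ₇ _ _ hH).bind ?_
  rintro T₂ σ₈ c₆ h₈ ⟨⟨r₂, row₂, col₂, l₂, u₂, el₂, hL₂, hE₂, hU₂⟩, hc₆⟩
  refine (ih (n / 2) (by omega) σ₈ _ _ (hI.mono h₈)).bind ?_
  rintro T₃ σ₉ c₇ h₉ ⟨⟨r₃, row₃, col₃, l₃, u₃, el₃, hL₃, hE₃, hU₃⟩, hc₇⟩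
  -- Written as `P [0; F]`, the residual visibly vanishes on the pivot rows, as appending requires.
  have hrow0 : ∀ t j, (W₂ - (fromRows L M).submatrix d.p id * Dv) (d.p.symm (Sum.inl t)) j = 0 := by
    intro t j
    rw [← fromRows_residual dv W₂ hd.unitLower, submatrix_apply,
      show dv.p (d.p.symm (Sum.inl t)) = Sum.inl t from d.p.apply_symm_apply _]
    rfl
  have hcol0 : ∀ t i, (W₃ - Ev * (fromCols U V).submatrix id d.q) i (d.q.symm (Sum.inl t)) = 0 := by
    intro t i
    rw [← fromCols_residual dv W₃ hd.invUpper, submatrix_apply,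
      show dv.q (d.q.symm (Sum.inl t)) = Sum.inl t from d.q.apply_symm_apply _]
    rfl
  obtain ⟨r', row', col', l', u', el', eL, eE, eU⟩ :=
    isElimination_step (A₄ := W.submatrix (rowBot n) (colRight n)) el hrow0 hcol0 el₂ el₃
  rw [assemble_submatrix] at el'
  have h39 := h37.trans (h₈.trans h₉)
  have h79 := h₈.trans h₉
  have hz₉ := hz₇.mono h79
  have repL := ((hL.mono h39).fromBlocks (rep_zero hz₉) (hM.mono h39)
    (rep_zero (ι := Fin (n - n / 2 - d.r)) (κ := Fin (n / 2 - d.r)) hz₉)).submatrix d.p d.q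
  have repU := ((hU.mono h39).fromBlocks (hV.mono h39) (rep_zero hz₉)
    (rep_zero (ι := Fin (n - n / 2 - d.r)) (κ := Fin (n / 2 - d.r)) hz₉)).submatrix d.p d.q
  have repE := ((hE.mono (h₆.trans (h₇.trans h79))).fromCols
    (rep_zero (κ := Fin (n / 2 - d.r)) hz₉)).submatrix id d.q
  have repD := ((hD.mono (h₅.trans (h₆.trans (h₇.trans h79)))).fromRows
    (rep_zero (ι := Fin (n - n / 2 - d.r)) hz₉)).submatrix d.p id
  refine (spec_addMatrix
    ((repL.assemble (rep_zero hz₉) repE (rep_zero hz₉)).leftPart hz₉)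
    ((rep_zero hz₉).assemble (hL₂.mono h₉) hL₃ (rep_zero hz₉))).bind ?_
  rintro calL σ₁₀ c₈ h₁₀ ⟨hcalL, hc₈⟩
  refine (spec_addMatrix
    ((repU.assemble (repD.leftPart hz₉) (rep_zero hz₉) (rep_zero hz₉)).mono h₁₀)
    (((rep_zero hz₉).assemble (hU₂.mono h₉) hU₃ (rep_zero hz₉)).mono h₁₀)).bind ?_
  rintro calU σ₁₁ c₉ h₁₁ ⟨hcalU, hc₉⟩
  refine Prog.Spec.pure ⟨⟨r', row', col', l', u', el', ?_, ?_, ?_⟩, ?_⟩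
  · rw [eL, ← fromBlocks_L_eq_pivotL dv, ← pivotL_fromCols dv]
    exact hcalL.mono h₁₁
  · rw [eE, ← pivots_eq_pivotE dv]
    have h911 := h₁₀.trans h₁₁
    exact (rep_pivots (hz₉.mono h911) ((ho₇.mono h79).mono h911) d).assemble
      ((hE₂.mono h₉).mono h911) (hE₃.mono h911) (rep_zero (hz₉.mono h911))
  · rw [eU, ← fromBlocks_U_eq_pivotU dv, ← pivotU_fromRows dv]
    exact hcalU
  · intro c hc hSc s hs
    have hq₂ := quasiOrder_top_right_le W el Dv
    have hq₃ := quasiOrder_bot_left_le W el Ev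
    -- The induction bounds the cost for every `s` above the order, so one `s` serves both recursive
    -- calls even if their orders drop.
    have k₆ := hc₆ c hc hSc s (le_trans (by gcongr) hs)
    have k₇ := hc₇ c hc hSc s (le_trans (by gcongr) hs)
    have hr := rank_top_left_le_quasiOrder W hn2
    rw [← hW₁, hrank] at hr
    have k₁ := hc₁ c hSc
    rw [hrank] at k₁
    have hlev := level_cost_le hω hc (le_of_fin_injective el.row_injective)
      (le_of_fin_injective el.col_injective) (le_trans (by gcongr) hs) k₁ (hc₂ c hSc)
      (hc₃ c hSc) (hc₄ c hSc) (hc₅ c hSc) hc₈ hc₉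
    have hrec := recurrence_le (d := (5 * c + 2) * (s : ℝ) ^ (ω - 2)) (by positivity) hn2
    push_cast
    linarith

end Correctness

end QuasiSep

namespace QuasiSep

/-! ### Halving inequalities for powers. -/

section Inequalities

variable {α : ℝ}

/-- The ratio `2/3` is attained by the larger half at `n = 3`. -/
theorem half_le_two_thirds {n : ℕ} (hn : 2 ≤ n) :
    ((n / 2 : ℕ) : ℝ) ≤ 2 / 3 * n ∧ ((n - n / 2 : ℕ) : ℝ) ≤ 2 / 3 * n := by
  have h1 : 3 * (n / 2) ≤ 2 * n := by omega
  have h2 : 3 * (n - n / 2) ≤ 2 * n := by omega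
  have h1' : 3 * ((n / 2 : ℕ) : ℝ) ≤ 2 * n := by exact_mod_cast h1
  have h2' : 3 * ((n - n / 2 : ℕ) : ℝ) ≤ 2 * n := by exact_mod_cast h2
  constructor <;> linarith

/-- The ratio of the sum of the costs of the two halves of a problem to the cost of the problem. -/
noncomputable def halvingRatio (α : ℝ) : ℝ := (2 / 3 : ℝ) ^ min α 1

theorem halvingRatio_lt_one (hα : 0 < α) : halvingRatio α < 1 :=
  Real.rpow_lt_one (by norm_num) (by norm_num) (lt_min hα one_pos)

theorem halvingRatio_nonneg : 0 ≤ halvingRatio α := Real.rpow_nonneg (by norm_num) _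

/-- The factors `x` and `y` add up to `z`, and each power loses at least the factor `(2 / 3) ^ α`.
-/
theorem halving_rpow (hα : 0 < α) {x y z : ℝ} (hx : 0 ≤ x) (hy : 0 ≤ y) (hxz : x ≤ 2 / 3 * z)
    (hyz : y ≤ 2 / 3 * z) (hz : x + y = z) :
    x * x ^ α + y * y ^ α ≤ halvingRatio α * (z * z ^ α) := by
  have hz0 : 0 ≤ z := by linarith
  have hle : (2 / 3 : ℝ) ^ α ≤ halvingRatio α :=
    Real.rpow_le_rpow_of_exponent_ge (by norm_num) (by norm_num) (min_le_left _ _)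
  have key : ∀ w : ℝ, 0 ≤ w → w ≤ 2 / 3 * z → w ^ α ≤ halvingRatio α * z ^ α := by
    intro w hw hwz
    calc w ^ α ≤ (2 / 3 * z) ^ α := Real.rpow_le_rpow hw hwz hα.le
      _ = (2 / 3 : ℝ) ^ α * z ^ α := Real.mul_rpow (by norm_num) hz0
      _ ≤ _ := mul_le_mul_of_nonneg_right hle (Real.rpow_nonneg hz0 _)
  have h1 := mul_le_mul_of_nonneg_left (key x hx hxz) hx
  have h2 := mul_le_mul_of_nonneg_left (key y hy hyz) hy
  calc x * x ^ α + y * y ^ α ≤ (x + y) * (halvingRatio α * z ^ α) := by linarith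
    _ = _ := by rw [hz]; ring

/-- Here `x` and `y` play the ranks found in the two halves, possibly `x + y` and `0`; the gain has
to come from the weights `a` and `b`. After dividing by `x + y` and `n`, it is Jensen's inequality
for `t ^ min α 1`, at a mean of at most `2/3`. -/
theorem halving_mul_rpow (hα : 0 < α) {a b n x y : ℝ} (ha : 0 ≤ a) (hb : 0 ≤ b)
    (han : a ≤ 2 / 3 * n) (hbn : b ≤ 2 / 3 * n) (hn : a + b = n) (hx : 0 ≤ x) (hy : 0 ≤ y) :
    a * x ^ α + b * y ^ α ≤ halvingRatio α * (n * (x + y) ^ α) := by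
  rcases (add_nonneg hx hy).eq_or_lt with h0 | h0
  · have hx0 : x = 0 := by linarith
    have hy0 : y = 0 := by linarith
    simp [hx0, hy0, Real.zero_rpow hα.ne']
  have hn0 : 0 ≤ n := by linarith
  rcases hn0.eq_or_lt with hn0 | hn0
  · have ha0 : a = 0 := by linarith
    have hb0 : b = 0 := by linarith
    simp [ha0, hb0, ← hn0]
  set β := min α 1 with hβ
  have hβ0 : 0 < β := lt_min hα one_pos
  set s := x + y with hs
  have hxs : x = s * (x / s) := by field_simp
  have hys : y = s * (y / s) := by field_simp
  have hx1 : x / s ≤ 1 := (div_le_one h0).2 (by linarith)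
  have hy1 : y / s ≤ 1 := (div_le_one h0).2 (by linarith)
  have hx0 : 0 ≤ x / s := by positivity
  have hy0 : 0 ≤ y / s := by positivity
  have hsum : x / s + y / s = 1 := by rw [← add_div]; exact div_self h0.ne'
  -- On `[0, 1]`, lowering the exponent from `α` to `β ≤ 1` increases the power and makes it
  -- concave.
  have key : ∀ w : ℝ, 0 ≤ w → w ≤ 1 → (s * w) ^ α ≤ s ^ α * w ^ β := by
    intro w hw hw1
    rw [Real.mul_rpow h0.le hw]
    refine mul_le_mul_of_nonneg_left ?_ (Real.rpow_nonneg h0.le _)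
    rcases hw.eq_or_lt with rfl | hw
    · rw [Real.zero_rpow hα.ne', Real.zero_rpow hβ0.ne']
    · exact Real.rpow_le_rpow_of_exponent_ge hw hw1 (min_le_left _ _)
  have hconc := (Real.concaveOn_rpow hβ0.le (min_le_right α 1)).2
    (Set.mem_Ici.2 hx0) (Set.mem_Ici.2 hy0) (show 0 ≤ a / n by positivity)
    (show 0 ≤ b / n by positivity) (by rw [← add_div, hn]; exact div_self hn0.ne')
  simp only [smul_eq_mul] at hconc
  have hmean : a / n * (x / s) + b / n * (y / s) ≤ 2 / 3 := by
    have h1 : a / n ≤ 2 / 3 := (div_le_iff₀ hn0).2 han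
    have h2 : b / n ≤ 2 / 3 := (div_le_iff₀ hn0).2 hbn
    calc a / n * (x / s) + b / n * (y / s) ≤ 2 / 3 * (x / s) + 2 / 3 * (y / s) := by gcongr
      _ = 2 / 3 := by rw [← mul_add, hsum, mul_one]
  have hpow : (a / n * (x / s) + b / n * (y / s)) ^ β ≤ halvingRatio α :=
    Real.rpow_le_rpow (by positivity) hmean hβ0.le
  have hfin := hconc.trans hpow
  calc a * x ^ α + b * y ^ α = a * (s * (x / s)) ^ α + b * (s * (y / s)) ^ α := by
        rw [← hxs, ← hys]
    _ ≤ a * (s ^ α * (x / s) ^ β) + b * (s ^ α * (y / s) ^ β) := by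
        gcongr
        · exact key _ hx0 hx1
        · exact key _ hy0 hy1
    _ = n * s ^ α * (a / n * (x / s) ^ β + b / n * (y / s) ^ β) := by field_simp
    _ ≤ n * s ^ α * halvingRatio α := by gcongr
    _ = _ := by ring

end Inequalities

/-! ### Rectangular products by square tiles. -/

section Product

variable {K : Type u} [Field K]

/-- `B - M D`, computed by square tiles of order the inner dimension. -/
noncomputable def tiledMul
    (mul : (k : ℕ) → Matrix (Fin k) (Fin k) ℕ → Matrix (Fin k) (Fin k) ℕ →
      Prog K (Matrix (Fin k) (Fin k) ℕ))
    (m k n : ℕ) (B : Matrix (Fin m) (Fin n) ℕ) (M : Matrix (Fin m) (Fin k) ℕ)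
    (D : Matrix (Fin k) (Fin n) ℕ) : Prog K (Matrix (Fin m) (Fin n) ℕ) :=
  if hk : k = 0 then pure B
  else do
    let z ← Prog.const 0 Prog.ret
    let P ← Prog.forFin (m / k + 1) fun i => Prog.forFin (n / k + 1) fun j => mul k
      (Matrix.of fun x y => if h : i * k + x < m then M ⟨i * k + x, h⟩ y else z)
      (Matrix.of fun x y => if h : j * k + y < n then D x ⟨j * k + y, h⟩ else z)
    let C ← Prog.forFin m fun i => Prog.forFin n fun j => Prog.arith .sub (B i j)
      (P ⟨i / k, Nat.lt_succ_of_le (Nat.div_le_div_right i.2.le)⟩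
        ⟨j / k, Nat.lt_succ_of_le (Nat.div_le_div_right j.2.le)⟩
        ⟨i % k, Nat.mod_lt _ (Nat.pos_of_ne_zero hk)⟩
        ⟨j % k, Nat.mod_lt _ (Nat.pos_of_ne_zero hk)⟩) Prog.ret
    return Matrix.of C

/-- Tiles as large as the inner dimension need no sum over tiles: `m / k + 1` times `n / k + 1`
products of order `k`, padded by zeros, with `(m / k + 1) * k ≤ m + k`. The `1` in `c + 1` pays for
the entrywise subtraction. -/
theorem spec_tiledMul {mul : (k : ℕ) → Matrix (Fin k) (Fin k) ℕ → Matrix (Fin k) (Fin k) ℕ →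
      Prog K (Matrix (Fin k) (Fin k) ℕ)} {ω c : ℝ} (hω : 2 < ω) (hc : 0 ≤ c)
    (hmul : ∀ k σ A B VA VB, Rep σ A VA → Rep σ B VB →
      (mul k A B).Spec σ fun C τ cost => Rep τ C (VA * VB) ∧ (cost : ℝ) ≤ c * (k : ℝ) ^ ω)
    {m k n : ℕ} {σ : List K} {B : Matrix (Fin m) (Fin n) ℕ} {M : Matrix (Fin m) (Fin k) ℕ}
    {D : Matrix (Fin k) (Fin n) ℕ} {VB : Matrix (Fin m) (Fin n) K} {VM : Matrix (Fin m) (Fin k) K}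
    {VD : Matrix (Fin k) (Fin n) K} (hB : Rep σ B VB) (hM : Rep σ M VM) (hD : Rep σ D VD) :
    (tiledMul mul m k n B M D).Spec σ fun C τ cost => Rep τ C (VB - VM * VD) ∧
      (cost : ℝ) ≤ (c + 1) * (m + k) * (n + k) * (k : ℝ) ^ (ω - 2) := by
  rw [tiledMul]
  split_ifs with hk
  · subst hk
    refine Prog.Spec.pure ⟨?_, ?_⟩
    · rw [show VB - VM * VD = VB by ext i j; simp]
      exact hB
    · rw [Nat.cast_zero, Real.zero_rpow (by linarith), mul_zero]
  have hkpos : 0 < k := Nat.pos_of_ne_zero hk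
  refine (Prog.spec_const 0 σ).bind ?_
  rintro z σ₁ _ h₁ ⟨hz, rfl⟩
  let VT : ℕ → Matrix (Fin k) (Fin k) K := fun i =>
    Matrix.of fun x y => if h : i * k + x < m then VM ⟨i * k + x, h⟩ y else 0
  let VS : ℕ → Matrix (Fin k) (Fin k) K := fun j =>
    Matrix.of fun x y => if h : j * k + y < n then VD x ⟨j * k + y, h⟩ else 0
  have hP := Prog.spec_forFin (σ := σ₁) (n := m / k + 1)
    (f := fun i => Prog.forFin (n / k + 1) fun j => mul k
      (Matrix.of fun x y => if h : i * k + x < m then M ⟨i * k + x, h⟩ y else z)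
      (Matrix.of fun x y => if h : j * k + y < n then D x ⟨j * k + y, h⟩ else z))
    (Q := fun i P τ => ∀ j, Rep τ (P j) (VT i * VS j))
    (b := (n / k + 1 : ℕ) * (c * (k : ℝ) ^ ω)) (fun i P τ τ' h hτ j => (h j).mono hτ)
    (fun i τ hτ => Prog.spec_forFin (Q := fun j P τ => Rep τ P (VT i * VS j))
      (fun j P τ τ' h hτ => h.mono hτ) fun j μ hμ => by
        have h1μ := hτ.trans hμ
        refine hmul k μ _ _ _ _ (fun x y => ?_) (fun x y => ?_)
        · simp only [VT, of_apply]
          split_ifs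
          · exact (hM.mono (h₁.trans h1μ)) _ _
          · exact hz.mono h1μ
        · simp only [VS, of_apply]
          split_ifs
          · exact (hD.mono (h₁.trans h1μ)) _ _
          · exact hz.mono h1μ)
  refine hP.bind ?_
  rintro P σ₂ c₁ h₂ ⟨hP, hc₁⟩
  refine (Prog.spec_forFin_arith (W := VM * VD) .sub (hB.mono (h₁.trans h₂))
    (B := Matrix.of fun i j => P ⟨i / k, Nat.lt_succ_of_le (Nat.div_le_div_right i.2.le)⟩
        ⟨j / k, Nat.lt_succ_of_le (Nat.div_le_div_right j.2.le)⟩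
        ⟨i % k, Nat.mod_lt _ hkpos⟩ ⟨j % k, Nat.mod_lt _ hkpos⟩) (fun i j => ?_)).bind ?_
  · have := hP ⟨i / k, Nat.lt_succ_of_le (Nat.div_le_div_right i.2.le)⟩
      ⟨j / k, Nat.lt_succ_of_le (Nat.div_le_div_right j.2.le)⟩
      ⟨i % k, Nat.mod_lt _ hkpos⟩ ⟨j % k, Nat.mod_lt _ hkpos⟩
    rw [of_apply, this]
    -- Position `i % k` of tile `i / k` is row `i`, never padding, since `i < m`; likewise for
    -- columns.
    simp [VT, VS, Matrix.mul_apply, Nat.div_add_mod']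
  · rintro C σ₃ c₂ _ ⟨hC, hc₂⟩
    refine Prog.Spec.pure ⟨hC, ?_⟩
    push_cast at hc₁ ⊢
    have hk1 : (1 : ℝ) ≤ k := by exact_mod_cast hkpos
    have hm : (((m / k : ℕ) : ℝ) + 1) * k ≤ m + k := by
      have : m / k * k ≤ m := Nat.div_mul_le_self m k
      have : ((m / k : ℕ) : ℝ) * k ≤ m := by exact_mod_cast this
      linarith
    have hn : (((n / k : ℕ) : ℝ) + 1) * k ≤ n + k := by
      have : n / k * k ≤ n := Nat.div_mul_le_self n k
      have : ((n / k : ℕ) : ℝ) * k ≤ n := by exact_mod_cast this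
      linarith
    have hp : (k : ℝ) ^ ω = k * k * (k : ℝ) ^ (ω - 2) := by
      rw [show ω = (ω - 2) + 2 by ring, Real.rpow_add (by linarith), Real.rpow_two,
        show ω - 2 + 2 - 2 = ω - 2 by ring]
      ring
    have hx : 1 ≤ (k : ℝ) ^ (ω - 2) := Real.one_le_rpow hk1 (by linarith)
    rw [hp] at hc₁
    generalize (k : ℝ) ^ (ω - 2) = x at *
    have t₁ : (((m / k : ℕ) : ℝ) + 1) * ((((n / k : ℕ) : ℝ) + 1) * (c * (k * k * x))) ≤
        c * (m + k) * (n + k) * x := by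
      calc _ = c * ((((m / k : ℕ) : ℝ) + 1) * k) * ((((n / k : ℕ) : ℝ) + 1) * k) * x := by ring
        _ ≤ _ := by gcongr
    have t₂ : (m : ℝ) * n ≤ (m + k) * (n + k) * x := by
      calc (m : ℝ) * n ≤ (m + k) * (n + k) := by gcongr <;> linarith
        _ ≤ _ := le_mul_of_one_le_right (by positivity) hx
    linarith

end Product

/-! ### Triangular solves by halving. -/

section Solve

variable {K : Type u} [Field K]

theorem sum_colSplit {n : ℕ} {X : Type*} [AddCommMonoid X] (f : Fin n → X) :
    ∑ i, f i = ∑ a, f (colLeft n a) + ∑ b, f (colRight n b) := by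
  rw [← (colSplit n).symm.sum_comp, Fintype.sum_sum_type]
  rfl

/-- Solution `X` of `L X = B` for an invertible lower triangular matrix `L`, by halving. -/
noncomputable def solveLower
    (mm : (m k n : ℕ) → Matrix (Fin m) (Fin n) ℕ → Matrix (Fin m) (Fin k) ℕ →
      Matrix (Fin k) (Fin n) ℕ → Prog K (Matrix (Fin m) (Fin n) ℕ))
    (r n : ℕ) (L : Matrix (Fin r) (Fin r) ℕ) (B : Matrix (Fin r) (Fin n) ℕ) :
    Prog K (Matrix (Fin r) (Fin n) ℕ) :=
  if _hr : r ≤ 1 then do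
    let C ← Prog.forFin r fun i => Prog.forFin n fun j => Prog.arith .div (B i j) (L i i) Prog.ret
    return Matrix.of C
  else do
    let X₁ ← solveLower mm (r / 2) n (L.submatrix (colLeft r) (colLeft r))
      (B.submatrix (colLeft r) id)
    let Y ← mm _ _ _ (B.submatrix (colRight r) id) (L.submatrix (colRight r) (colLeft r)) X₁
    let X₂ ← solveLower mm (r - r / 2) n (L.submatrix (colRight r) (colRight r)) Y
    return (fromRows X₁ X₂).submatrix (colSplit r) id
termination_by r

/-- Only a nonzero diagonal is assumed, so that the transpose of an invertible upper triangular
matrix qualifies as well. The constant `C` solves `C * θ + (c + 1) = C`, with `θ` the halving ratio: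
the middle product costs `c`, and the extra `1` gives `1 ≤ C` for the base case. -/
theorem spec_solveLower
    {mm : (m k n : ℕ) → Matrix (Fin m) (Fin n) ℕ → Matrix (Fin m) (Fin k) ℕ →
      Matrix (Fin k) (Fin n) ℕ → Prog K (Matrix (Fin m) (Fin n) ℕ)} {ω c : ℝ} (hω : 2 < ω)
    (hc : 0 ≤ c)
    (hmm : ∀ m k n σ B M D VB VM VD, Rep σ B VB → Rep σ M VM → Rep σ D VD →
      (mm m k n B M D).Spec σ fun C τ cost => Rep τ C (VB - VM * VD) ∧
        (cost : ℝ) ≤ c * (m + k) * (n + k) * (k : ℝ) ^ (ω - 2))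
    {r n : ℕ} {σ : List K} {L : Matrix (Fin r) (Fin r) ℕ} {B : Matrix (Fin r) (Fin n) ℕ}
    {VL : Matrix (Fin r) (Fin r) K} {VB : Matrix (Fin r) (Fin n) K} (hdiag : ∀ i, VL i i ≠ 0)
    (hlow : ∀ i j, i < j → VL i j = 0) (hL : Rep σ L VL) (hB : Rep σ B VB) :
    (solveLower mm r n L B).Spec σ fun X τ cost => (∃ VX, Rep τ X VX ∧ VL * VX = VB) ∧
      (cost : ℝ) ≤ (c + 1) / (1 - halvingRatio (ω - 2)) * (r : ℝ) ^ (ω - 1) * (r + n) := by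
  have hα : 0 < ω - 2 := by linarith
  have hθ := halvingRatio_lt_one hα
  have hθ0 : 0 ≤ halvingRatio (ω - 2) := halvingRatio_nonneg
  set C := (c + 1) / (1 - halvingRatio (ω - 2)) with hCdef
  have hCeq : C * (1 - halvingRatio (ω - 2)) = c + 1 := div_mul_cancel₀ _ (by linarith)
  have hC1 : 1 ≤ C := by
    rw [hCdef, le_div_iff₀ (by linarith)]
    linarith
  induction r using Nat.strong_induction_on generalizing σ with
  | _ r ih =>
  rw [solveLower]
  split_ifs with hr
  · refine (Prog.spec_forFin_arith .div hB (B := Matrix.of fun i _ => L i i)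
      (W := Matrix.of fun i _ => VL i i) (fun i j => hL i i)).bind ?_
    rintro X τ cost _ ⟨hX, hcost⟩
    refine Prog.Spec.pure ⟨⟨_, hX, ?_⟩, ?_⟩
    · ext i j
      rw [Matrix.mul_apply, Finset.sum_eq_single i]
      · simp only [of_apply, ArithOp.eval]
        exact mul_div_cancel₀ _ (hdiag i)
      · intro b _ hb
        exact absurd (Fin.ext (by omega)) hb
      · simp
    · rw [add_zero]
      refine hcost.trans ?_
      rcases Nat.le_one_iff_eq_zero_or_eq_one.1 hr with rfl | rfl
      · rw [Nat.cast_zero, Real.zero_rpow (by linarith)]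
        simp
      · simp only [Nat.cast_one, Real.one_rpow, mul_one, one_mul]
        nlinarith [Nat.cast_nonneg (α := ℝ) n]
  have hr2 : 2 ≤ r := by omega
  refine (ih (r / 2) (by omega) (VL := VL.submatrix (colLeft r) (colLeft r))
    (VB := VB.submatrix (colLeft r) id) (fun i => hdiag _)
    (fun i j hij => hlow _ _ ((colLeft r).lt_iff_lt.2 hij)) (hL.submatrix _ _)
    (hB.submatrix _ _)).bind ?_
  rintro X₁ σ₁ c₁ h₁ ⟨⟨VX₁, hX₁, hVX₁⟩, hc₁⟩
  refine (hmm _ _ _ σ₁ _ _ _ _ _ _ ((hB.mono h₁).submatrix (colRight r) id)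
    ((hL.mono h₁).submatrix (colRight r) (colLeft r)) hX₁).bind ?_
  rintro Y σ₂ c₂ h₂ ⟨hY, hc₂⟩
  refine (ih (r - r / 2) (by omega) (VL := VL.submatrix (colRight r) (colRight r))
    (fun i => hdiag _) (fun i j hij => hlow _ _ ((colRight r).lt_iff_lt.2 hij))
    ((hL.mono (h₁.trans h₂)).submatrix _ _) hY).bind ?_
  rintro X₂ σ₃ c₃ h₃ ⟨⟨VX₂, hX₂, hVX₂⟩, hc₃⟩
  refine Prog.Spec.pure ⟨⟨(fromRows VX₁ VX₂).submatrix (colSplit r) id,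
    ((hX₁.mono (h₂.trans h₃)).fromRows hX₂).submatrix _ _, ?_⟩, ?_⟩
  · ext i j
    rw [Matrix.mul_apply, sum_colSplit]
    simp only [submatrix_apply, colSplit_colLeft, colSplit_colRight, fromRows_apply_inl,
      fromRows_apply_inr, id]
    induction i using col_cases with
    | h₁ i =>
      have e := congrFun (congrFun hVX₁ i) j
      simp only [Matrix.mul_apply, submatrix_apply, id] at e
      rw [e, add_eq_left]
      refine Finset.sum_eq_zero fun k _ => ?_
      rw [hlow, zero_mul]
      rw [Fin.lt_def, val_colLeft, val_colRight]
      omega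
    | h₂ i =>
      have e := congrFun (congrFun hVX₂ i) j
      simp only [Matrix.mul_apply, submatrix_apply, Matrix.sub_apply, id] at e
      rw [e]
      ring
  · obtain ⟨hh₁, hh₂⟩ := half_le_two_thirds hr2
    have hsum : ((r / 2 : ℕ) : ℝ) + (r - r / 2 : ℕ) = r := by
      rw [← Nat.cast_add]
      congr 1
      omega
    have hrec := halving_rpow hα (Nat.cast_nonneg (r / 2)) (Nat.cast_nonneg (r - r / 2)) hh₁ hh₂
      hsum
    rw [natCast_rpow_sub_one hω] at hc₁ hc₃ ⊢
    have ha : (0 : ℝ) ≤ (r / 2 : ℕ) := Nat.cast_nonneg _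
    have hb : (0 : ℝ) ≤ (r - r / 2 : ℕ) := Nat.cast_nonneg _
    have hmono : ((r / 2 : ℕ) : ℝ) ^ (ω - 2) ≤ (r : ℝ) ^ (ω - 2) :=
      Real.rpow_le_rpow ha (by linarith) hα.le
    have hx0 : 0 ≤ ((r / 2 : ℕ) : ℝ) ^ (ω - 2) := Real.rpow_nonneg ha _
    have hy0 : 0 ≤ ((r - r / 2 : ℕ) : ℝ) ^ (ω - 2) := Real.rpow_nonneg hb _
    have hz0 : 0 ≤ (r : ℝ) ^ (ω - 2) := Real.rpow_nonneg (Nat.cast_nonneg r) _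
    push_cast
    generalize ((r / 2 : ℕ) : ℝ) ^ (ω - 2) = x at *
    generalize ((r - r / 2 : ℕ) : ℝ) ^ (ω - 2) = y at *
    generalize (r : ℝ) ^ (ω - 2) = z at *
    generalize ((r / 2 : ℕ) : ℝ) = a at *
    generalize ((r - r / 2 : ℕ) : ℝ) = b at *
    generalize halvingRatio (ω - 2) = θ at *
    have hn0 : (0 : ℝ) ≤ n := Nat.cast_nonneg n
    have hr0 : (0 : ℝ) ≤ r := Nat.cast_nonneg r
    have t₁ : (c₁ : ℝ) ≤ C * (a * x) * (r + n) :=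
      hc₁.trans (mul_le_mul_of_nonneg_left (by linarith) (by positivity))
    have t₃ : (c₃ : ℝ) ≤ C * (b * y) * (r + n) :=
      hc₃.trans (mul_le_mul_of_nonneg_left (by linarith) (by positivity))
    -- The two halves add up to `r`, so the first factor of the product bound is exactly `r`.
    have t₂ : (c₂ : ℝ) ≤ c * r * (n + r) * z := by
      refine hc₂.trans ?_
      gcongr <;> linarith
    have t₄ : (a * x + b * y) * (C * (r + n)) ≤ θ * (r * z) * (C * (r + n)) :=
      mul_le_mul_of_nonneg_right hrec (by positivity)
    have t₅ : 0 ≤ r * z * (r + n) := by positivity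
    have t₆ : C * (1 - θ) * (r * z * (r + n)) = (c + 1) * (r * z * (r + n)) := by rw [hCeq]
    nlinarith

end Solve

end QuasiSep

namespace QuasiSep

/-! ### Rank-sensitive Gaussian elimination by halving the columns. -/

section Pivoting

variable {K : Type u} [Field K]

/-- The first index of a non-zero entry. -/
def findNonzero : (m : ℕ) → (Fin m → ℕ) → Prog K (Option (Fin m))
  | 0, _ => pure none
  | m + 1, a => Prog.isZero (a 0) fun b =>
      if b then do
        let o ← findNonzero m fun i => a i.succ
        return o.map Fin.succ
      else pure (some 0)

theorem spec_findNonzero {m : ℕ} {a : Fin m → ℕ} {x : Fin m → K} {σ : List K}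
    (h : ∀ i, Holds σ (a i) (x i)) :
    (findNonzero m a).Spec σ fun o _ cost =>
      ((o = none ∧ ∀ i, x i = 0) ∨ ∃ i, o = some i ∧ x i ≠ 0 ∧ ∀ j, j < i → x j = 0) ∧
        (cost : ℝ) ≤ m := by
  classical
  induction m with
  | zero => exact Prog.Spec.pure ⟨Or.inl ⟨rfl, fun i => i.elim0⟩, by simp⟩
  | succ m ih =>
    by_cases h0 : x 0 = 0
    · have hs : ((findNonzero m fun i => a i.succ) >>= fun o =>
          (pure (o.map Fin.succ) : Prog K (Option (Fin (m + 1))))).Spec σ fun o _ cost =>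
            ((o = none ∧ ∀ i, x i = 0) ∨ ∃ i, o = some i ∧ x i ≠ 0 ∧ ∀ j, j < i → x j = 0) ∧
              (cost : ℝ) ≤ m := by
        refine (ih (x := fun i => x i.succ) fun i => h i.succ).bind ?_
        rintro o τ cost _ ⟨ho, hc⟩
        refine Prog.Spec.pure ⟨?_, by simpa using hc⟩
        rcases ho with ⟨rfl, ho⟩ | ⟨i, rfl, hi, hj⟩
        · exact Or.inl ⟨rfl, Fin.cases h0 ho⟩
        · refine Or.inr ⟨i.succ, rfl, hi, Fin.cases (fun _ => h0) fun j hlt => ?_⟩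
          exact hj j (Fin.succ_lt_succ_iff.1 hlt)
      rw [findNonzero, Prog.Spec, Prog.run]
      simp only [(h 0).getD, h0, decide_true, if_true]
      refine ⟨hs.1, ?_⟩
      push_cast
      linarith [hs.2]
    · rw [findNonzero, Prog.Spec, Prog.run]
      simp only [(h 0).getD, h0, decide_false, Bool.false_eq_true, if_false, Prog.run_pure]
      refine ⟨Or.inr ⟨0, rfl, h0, fun j hj => absurd hj (Fin.not_lt_zero j)⟩, ?_⟩
      push_cast
      linarith [Nat.cast_nonneg (α := ℝ) m]

/-- The pivots and the vectors of an elimination. -/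
structure Pivots (m n : ℕ) (X : Type*) where
  r : ℕ
  row : Fin r → Fin m
  col : Fin r → Fin n
  l : Matrix (Fin m) (Fin r) X
  u : Matrix (Fin r) (Fin n) X

/-- No pivot. -/
def Pivots.empty (m n : ℕ) (X : Type*) : Pivots m n X :=
  ⟨0, Fin.elim0, Fin.elim0, Matrix.of fun _ k => k.elim0, Matrix.of fun k => k.elim0⟩

theorem isElimination_zero {m n : ℕ} {W : Matrix (Fin m) (Fin n) K} (hW : ∀ i j, W i j = 0)
    (row : Fin 0 → Fin m) (col : Fin 0 → Fin n) (l : Matrix (Fin m) (Fin 0) K)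
    (u : Matrix (Fin 0) (Fin n) K) : IsElimination (fun _ _ => True) W row col l u :=
  ⟨fun _ k => k.elim0, fun k => k.elim0, fun k => k.elim0, fun _ k => k.elim0, fun k => k.elim0,
    fun k => k.elim0, fun k => k.elim0, fun k => k.elim0, fun i j _ => by simp [hW]⟩

/-- Gaussian elimination by halving the set of columns. -/
noncomputable def eliminate
    (mm : (m k n : ℕ) → Matrix (Fin m) (Fin n) ℕ → Matrix (Fin m) (Fin k) ℕ →
      Matrix (Fin k) (Fin n) ℕ → Prog K (Matrix (Fin m) (Fin n) ℕ))
    (m n : ℕ) (A : Matrix (Fin m) (Fin n) ℕ) : Prog K (Pivots m n ℕ) :=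
  if _h0 : n = 0 then pure (Pivots.empty m n ℕ)
  else if h1 : n = 1 then do
    let o ← findNonzero m fun i => A i ⟨0, by omega⟩
    match o with
    | none => return Pivots.empty m n ℕ
    | some i₀ => do
      let C ← Prog.forFin m fun i => Prog.forFin 1 fun _ =>
        Prog.arith .div (A i ⟨0, by omega⟩) (A i₀ ⟨0, by omega⟩) Prog.ret
      return ⟨1, fun _ => i₀, fun _ => ⟨0, by omega⟩, Matrix.of C, A.submatrix (fun _ => i₀) id⟩
  else do
    let d₁ ← eliminate mm m (n / 2) (A.submatrix id (colLeft n))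
    let D ← solveLower mm d₁.r _ (d₁.l.submatrix d₁.row id) (A.submatrix d₁.row (colRight n))
    let H ← mm m d₁.r _ (A.submatrix id (colRight n)) d₁.l D
    let d₂ ← eliminate mm m (n - n / 2) H
    let z ← Prog.const 0 Prog.ret
    return ⟨d₁.r + d₂.r, Fin.append d₁.row d₂.row,
      Fin.append (colLeft n ∘ d₁.col) (colRight n ∘ d₂.col),
      Matrix.of fun i => Fin.append (d₁.l i) (d₂.l i),
      Matrix.of fun k j => Fin.append (fun t => fromCols d₁.u D t (colSplit n j))
        (fun t => fromCols (constMatrix z) d₂.u t (colSplit n j)) k⟩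
termination_by n

/-- An elimination of the left half of the columns followed by an elimination of the residual. -/
theorem isElimination_columns {m n r₁ r₂ : ℕ} {W : Matrix (Fin m) (Fin n) K}
    {row₁ : Fin r₁ → Fin m} {col₁ : Fin r₁ → Fin (n / 2)} {l₁ : Matrix (Fin m) (Fin r₁) K}
    {u₁ : Matrix (Fin r₁) (Fin (n / 2)) K}
    (h₁ : IsElimination (fun _ _ => True) (W.submatrix id (colLeft n)) row₁ col₁ l₁ u₁)
    {D : Matrix (Fin r₁) (Fin (n - n / 2)) K}
    (hD : l₁.submatrix row₁ id * D = W.submatrix row₁ (colRight n))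
    {row₂ : Fin r₂ → Fin m} {col₂ : Fin r₂ → Fin (n - n / 2)} {l₂ : Matrix (Fin m) (Fin r₂) K}
    {u₂ : Matrix (Fin r₂) (Fin (n - n / 2)) K}
    (h₂ : IsElimination (fun _ _ => True) (W.submatrix id (colRight n) - l₁ * D) row₂ col₂ l₂ u₂) :
    IsElimination (fun _ _ => True) W (Fin.append row₁ row₂)
      (Fin.append (colLeft n ∘ col₁) (colRight n ∘ col₂))
      (Matrix.of fun i => Fin.append (l₁ i) (l₂ i))
      (Matrix.of fun k j => Fin.append (fun t => fromCols u₁ D t (colSplit n j))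
        (fun t => fromCols (0 : Matrix _ (Fin (n / 2)) K) u₂ t (colSplit n j)) k) := by
  have e₁ := h₁.widen (OrderIso.refl (Fin m)).toOrderEmbedding (colLeft n)
    (fun i a hi => absurd ⟨i, rfl⟩ hi)
    (fun j a hj => by
      induction j using col_cases with
      | h₁ j => exact absurd ⟨j, rfl⟩ hj
      | h₂ j =>
        rw [Fin.lt_def, val_colLeft, val_colRight]
        omega)
    (l' := l₁) (u' := (fromCols u₁ D).submatrix id (colSplit n))
    (fun i k => rfl) (fun k j => by simp)
  have e₂ : IsElimination (fun _ _ => True)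
      ((fromCols (0 : Matrix (Fin m) (Fin (n / 2)) K)
        (W.submatrix id (colRight n) - l₁ * D)).submatrix id (colSplit n))
      ((OrderIso.refl (Fin m)).toOrderEmbedding ∘ row₂) (colRight n ∘ col₂) l₂
      ((fromCols (0 : Matrix _ (Fin (n / 2)) K) u₂).submatrix id (colSplit n)) := by
    refine h₂.embed (OrderIso.refl (Fin m)).toOrderEmbedding (colRight n) (fun i j => Iff.rfl)
      (fun i k => rfl) (fun i k hi => absurd ⟨i, rfl⟩ hi) (fun k j => by simp) ?_ ?_ ?_
    · intro k j hj
      induction j using col_cases with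
      | h₁ j => simp
      | h₂ j => exact absurd ⟨j, rfl⟩ hj
    · intro i j
      simp
    · intro i j _ hij
      induction j using col_cases with
      | h₁ j => simp
      | h₂ j => exact absurd ⟨j, rfl⟩ (hij.resolve_left fun hi => hi ⟨i, rfl⟩)
  refine e₁.append e₂ (fun t j _ => ?_) (fun t i _ => by simp) (fun i j _ => ?_)
  · induction j using col_cases with
    | h₁ j => simp
    | h₂ j =>
      have := congrFun (congrFun hD t) j
      simp only [Matrix.mul_apply, submatrix_apply, id] at this
      simp [Matrix.mul_apply, this]
  · induction j using col_cases with
    | h₁ j =>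
      have := h₁.eq i j trivial
      simp only [submatrix_apply, id] at this
      simp [Matrix.mul_apply, this]
    | h₂ j => simp [Matrix.mul_apply]

/-- The separate term `m * n` pays for the zero tests, which are needed even at rank zero, where `0
^ (ω - 2) = 0`; it is additive over the two halves. In `C`, the part `c'` covers the triangular
solve and `2 * c` the product, whose factor `m + r` is at most `2 * m`. -/
theorem spec_eliminate
    {mm : (m k n : ℕ) → Matrix (Fin m) (Fin n) ℕ → Matrix (Fin m) (Fin k) ℕ →
      Matrix (Fin k) (Fin n) ℕ → Prog K (Matrix (Fin m) (Fin n) ℕ)} {ω c c' C : ℝ} (hω : 2 < ω)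
    (hc : 0 ≤ c)
    (hmm : ∀ m k n σ B M D VB VM VD, Rep σ B VB → Rep σ M VM → Rep σ D VD →
      (mm m k n B M D).Spec σ fun C τ cost => Rep τ C (VB - VM * VD) ∧
        (cost : ℝ) ≤ c * (m + k) * (n + k) * (k : ℝ) ^ (ω - 2))
    (hc' : c' = (c + 1) / (1 - halvingRatio (ω - 2)))
    (hC : C = (c' + 2 * c + 1) / (1 - halvingRatio (ω - 2)))
    {m n : ℕ} {σ : List K} {A : Matrix (Fin m) (Fin n) ℕ} {W : Matrix (Fin m) (Fin n) K}
    (hA : Rep σ A W) :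
    (eliminate mm m n A).Spec σ fun d τ cost =>
      (∃ l u, IsElimination (fun _ _ => True) W d.row d.col l u ∧ Rep τ d.l l ∧ Rep τ d.u u) ∧
        (cost : ℝ) ≤ C * m * n * (d.r : ℝ) ^ (ω - 2) + m * n := by
  have hα : 0 < ω - 2 := by linarith
  have hθ := halvingRatio_lt_one hα
  have hθ0 : 0 ≤ halvingRatio (ω - 2) := halvingRatio_nonneg
  have hc'0 : 0 ≤ c' := by
    rw [hc']
    exact div_nonneg (by linarith) (by linarith)
  have hCeq : C * (1 - halvingRatio (ω - 2)) = c' + 2 * c + 1 := by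
    rw [hC]
    exact div_mul_cancel₀ _ (by linarith)
  have hC1 : 1 ≤ C := by
    rw [hC, le_div_iff₀ (by linarith)]
    linarith
  induction n using Nat.strong_induction_on generalizing σ with
  | _ n ih =>
  rw [eliminate]
  split_ifs with h0 h1
  · subst h0
    refine Prog.Spec.pure ⟨⟨0, 0, isElimination_zero (fun i j => j.elim0) _ _ _ _, ?_, ?_⟩, ?_⟩
    · exact fun i k => k.elim0
    · exact fun k => k.elim0
    · simp
  · subst h1
    refine (spec_findNonzero fun i => hA i _).bind ?_
    rintro o σ₁ c₁ h₁ ⟨ho, hc₁⟩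
    rcases ho with ⟨rfl, hz⟩ | ⟨i₀, rfl, hi, hj⟩
    · refine Prog.Spec.pure ⟨⟨0, 0, isElimination_zero (fun i j => ?_) _ _ _ _, ?_, ?_⟩, ?_⟩
      · rw [Subsingleton.elim j ⟨0, by omega⟩]
        exact hz i
      · exact fun i k => k.elim0
      · exact fun k => k.elim0
      -- A zero column costs `m` tests and yields no pivot: only the additive term pays.
      · simpa [Pivots.empty, Real.zero_rpow hα.ne'] using hc₁
    · refine (Prog.spec_forFin_arith .div ((hA.mono h₁).submatrix id (fun _ : Fin 1 => 0))
        (((hA.mono h₁).submatrix (fun _ : Fin m => i₀) (fun _ : Fin 1 => 0)))).bind ?_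
      rintro X σ₂ c₂ h₂ ⟨hX, hc₂⟩
      refine Prog.Spec.pure ⟨⟨_, W.submatrix (fun _ => i₀) id, ?_, hX,
        ((hA.mono (h₁.trans h₂)).submatrix _ _)⟩, ?_⟩
      · refine ⟨fun i k hlt => ?_, fun k => ?_, fun t k hlt => ?_, fun i k hn => absurd trivial hn,
          fun k j hlt => ?_, fun k => ?_, fun t k hlt => ?_, fun i k hn => absurd trivial hn,
          fun i j _ => ?_⟩
        -- Taking the first nonzero entry as pivot is what makes `l_lower` hold.
        · have := hj i hlt
          simp only [of_apply, ArithOp.eval, submatrix_apply, id]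
          rw [show W i 0 = 0 from this, zero_div]
        · simp only [of_apply, ArithOp.eval, submatrix_apply, id]
          exact div_self hi
        · exact absurd hlt (by rw [Subsingleton.elim (α := Fin 1) t k]; exact lt_irrefl _)
        · exact absurd hlt (by rw [Fin.lt_def]; simp)
        · exact hi
        · exact absurd hlt (by rw [Subsingleton.elim (α := Fin 1) t k]; exact lt_irrefl _)
        · rw [Subsingleton.elim j 0]
          simp only [of_apply, ArithOp.eval, submatrix_apply, id, Finset.univ_unique,
            Finset.sum_singleton]
          exact (div_mul_cancel₀ _ hi).symm
      · push_cast
        simp only [Nat.cast_one, mul_one, Real.one_rpow] at hc₂ ⊢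
        nlinarith [Nat.cast_nonneg (α := ℝ) m]
  have hn2 : 2 ≤ n := by omega
  refine (ih (n / 2) (by omega) (hA.submatrix id (colLeft n))).bind ?_
  rintro d₁ σ₁ c₁ h₁ ⟨⟨l₁, u₁, el₁, hl₁, hu₁⟩, hc₁⟩
  refine (spec_solveLower hω hc hmm (VL := l₁.submatrix d₁.row id)
    (fun i => (el₁.l_diag i).trans_ne one_ne_zero) (fun i j hij => el₁.l_tri i j hij)
    (hl₁.submatrix d₁.row id) ((hA.mono h₁).submatrix d₁.row (colRight n))).bind ?_
  rintro D σ₂ c₂ h₂ ⟨⟨VD, hD, hVD⟩, hc₂⟩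
  refine (hmm _ _ _ σ₂ _ _ _ _ _ _ ((hA.mono (h₁.trans h₂)).submatrix id (colRight n))
    (hl₁.mono h₂) hD).bind ?_
  rintro H σ₃ c₃ h₃ ⟨hH, hc₃⟩
  refine (ih (n - n / 2) (by omega) hH).bind ?_
  rintro d₂ σ₄ c₄ h₄ ⟨⟨l₂, u₂, el₂, hl₂, hu₂⟩, hc₄⟩
  refine (Prog.spec_const 0 σ₄).bind ?_
  rintro z σ₅ _ h₅ ⟨hz, rfl⟩
  refine Prog.Spec.pure ⟨⟨_, _, isElimination_columns el₁ hVD el₂, ?_, ?_⟩, ?_⟩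
  · intro i k
    induction k using Fin.addCases with
    | left k => simpa using (hl₁.mono (h₂.trans (h₃.trans (h₄.trans h₅)))) i k
    | right k => simpa using (hl₂.mono h₅) i k
  · intro k j
    have e₁ := (hu₁.mono (h₂.trans (h₃.trans (h₄.trans h₅)))).fromCols
      (hD.mono (h₃.trans (h₄.trans h₅)))
    have e₂ := (rep_zero (ι := Fin d₂.r) (κ := Fin (n / 2)) hz).fromCols (hu₂.mono h₅)
    induction k using Fin.addCases with
    | left k => simpa using e₁ k (colSplit n j)
    | right k => simpa using e₂ k (colSplit n j)
  · obtain ⟨hh₁, hh₂⟩ := half_le_two_thirds hn2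
    have hsum : ((n / 2 : ℕ) : ℝ) + (n - n / 2 : ℕ) = n := by
      rw [← Nat.cast_add]
      congr 1
      omega
    -- The weights are the column counts of the halves, and the arguments are the ranks found in
    -- them.
    have hrec := halving_mul_rpow hα (Nat.cast_nonneg (n / 2)) (Nat.cast_nonneg (n - n / 2)) hh₁
      hh₂ hsum (Nat.cast_nonneg d₁.r) (Nat.cast_nonneg d₂.r)
    have hrm : (d₁.r : ℝ) ≤ m := by exact_mod_cast le_of_fin_injective el₁.row_injective
    have hrn : (d₁.r : ℝ) ≤ (n / 2 : ℕ) := by exact_mod_cast le_of_fin_injective el₁.col_injective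
    rw [← hc', natCast_rpow_sub_one hω] at hc₂
    have hr0 : (0 : ℝ) ≤ d₁.r := Nat.cast_nonneg _
    have hb : (0 : ℝ) ≤ (n - n / 2 : ℕ) := Nat.cast_nonneg _
    have hmono : (d₁.r : ℝ) ^ (ω - 2) ≤ ((d₁.r : ℝ) + d₂.r) ^ (ω - 2) :=
      Real.rpow_le_rpow hr0 (by linarith [Nat.cast_nonneg (α := ℝ) d₂.r]) hα.le
    have hx0 : 0 ≤ (d₁.r : ℝ) ^ (ω - 2) := Real.rpow_nonneg hr0 _
    push_cast
    generalize (d₁.r : ℝ) ^ (ω - 2) = x at *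
    generalize (d₂.r : ℝ) ^ (ω - 2) = y at *
    generalize ((d₁.r : ℝ) + d₂.r) ^ (ω - 2) = w at *
    generalize ((n / 2 : ℕ) : ℝ) = a at *
    generalize ((n - n / 2 : ℕ) : ℝ) = b at *
    generalize (d₁.r : ℝ) = r at *
    generalize halvingRatio (ω - 2) = θ at *
    have hm0 : (0 : ℝ) ≤ m := Nat.cast_nonneg m
    have hn0 : (0 : ℝ) ≤ n := Nat.cast_nonneg n
    have hw0 : 0 ≤ w := hx0.trans hmono
    have t₂ : (c₂ : ℝ) ≤ c' * (m * w) * n := by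
      refine hc₂.trans ?_
      gcongr
      linarith
    have t₃ : (c₃ : ℝ) ≤ c * (2 * m) * n * w := by
      refine hc₃.trans ?_
      gcongr <;> linarith
    have t₄ : (a * x + b * y) * (C * m) ≤ θ * (n * w) * (C * m) :=
      mul_le_mul_of_nonneg_right hrec (by positivity)
    have t₅ : 0 ≤ m * n * w := mul_nonneg (mul_nonneg hm0 hn0) hw0
    have t₆ : C * (1 - θ) * (m * n * w) = (c' + 2 * c + 1) * (m * n * w) := by rw [hCeq]
    have t₇ : (m : ℝ) * a + m * b = m * n := by rw [← mul_add, hsum]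
    nlinarith

end Pivoting

/-! ### Correct subroutines within the required costs, from square matrix multiplication. -/

section FastSubroutines

variable {K : Type u} [Field K]

open Classical in
/-- The decomposition given by the pivots of an elimination. -/
noncomputable def Pivots.toPLUQ {m n : ℕ} {X : Type*} (d : Pivots m n X) : PLUQ m n X :=
  if h : Function.Injective d.row ∧ Function.Injective d.col then
    PLUQ.ofPivots d.row d.col h.1 h.2 d.l d.u
  else PLUQ.ofPivots Fin.elim0 Fin.elim0 (fun k => k.elim0) (fun k => k.elim0)
    (Matrix.of fun _ k => k.elim0) (Matrix.of fun k => k.elim0)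

/-- Subroutines obtained from an algorithm for the products `B - M D`. -/
noncomputable def Subroutines.ofProduct
    (mm : (m k n : ℕ) → Matrix (Fin m) (Fin n) ℕ → Matrix (Fin m) (Fin k) ℕ →
      Matrix (Fin k) (Fin n) ℕ → Prog K (Matrix (Fin m) (Fin n) ℕ)) : Subroutines K where
  pluq m n A := do
    let d ← eliminate mm m n A
    return d.toPLUQ
  trsmLower r n L B := solveLower mm r n L B
  trsmUpper m r C U := do
    let X ← solveLower mm r m Uᵀ Cᵀ
    return Xᵀ
  mm := mm

/-- The constants are fixed before the field is introduced, hence depend only on `ω` and `c`.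
Products cost `c + 1`, which replaces `c` in the constants `c'` and `C` of the solver and of the
elimination; their sum `C₀` dominates all of them. -/
theorem exists_subroutines {ω : ℝ} (hω : 2 < ω) {c : ℝ} (hc : 0 ≤ c) :
    ∃ C : ℝ, 0 ≤ C ∧ ∀ (K : Type u) [Field K], MatMulIn K ω c →
      ∃ S : Subroutines K, S.Correct ∧ S.CostIn ω C := by
  have hα : 0 < ω - 2 := by linarith
  have hθ := halvingRatio_lt_one hα
  obtain ⟨c', hc'⟩ : ∃ c', c' = (c + 1 + 1) / (1 - halvingRatio (ω - 2)) := ⟨_, rfl⟩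
  obtain ⟨C, hC⟩ : ∃ C, C = (c' + 2 * (c + 1) + 1) / (1 - halvingRatio (ω - 2)) := ⟨_, rfl⟩
  have hc'0 : 0 ≤ c' := by
    rw [hc']
    exact div_nonneg (by linarith) (by linarith)
  have hC0 : 0 ≤ C := by
    rw [hC]
    exact div_nonneg (by linarith) (by linarith)
  obtain ⟨C₀, hC₀⟩ : ∃ C₀, C₀ = C + 1 + c' + (c + 1) := ⟨_, rfl⟩
  have hle₁ : C + 1 ≤ C₀ := by linarith
  have hle₂ : c' ≤ C₀ := by linarith
  have hle₃ : c + 1 ≤ C₀ := by linarith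
  refine ⟨C₀, by linarith, fun K _ hmul => ?_⟩
  choose mul hmul using hmul
  have hmm := fun m k n σ B M D VB VM VD hB hM hD =>
    spec_tiledMul (m := m) (k := k) (n := n) (σ := σ) (B := B) (M := M) (D := D) (VB := VB)
      (VM := VM) (VD := VD) hω hc hmul hB hM hD
  have hsolve := fun r n σ L B VL VB hd hl hL hB =>
    spec_solveLower (r := r) (n := n) (σ := σ) (L := L) (B := B) (VL := VL) (VB := VB) hω
      (by linarith) hmm hd hl hL hB
  rw [← hc'] at hsolve
  have helim := fun m n σ A W hA =>
    spec_eliminate (m := m) (n := n) (σ := σ) (A := A) (W := W) hω (by linarith) hmm hc' hC hA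
  refine ⟨Subroutines.ofProduct (tiledMul mul), ⟨?_, ?_, ?_, ?_⟩, ⟨?_, ?_, ?_, ?_⟩⟩
  · intro m n σ A W hA
    have : (Subroutines.ofProduct (tiledMul mul)).pluq m n A |>.Spec σ fun d τ _ =>
        ∃ L M U V, Rep τ d.L L ∧ Rep τ d.M M ∧ Rep τ d.U U ∧ Rep τ d.V V ∧
          (⟨d.r, d.p, d.q, L, M, U, V⟩ : PLUQ m n K).Reveals W := by
      refine (helim m n σ A W hA).bind ?_
      rintro d τ cost _ ⟨⟨l, u, el, hl, hu⟩, _⟩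
      refine Prog.Spec.pure ?_
      -- The pivots of an elimination are injective, so the fallback branch of `Pivots.toPLUQ` is
      -- never reached.
      rw [Pivots.toPLUQ, dif_pos ⟨el.row_injective, el.col_injective⟩]
      exact ⟨_, _, _, _, hl.submatrix _ _, hl.submatrix _ _, hu.submatrix _ _, hu.submatrix _ _,
        el.reveals⟩
    exact this
  · intro r n σ L B VL VB hVL hL hB
    obtain ⟨⟨VX, hX, hVX⟩, _⟩ := hsolve r n σ L B VL VB
      (fun i => by rw [hVL.1]; exact one_ne_zero) hVL.2 hL hB
    rw [← hVX, ← Matrix.mul_assoc, Matrix.nonsing_inv_mul _ hVL.isUnit_det, Matrix.one_mul]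
    exact hX
  · intro m r σ C U VC VU hVU hC hU
    have : (Subroutines.ofProduct (tiledMul mul)).trsmUpper m r C U |>.Spec σ fun X τ _ =>
        Rep τ X (VC * VU⁻¹) := by
      refine (hsolve r m σ Uᵀ Cᵀ VUᵀ VCᵀ hVU.1 (fun i j hij => hVU.2 j i hij) hU.transpose
        hC.transpose).bind ?_
      rintro X τ cost _ ⟨⟨VX, hX, hVX⟩, _⟩
      refine Prog.Spec.pure ?_
      -- Solving `X U = C` from the right is solving the transposed lower triangular system.
      have : VC * VU⁻¹ = VXᵀ := by
        rw [← Matrix.transpose_transpose VC, ← hVX, Matrix.transpose_mul,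
          Matrix.transpose_transpose, Matrix.mul_assoc, Matrix.mul_nonsing_inv _ hVU.isUnit_det,
          Matrix.mul_one]
      rw [this]
      exact hX.transpose
    exact this
  · intro m k n σ B M D VB VM VD hB hM hD
    exact (hmm m k n σ B M D VB VM VD hB hM hD).1
  · intro m n σ A W hA
    have : (Subroutines.ofProduct (tiledMul mul)).pluq m n A |>.Spec σ fun _ _ cost =>
        (cost : ℝ) ≤ C * m * n * (W.rank : ℝ) ^ (ω - 2) + m * n := by
      refine (helim m n σ A W hA).bind ?_
      rintro d τ cost _ ⟨⟨l, u, el, hl, hu⟩, hcost⟩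
      refine Prog.Spec.pure ?_
      rw [el.rank_eq]
      exact hcost
    refine le_trans this ?_
    have h1 : (W.rank : ℝ) ^ (ω - 2) ≤ ((max W.rank 1 : ℕ) : ℝ) ^ (ω - 2) :=
      Real.rpow_le_rpow (Nat.cast_nonneg _) (by exact_mod_cast le_max_left _ _) hα.le
    have h2 : 1 ≤ ((max W.rank 1 : ℕ) : ℝ) ^ (ω - 2) :=
      Real.one_le_rpow (by exact_mod_cast le_max_right _ _) hα.le
    generalize ((max W.rank 1 : ℕ) : ℝ) ^ (ω - 2) = x at *
    calc C * m * n * (W.rank : ℝ) ^ (ω - 2) + m * n ≤ C * m * n * x + m * n * x :=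
          add_le_add (mul_le_mul_of_nonneg_left h1 (by positivity))
            (le_mul_of_one_le_right (by positivity) h2)
      _ = (C + 1) * m * n * x := by ring
      _ ≤ _ := by gcongr
  · intro r n σ L B VL VB hVL hL hB
    refine (hsolve r n σ L B VL VB (fun i => by rw [hVL.1]; exact one_ne_zero) hVL.2 hL
      hB).2.trans ?_
    gcongr
  · intro m r σ C U VC VU hVU hC hU
    have : (Subroutines.ofProduct (tiledMul mul)).trsmUpper m r C U |>.Spec σ fun _ _ cost =>
        (cost : ℝ) ≤ c' * (r : ℝ) ^ (ω - 1) * (r + m) := by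
      refine (hsolve r m σ Uᵀ Cᵀ VUᵀ VCᵀ hVU.1 (fun i j hij => hVU.2 j i hij) hU.transpose
        hC.transpose).bind ?_
      rintro X τ cost _ ⟨_, hcost⟩
      exact Prog.Spec.pure hcost
    refine le_trans this ?_
    rw [add_comm (r : ℝ)]
    gcongr
  · intro m k n σ B M D VB VM VD hB hM hD
    refine (hmm m k n σ B M D VB VM VD hB hM hD).2.trans ?_
    have hC₀0 : 0 ≤ C₀ := by linarith
    gcongr
    exact le_max_left _ _

end FastSubroutines

theorem MatMulIn.mono {K : Type u} [Field K] {ω c c' : ℝ} (h : MatMulIn K ω c) (hc : c ≤ c') :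
    MatMulIn K ω c' := by
  intro n
  obtain ⟨mul, hmul⟩ := h n
  refine ⟨mul, fun σ A B VA VB hA hB => ⟨(hmul σ A B VA VB hA hB).1,
    (hmul σ A B VA VB hA hB).2.trans ?_⟩⟩
  gcongr

theorem cost_ltBruhat_le {K : Type u} [Field K] {S : Subroutines K} {ω c : ℝ} (hω : 2 < ω)
    (hc : 0 ≤ c) (hS : S.Correct) (hcost : S.CostIn ω c) {n : ℕ} {σ : List K}
    {A : Matrix (Fin n) (Fin n) ℕ} {W : Matrix (Fin n) (Fin n) K} (hA : Rep σ A W) :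
    (((ltBruhat S n A).run σ).cost : ℝ) ≤ 8 / 3 * (5 * c + 2) *
      ((max (quasiOrder (leftPart 0 W)) 1 : ℕ) : ℝ) ^ (ω - 2) * (n : ℝ) ^ 2 := by
  rw [quasiOrder_leftPart]
  have := (spec_ltBruhat hS hω n σ A W hA).2 c hc hcost _ le_rfl
  rwa [← mul_assoc] at this

end QuasiSep

theorem mainTheorem2 (ω : ℝ) (hω : 2 < ω) :
    -- whatever correct subroutines are used, the output is a Bruhat generator of `Left(W)`
    (∀ (K : Type u) [Field K] (S : QuasiSep.Subroutines K), S.Correct →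
      ∀ (n : ℕ) (σ : List K) (A : Matrix (Fin n) (Fin n) ℕ) (W : Matrix (Fin n) (Fin n) K),
        QuasiSep.Rep σ A W →
          ∃ T : QuasiSep.Triple n K,
            QuasiSep.Rep ((QuasiSep.ltBruhat S n A).run σ).mem
              ((QuasiSep.ltBruhat S n A).run σ).val.L T.L ∧
            QuasiSep.Rep ((QuasiSep.ltBruhat S n A).run σ).mem
              ((QuasiSep.ltBruhat S n A).run σ).val.E T.E ∧
            QuasiSep.Rep ((QuasiSep.ltBruhat S n A).run σ).mem
              ((QuasiSep.ltBruhat S n A).run σ).val.U T.U ∧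
            QuasiSep.IsBruhatGenerator (QuasiSep.leftPart 0 W) T) ∧
    -- for all correct subroutines of the usual costs, the cost is `O(s ^ (ω - 2) n ^ 2)`
    (∀ c : ℝ, ∃ C : ℝ, ∀ (K : Type u) [Field K] (S : QuasiSep.Subroutines K),
      S.Correct → S.CostIn ω c →
        ∀ (n : ℕ) (σ : List K) (A : Matrix (Fin n) (Fin n) ℕ) (W : Matrix (Fin n) (Fin n) K),
          QuasiSep.Rep σ A W →
            (((QuasiSep.ltBruhat S n A).run σ).cost : ℝ) ≤
              C * ((max (QuasiSep.quasiOrder (QuasiSep.leftPart 0 W)) 1 : ℕ) : ℝ) ^ (ω - 2)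
                * (n : ℝ) ^ 2) ∧
    -- and such subroutines exist as soon as matrices can be multiplied in `O(n ^ ω)`
    (∀ c : ℝ, ∃ C : ℝ, ∀ (K : Type u) [Field K], QuasiSep.MatMulIn K ω c →
      ∃ S : QuasiSep.Subroutines K, S.Correct ∧ S.CostIn ω C ∧
        ∀ (n : ℕ) (σ : List K) (A : Matrix (Fin n) (Fin n) ℕ) (W : Matrix (Fin n) (Fin n) K),
          QuasiSep.Rep σ A W →
            (((QuasiSep.ltBruhat S n A).run σ).cost : ℝ) ≤
              C * ((max (QuasiSep.quasiOrder (QuasiSep.leftPart 0 W)) 1 : ℕ) : ℝ) ^ (ω - 2)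
                * (n : ℝ) ^ 2) := by
  refine ⟨?_, ?_, ?_⟩
  · intro K _ S hS n σ A W hA
    obtain ⟨⟨r, row, col, l, u, el, hL, hE, hU⟩, _⟩ := QuasiSep.spec_ltBruhat hS hω n σ A W hA
    exact ⟨⟨_, _, _⟩, hL, hE, hU, el.isBruhatGenerator⟩
  · intro c
    -- The given constant may be negative, while the cost estimates need a nonnegative one.
    refine ⟨8 / 3 * (5 * max c 0 + 2), fun K _ S hS hcost n σ A W hA => ?_⟩
    exact QuasiSep.cost_ltBruhat_le hω (le_max_right _ _) hS (hcost.mono (le_max_left _ _)) hA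
  · intro c
    obtain ⟨C, hC, hex⟩ := QuasiSep.exists_subroutines hω (le_max_right c 0)
    refine ⟨8 / 3 * (5 * C + 2), fun K _ hmul => ?_⟩
    obtain ⟨S, hS, hcost⟩ := hex K (hmul.mono (le_max_left _ _))
    refine ⟨S, hS, hcost.mono (by linarith), fun n σ A W hA => ?_⟩
    exact QuasiSep.cost_ltBruhat_le hω hC hS hcost hA
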